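/- Let $1\le m\le n$, and let $\beta=i\sum_j dz_j\wedge d\bar z_j$ on $\mathbb C^n$. Upper semicontinuous (usc) functions take values in $[-\infty,\infty)$; the value $-\infty$ is allowed everywhere or on whole components. Let $\Gamma_m$ be the set of constant real $(1,1)$-forms $\alpha$ with $\alpha^k\wedge\beta^{n-k}\ge 0$ for $k=1,\dots,m$. A function $u$ on an open set $U\subset\mathbb C^n$ is $m$-subharmonic, $u\in\mathcal{SH}_m(U)$, if it is subharmonic (usc, with the sub-mean value inequality; $u\equiv-\infty$ is allowed) and, on each component of $U$ on which $u\not\equiv-\infty$, $dd^c u\wedge\alpha_1\wedge\dots\wedge\alpha_{m-1}\wedge\beta^{n-m}\ge 0$ in the sense of currents for all $\alpha_1,\dots,\alpha_{m-1}\in\Gamma_m$. For a compact set $X\subset\mathbb C^n$, let $\mathcal{SH}_m^o(X)$ be the set of restrictions to $X$ of real-valued functions that are continuous and $m$-subharmonic on some open neighborhood of $X$. For $z\in X$, let $\mathcal J_z^m(X)$ be the set of regular Borel probability measures $\mu$ on $X$ with $u(z)\le\int_X u\,d\mu$ for all $u\in\mathcal{SH}_m^o(X)$. Let $\mathcal{SH}_m(X)$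 be the set of usc functions $u:X\to[-\infty,\infty)$ with $u(z)\le\int_X u\,d\mu$ for all $z\in X$ and all $\mu\in\mathcal J_z^m(X)$. **Theorem.** Let $\Omega\subset\mathbb C^n$ be a bounded open set. 1. If $\varphi\in\mathcal{SH}_m(\bar\Omega)$, then $\varphi|_\Omega\in\mathcal{SH}_m(\Omega)$ and $\varphi|_{\partial\Omega}\in\mathcal{SH}_m(\partial\Omega)$. 2. Let $\varphi:\bar\Omega\to[-\infty,\infty)$ be usc on $\bar\Omega$ with $\varphi|_\Omega\in\mathcal{SH}_m(\Omega)$. If $$\varphi(z)\le\int_{\bar\Omega}\varphi\,d\mu\qquad\text{for all } z\in\partial\Omega \text{ and all } \mu\in\mathcal J_z^m(\bar\Omega),$$ then $\varphi\in\mathcal{SH}_m(\bar\Omega)$. -/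

import Mathlib

open MeasureTheory Set
open scoped ENNReal ContDiff

noncomputable section

namespace MSubharmonic

/-- The space `ℂⁿ` with its Euclidean norm. -/
abbrev Cn (n : ℕ) : Type := EuclideanSpace ℂ (Fin n)

/-- The integral of an extended-real valued function: integral of the positive part minus integral
of the negative part. It is used only for functions that are bounded above, against finite
measures, so that the first term is finite and the value lies in `[-∞, ∞)`. -/
def eintegral {α : Type*} [MeasurableSpace α] (μ : Measure α) (u : α → EReal) : EReal :=
  ((∫⁻ x, (u x).toENNReal ∂μ : ℝ≥0∞) : EReal) - ((∫⁻ x, (-u x).toENNReal ∂μ : ℝ≥0∞) : EReal)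

/-- The average of `u` over the closed ball of center `z` and radius `r`, for Lebesgue measure on
`ℂⁿ = ℝ²ⁿ`. -/
def ballMean {n : ℕ} (u : Cn n → EReal) (z : Cn n) (r : ℝ) : EReal :=
  eintegral ((volume (Metric.closedBall z r))⁻¹ • volume.restrict (Metric.closedBall z r)) u

/-- The wedge product of `n` constant `(1,1)`-forms on `ℂⁿ`. A Hermitian matrix `A = (a_jk)` stands
for the real form `α = i ∑ a_jk dz_j ∧ dz̄_k`, and the identity matrix for `β = i ∑ dz_j ∧ dz̄_j`.
With this identification `α_0 ∧ ⋯ ∧ α_(n-1)` is a positive constant, which depends on `n` only,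
times `wedge A` times the volume form: both sides are symmetric and multilinear,
and for `α_0 = ⋯ = α_(n-1) = α` the right-hand side is `n! det A`. -/
def wedge {n : ℕ} (A : Fin n → Matrix (Fin n) (Fin n) ℂ) : ℝ :=
  (∑ σ : Equiv.Perm (Fin n), (Matrix.of fun i j => A (σ j) i j).det).re

/-- The cone `Γ_m` of constant real `(1,1)`-forms `α` with `α^k ∧ β^(n-k) ≥ 0` for
`k = 1, …, m`. -/
def Gam (n m : ℕ) : Set (Matrix (Fin n) (Fin n) ℂ) :=
  {A | A.IsHermitian ∧
    ∀ k : ℕ, 1 ≤ k → k ≤ m → 0 ≤ wedge (fun i : Fin n => if (i : ℕ) < k then A else 1)}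

/-- The `j`-th standard basis vector of `ℂⁿ`. -/
def basisVec {n : ℕ} (j : Fin n) : Cn n := EuclideanSpace.single j (1 : ℂ)

/-- The complex Hessian `(∂²η / ∂z_j ∂z̄_k)(z)` of a real function `η`, expressed through its real
second derivative in the directions `∂/∂x_j` (that is, `e_j`) and `∂/∂y_j` (that is, `i e_j`). -/
def complexHessian {n : ℕ} (η : Cn n → ℝ) (z : Cn n) : Matrix (Fin n) (Fin n) ℂ :=
  Matrix.of fun j k =>
    let D : Cn n → Cn n → ℝ := fun v w => iteratedFDeriv ℝ 2 η z ![v, w]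
    let e : Fin n → Cn n := basisVec
    let f : Fin n → Cn n := fun l => Complex.I • basisVec l
    (1 / 4 : ℂ) * (((D (e j) (e k) + D (f j) (f k) : ℝ) : ℂ)
      + Complex.I * ((D (e j) (f k) - D (f j) (e k) : ℝ) : ℂ))

/-- The coefficient of `dd^c η ∧ α_1 ∧ ⋯ ∧ α_(m-1) ∧ β^(n-m)` at `z` (up to a positive constant).
Only the entries `A_1, …, A_(m-1)` of `A` are used. -/
def hessWedge {n : ℕ} (m : ℕ) (A : Fin n → Matrix (Fin n) (Fin n) ℂ) (η : Cn n → ℝ)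
    (z : Cn n) : ℝ :=
  wedge fun i : Fin n =>
    if (i : ℕ) = 0 then complexHessian η z else if (i : ℕ) < m then A i else 1

/-- Subharmonic functions on an open set `U` of `ℂⁿ`: upper semicontinuous functions with values in
`[-∞, ∞)` that satisfy the sub-mean value inequality. The value `-∞` on a whole connected component
is allowed. -/
def IsSubharmonic {n : ℕ} (u : Cn n → EReal) (U : Set (Cn n)) : Prop :=
  (∀ z ∈ U, u z ≠ ⊤) ∧ UpperSemicontinuousOn u U ∧
    ∀ z ∈ U, ∀ r : ℝ, 0 < r → Metric.closedBall z r ⊆ U → u z ≤ ballMean u z r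

/-- `m`-subharmonic functions on an open set `U` of `ℂⁿ`: subharmonic functions `u` such that
`dd^c u ∧ α_1 ∧ ⋯ ∧ α_(m-1) ∧ β^(n-m) ≥ 0` in the sense of currents, for all
`α_1, …, α_(m-1) ∈ Γ_m`. The current is tested with smooth functions `η ≥ 0` of compact support in
`U`. A subharmonic function is either locally integrable or identically `-∞` on each connected
component of `U`; the integrability clauses leave out exactly the `η` whose support meets a
component of the second kind. -/
def IsMSubharmonic {n : ℕ} (m : ℕ) (u : Cn n → EReal) (U : Set (Cn n)) : Prop :=
  IsSubharmonic u U ∧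
    ∀ A : Fin n → Matrix (Fin n) (Fin n) ℂ, (∀ i, A i ∈ Gam n m) →
      ∀ η : Cn n → ℝ, ContDiff ℝ ∞ η → HasCompactSupport η → tsupport η ⊆ U → (∀ z, 0 ≤ η z) →
        (∀ᵐ z ∂(volume.restrict (tsupport η)), u z ≠ ⊥) →
        IntegrableOn (fun z => (u z).toReal) (tsupport η) volume →
          0 ≤ ∫ z, (u z).toReal * hessWedge m A η z

/-- `𝒮ℋ_m^o(X)`: (total functions extending) restrictions to `X` of functions that are continuous
and `m`-subharmonic on some open neighborhood of `X`. -/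
def SHo {n : ℕ} (m : ℕ) (X : Set (Cn n)) : Set (Cn n → ℝ) :=
  {v | ∃ (U : Set (Cn n)) (w : Cn n → ℝ), IsOpen U ∧ X ⊆ U ∧ ContinuousOn w U ∧
    IsMSubharmonic m (fun z => (w z : EReal)) U ∧ EqOn v w X}

/-- `𝒥_z^m(X)`: Jensen measures on the compact set `X` with barycenter `z ∈ X`. A probability
measure on `X` is a Borel probability measure on `ℂⁿ` that gives no mass to the complement of `X`
(regularity is automatic for finite Borel measures on `ℂⁿ`). -/
def JensenMeasures {n : ℕ} (m : ℕ) (X : Set (Cn n)) (z : Cn n) : Set (Measure (Cn n)) :=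
  {μ | z ∈ X ∧ IsProbabilityMeasure μ ∧ μ Xᶜ = 0 ∧ ∀ v ∈ SHo m X, v z ≤ ∫ x in X, v x ∂μ}

/-- Upper semicontinuous functions `X → [-∞, ∞)`. -/
def USC {n : ℕ} (X : Set (Cn n)) : Set (Cn n → EReal) :=
  {u | (∀ z ∈ X, u z ≠ ⊤) ∧ UpperSemicontinuousOn u X}

/-- `𝒮ℋ_m(X)` for a compact set `X`: upper semicontinuous functions on `X` that satisfy the
Jensen inequality for all `z ∈ X` and all Jensen measures with barycenter `z`. -/
def SHCompact {n : ℕ} (m : ℕ) (X : Set (Cn n)) : Set (Cn n → EReal) :=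
  {u | u ∈ USC X ∧
    ∀ z ∈ X, ∀ μ ∈ JensenMeasures m X z, u z ≤ eintegral (μ.restrict X) u}

end MSubharmonic

end

/-! Write X for the closure of Ω. On the boundary, part 1 is duality: a function in `SHo m X` lies
in `SHo m (frontier Ω)`, so a Jensen measure on the boundary is one on X. In Ω, the sub-mean value
inequality holds because normalized Lebesgue measures on balls in Ω are Jensen measures.

The positivity of the currents comes from Edwards' duality. Let f be continuous with φ ≤ f on X. The
supremum of v(z) over v ∈ `SHo m X` with v ≤ f equals ∫ f dμ for some Jensen measure μ at z
(Hahn–Banach and Riesz). At a point z where φ has the Jensen property, φ(z) ≤ ∫ φ dμ ≤ ∫ f dμ, so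
some minorant v satisfies φ(z) < v(z) + ε, and semicontinuity keeps this true near z. On a compact
set of such points, finitely many minorants suffice, and their maximum v satisfies v ≤ f and φ < v +
ε there (`exists_SHo_between`). With continuous f_j decreasing to φ and ε = 1/(j+1), this gives v_j
→ φ on X, and the inequalities for v_j pass to φ by dominated convergence.

In part 2 the Jensen property is known on the boundary only, so the same argument gives v ≤ f with φ
< v + ε on ∂Ω. The set K where φ ≥ v + ε is compact in Ω. Near K, replace v by the maximum of v and
φ_δ − ε, where φ_δ is the average of φ over balls of small radius δ. In a collar around K the
average lies below v + ε, so the pieces glue to ψ ∈ `SHo m X` with ψ ≤ f and φ ≤ ψ + ε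
(`exists_SHo_ge_sub`). For a Jensen measure μ at z, φ(z) ≤ ψ(z) + ε ≤ ∫ ψ dμ + ε ≤ ∫ f dμ + ε; let ε
→ 0 and then let f decrease to φ.

Both halves need `SHo m X` to be stable under sums, maxima and gluing. The key is Gårding's
inequality (`wedge_nonneg`): for α_i ∈ Γ_m, wedging with α_1 ∧ ⋯ ∧ α_(m-1) ∧ β^(n-m) is nonnegative
on semidefinite forms, so the operator in the definition is a sum of squares of constant real
directional derivatives (`exists_hessWedge_eq_sqSum`). For such operators the inequality Lu ≥ 0 in
the sense of distributions survives mollification, maxima, localization and averaging; taking all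
α_i = β gives the Laplacian and hence the mean value inequality. Gårding's inequality itself is
proved from nonvanishing on tubes, Gauss–Lucas and a homotopy of zeros. -/

noncomputable section

namespace MSubharmonic

/-! ### Polarization of forms that do not vanish on a tube, by Gauss–Lucas. -/

section Garding

open Polynomial

variable {V : Type*} [AddCommGroup V] [Module ℂ V] {d : ℕ}

/-- The restriction of a multilinear map to a complex line of the diagonal is a polynomial. -/
theorem exists_linePolynomial (f : MultilinearMap ℂ (fun _ : Fin d => V) ℂ) (z a : V) :
    ∃ P : ℂ[X], (∀ s : ℂ, P.eval s = f fun _ => z + s • a) ∧ P.natDegree ≤ d ∧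
      P.coeff d = (f fun _ => a) ∧
      P.coeff 1 = ∑ i, f (Function.update (fun _ => z) i a) := by
  classical
  refine ⟨∑ S : Finset (Fin d), C (f (S.piecewise (fun _ => z) fun _ => a)) * X ^ (Sᶜ.card),
    ?_, ?_, ?_, ?_⟩
  · intro s
    have := f.map_add_univ (fun _ => z) (fun _ => s • a)
    simp only [Pi.add_def] at this
    rw [this, eval_finsetSum]
    refine Finset.sum_congr rfl fun S _ => ?_
    have h2 := f.map_piecewise_smul (fun _ => s) (S.piecewise (fun _ => z) fun _ => a) Sᶜ
    have h3 : (Sᶜ.piecewise (fun i => (fun _ => s) i • (S.piecewise (fun _ => z) fun _ => a) i)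
        (S.piecewise (fun _ => z) fun _ => a)) = S.piecewise (fun _ => z) (fun _ => s • a) := by
      funext i
      by_cases hi : i ∈ S <;> simp [Finset.piecewise, hi]
    rw [h3] at h2
    rw [h2, eval_mul, eval_C, eval_pow, eval_X]
    simp only [Finset.prod_const, smul_eq_mul]
    rw [mul_comm]
  · refine natDegree_sum_le_of_forall_le _ _ fun S _ => ?_
    refine (natDegree_C_mul_X_pow_le _ _).trans ?_
    simpa using Finset.card_le_univ Sᶜ
  · rw [finsetSum_coeff, Finset.sum_eq_single ∅]
    · simp
    · intro S _ hS
      rw [coeff_C_mul_X_pow, if_neg]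
      intro h
      have : Sᶜ = Finset.univ := Finset.eq_univ_of_card _ (by simpa using h.symm)
      exact hS (by simpa using this)
    · simp
  · rw [finsetSum_coeff]
    have h1 : ∀ i : Fin d, f (Function.update (fun _ => z) i a) =
        (C (f ((({i} : Finset (Fin d))ᶜ).piecewise (fun _ => z) fun _ => a)) *
          X ^ ((({i} : Finset (Fin d))ᶜ)ᶜ.card)).coeff 1 := by
      intro i
      have : (({i} : Finset (Fin d))ᶜ).piecewise (fun _ => z) (fun _ => a) =
          Function.update (fun _ => z) i a := by
        funext j
        by_cases hj : j = i <;> simp [Finset.piecewise, hj]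
      simp [this]
    simp_rw [h1]
    have h2 := Finset.sum_image (s := Finset.univ) (g := fun i : Fin d => ({i} : Finset (Fin d))ᶜ)
      (f := fun S => (C (f (S.piecewise (fun _ => z) fun _ => a)) * X ^ (Sᶜ.card)).coeff 1)
      (by intro i _ j _ h; simpa using h)
    refine Eq.trans ?_ h2
    symm
    refine Finset.sum_subset (Finset.subset_univ _) fun S _ hS => ?_
    rw [coeff_C_mul_X_pow, if_neg]
    intro h
    obtain ⟨i, hi⟩ := Finset.card_eq_one.1 h.symm
    exact hS (Finset.mem_image.2 ⟨i, Finset.mem_univ _, by rw [← hi, compl_compl]⟩)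

/-- Each root r has Im r ≤ 0, so each factor of the factorization satisfies |s − r| ≥ Im s. The
point is to turn the absence of zeros in the upper half-plane into a non-strict, hence closed,
condition on the polynomial. -/
theorem norm_mul_pow_im_le_norm_eval {P : ℂ[X]} (hP : ∀ s, P.eval s = 0 → s.im ≤ 0)
    {s : ℂ} (hs : 0 ≤ s.im) : ‖P.leadingCoeff‖ * s.im ^ P.natDegree ≤ ‖P.eval s‖ := by
  by_cases hP0 : P = 0
  · simp [hP0]
  have hsp : P.Splits := IsAlgClosed.splits P
  rw [hsp.eval_eq_prod_roots, norm_mul, hsp.natDegree_eq_card_roots]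
  refine mul_le_mul_of_nonneg_left ?_ (norm_nonneg _)
  have : ∀ m : Multiset ℂ, (∀ r ∈ m, r.im ≤ 0) →
      s.im ^ m.card ≤ ‖(m.map fun a => s - a).prod‖ := by
    intro m
    induction m using Multiset.induction_on with
    | empty => simp
    | cons r m ih =>
      intro h
      have h1 := ih fun r' hr' => h r' (Multiset.mem_cons_of_mem hr')
      have h2 := h r (Multiset.mem_cons_self r m)
      rw [Multiset.card_cons, Multiset.map_cons, Multiset.prod_cons, norm_mul, pow_succ']
      refine mul_le_mul ?_ h1 (by positivity) (norm_nonneg _)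
      calc s.im ≤ (s - r).im := by simp; linarith
        _ ≤ |(s - r).im| := le_abs_self _
        _ ≤ _ := Complex.abs_im_le_norm _
  exact this _ fun r hr => hP r (mem_roots'.1 hr).2

/-- Gauss–Lucas: the roots of P lie in the convex set Im s < 0, hence so do those of P′, and 0 is
not one of them. -/
theorem derivative_eval_zero_ne_zero {P : ℂ[X]} (hdeg : 0 < P.natDegree)
    (hP : ∀ s : ℂ, 0 ≤ s.im → P.eval s ≠ 0) : P.coeff 1 ≠ 0 := by
  intro h0
  have hdeg' : 0 < P.degree := natDegree_pos_iff_degree_pos.1 hdeg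
  have hP0 : P ≠ 0 := by rintro rfl; simp at hdeg
  have hd : derivative P ≠ 0 := by
    intro h
    have := derivative_eq_zero.1 h
    omega
  have hmem : (0 : ℂ) ∈ (derivative P).rootSet ℂ := by
    rw [mem_rootSet]
    refine ⟨hd, ?_⟩
    rw [coe_aeval_eq_eval, ← coeff_zero_eq_eval_zero, coeff_derivative]
    simp [h0]
  have h1 := rootSet_derivative_subset_convexHull_rootSet hdeg' hmem
  have h2 : convexHull ℝ (P.rootSet ℂ) ⊆ {s : ℂ | s.im < 0} := by
    refine convexHull_min ?_ (convex_halfSpace_im_lt 0)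
    intro s hs
    by_contra hs'
    rw [mem_rootSet] at hs
    exact hP s (not_lt.1 hs') (by simpa [coe_aeval_eq_eval] using hs.2)
  simpa using h2 h1

theorem map_const_smul (f : MultilinearMap ℂ (fun _ : Fin d => V) ℂ) (s : ℂ) (z : V) :
    (f fun _ => s • z) = s ^ d * f fun _ => z := by
  have := f.map_smul_univ (fun _ => s) (fun _ => z)
  simpa using this

/-- `f` does not vanish on the diagonal of the tube `R + iC`. -/
def TubeNonvanishing (f : MultilinearMap ℂ (fun _ : Fin d => V) ℂ) (R : AddSubgroup V)
    (K : Set V) : Prop :=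
  ∀ x ∈ R, ∀ y ∈ K, (f fun _ => x + Complex.I • y) ≠ 0

def IsSymmMultilinear (f : MultilinearMap ℂ (fun _ : Fin d => V) ℂ) : Prop :=
  ∀ (σ : Equiv.Perm (Fin d)) (x : Fin d → V), f (fun i => x (σ i)) = f x

/-- `f` with its last argument fixed. -/
def fixLast (f : MultilinearMap ℂ (fun _ : Fin (d + 1) => V) ℂ) (a : V) :
    MultilinearMap ℂ (fun _ : Fin d => V) ℂ :=
  (LinearMap.applyₗ (R := ℂ) (M := V) (M₂ := ℂ) a).compMultilinearMap f.curryRight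

theorem fixLast_apply (f : MultilinearMap ℂ (fun _ : Fin (d + 1) => V) ℂ) (a : V)
    (x : Fin d → V) : fixLast f a x = f (Fin.snoc x a) := rfl

theorem IsSymmMultilinear.fixLast {f : MultilinearMap ℂ (fun _ : Fin (d + 1) => V) ℂ}
    (hf : IsSymmMultilinear f) (a : V) : IsSymmMultilinear (fixLast f a) := by
  intro σ x
  rw [fixLast_apply, fixLast_apply]
  refine Eq.trans ?_ (hf (σ.viaFintypeEmbedding Fin.castSuccEmb) (Fin.snoc x a))
  congr 1
  funext i
  refine Fin.lastCases ?_ (fun j => ?_) i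
  · rw [Equiv.Perm.viaFintypeEmbedding_apply_notMem_range]
    · simp
    · simp
  · have := σ.viaFintypeEmbedding_apply_image Fin.castSuccEmb j
    simp only [Fin.coe_castSuccEmb] at this
    simp [this]

theorem TubeNonvanishing.apply_ne_zero {f : MultilinearMap ℂ (fun _ : Fin d => V) ℂ}
    {R : AddSubgroup V} {K : Set V} (hf : TubeNonvanishing f R K) {a : V} (ha : a ∈ K) :
    (f fun _ => a) ≠ 0 := by
  intro h
  refine hf 0 R.zero_mem a ha ?_
  simp only [zero_add]
  rw [map_const_smul, h, mul_zero]

/-- For z = x + iy in the tube and Im s ≥ 0, z + sa stays in the tube, so s ↦ f(z + sa, …, z + sa)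
has no zero in the closed upper half-plane. By symmetry its derivative at 0 is d + 1 times f(z, …,
z, a), and Gauss–Lucas applies. -/
theorem TubeNonvanishing.fixLast {f : MultilinearMap ℂ (fun _ : Fin (d + 1) => V) ℂ}
    (hs : IsSymmMultilinear f) {R : AddSubgroup V} {K : Set V}
    (hf : TubeNonvanishing f R K) (hK : ∀ x ∈ K, ∀ y ∈ K, x + y ∈ K)
    (hK' : ∀ x ∈ K, ∀ r : ℝ, 0 < r → (r : ℂ) • x ∈ K) (hR : ∀ x ∈ R, ∀ r : ℝ, (r : ℂ) • x ∈ R) (hKR : K ⊆ R) {a : V} (ha : a ∈ K) :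
    TubeNonvanishing (fixLast f a) R K := by
  intro x hx y hy h0
  obtain ⟨P, hP, hd, hc, h1⟩ := exists_linePolynomial f (x + Complex.I • y) a
  have hlead : P.coeff (d + 1) ≠ 0 := by rw [hc]; exact hf.apply_ne_zero ha
  have hdeg : 0 < P.natDegree :=
    lt_of_lt_of_le (Nat.succ_pos d) (le_natDegree_of_ne_zero hlead)
  refine derivative_eval_zero_ne_zero hdeg ?_ ?_ (P := P)
  · intro s hs
    rw [hP]
    have e : x + Complex.I • y + s • a = (x + (s.re : ℂ) • a) + Complex.I • (y + (s.im : ℂ) • a) := by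
      conv_lhs => rw [← Complex.re_add_im s]
      module
    rw [e]
    refine hf _ (R.add_mem hx (hR _ (hKR ha) _)) _ ?_
    rcases hs.eq_or_lt with h | h
    · simpa [← h] using hy
    · exact hK _ hy _ (hK' _ ha _ h)
  · rw [h1]
    have : ∀ i, f (Function.update (fun _ => x + Complex.I • y) i a) = 0 := by
      intro i
      rw [← h0, fixLast_apply, ← hs (Equiv.swap i (Fin.last d))]
      congr 1
      funext j
      refine Fin.lastCases ?_ (fun k => ?_) j
      · simp
      · simp only [Fin.snoc_castSucc]
        rw [Function.update_of_ne]
        intro hk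
        rw [Equiv.swap_apply_eq_iff] at hk
        simp at hk
    simp [this]

/-- Freezing the arguments one by one, each time keeping nonvanishing on the tube, passes from the
diagonal to mixed arguments. -/
theorem tube_apply_ne_zero {f : MultilinearMap ℂ (fun _ : Fin d => V) ℂ}
    (hs : IsSymmMultilinear f) {R : AddSubgroup V} {K : Set V} (hne : K.Nonempty)
    (hf : TubeNonvanishing f R K) (hK : ∀ x ∈ K, ∀ y ∈ K, x + y ∈ K)
    (hK' : ∀ x ∈ K, ∀ r : ℝ, 0 < r → (r : ℂ) • x ∈ K) (hR : ∀ x ∈ R, ∀ r : ℝ, (r : ℂ) • x ∈ R) (hKR : K ⊆ R) (a : Fin d → V)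
    (ha : ∀ i, a i ∈ K) : f a ≠ 0 := by
  induction d with
  | zero =>
    obtain ⟨y, hy⟩ := hne
    have := hf 0 R.zero_mem y hy
    rwa [Subsingleton.elim a fun _ => 0 + Complex.I • y]
  | succ d ih =>
    have := ih (hs.fixLast (a (Fin.last d))) (hf.fixLast hs hK hK' hR hKR (ha (Fin.last d)))
      (fun i => a i.castSucc) fun i => ha _
    rw [fixLast_apply] at this
    convert this
    funext i
    refine Fin.lastCases ?_ (fun k => ?_) i <;> simp

end Garding
-- Hyperbolicity: from the Gårding cone to the convex cone it spans, and Gårding's inequality.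
section Homotopy

open Polynomial Topology Filter

variable {V : Type*} [AddCommGroup V] [Module ℂ V] {d : ℕ} [TopologicalSpace V]
  [IsTopologicalAddGroup V] [ContinuousSMul ℂ V]

/-- If the zeros of `τ ↦ f (u + θ x + τ a)` do not meet the real axis for `θ ∈ [0, 1]`, and lie in
the lower half-plane for `θ = 0`, then they lie in the lower half-plane for `θ = 1`. -/
theorem homotopy_ne_zero {f : MultilinearMap ℂ (fun _ : Fin d => V) ℂ}
    (hf : Continuous f) {u x a : V} (ha : (f fun _ => a) ≠ 0)
    (hreal : ∀ θ ∈ Icc (0 : ℝ) 1, ∀ τ : ℝ, (f fun _ => u + (θ : ℂ) • x + (τ : ℂ) • a) ≠ 0)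
    (h0 : ∀ τ : ℂ, 0 ≤ τ.im → (f fun _ => u + τ • a) ≠ 0) (τ : ℂ) (hτ : 0 ≤ τ.im) :
    (f fun _ => u + x + τ • a) ≠ 0 := by
  set F : ℝ → ℂ → ℂ := fun θ τ => f fun _ => u + (θ : ℂ) • x + τ • a with hF
  have hFc : Continuous fun p : ℝ × ℂ => F p.1 p.2 := by
    refine hf.comp (continuous_pi fun _ => ?_)
    fun_prop
  -- the zeros are uniformly bounded
  obtain ⟨M, hM⟩ : ∃ M : ℝ, ∀ θ ∈ Icc (0 : ℝ) 1, ∀ τ : ℂ, F θ τ = 0 → ‖τ‖ ≤ M := by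
    have hc : Continuous fun p : ℂ × ℝ => f fun _ => p.1 • (u + (p.2 : ℂ) • x) + a := by
      refine hf.comp (continuous_pi fun _ => ?_)
      fun_prop
    have h1 := (isCompact_Icc (a := (0 : ℝ)) (b := 1)).eventually_forall_of_forall_eventually
      (x₀ := (0 : ℂ)) (P := fun s θ => (f fun _ => s • (u + (θ : ℂ) • x) + a) ≠ 0)
      (fun θ _ => hc.continuousAt.eventually_ne (by simpa using ha))
    obtain ⟨ε, hε, h2⟩ := Metric.eventually_nhds_iff.1 h1
    refine ⟨ε⁻¹, fun θ hθ τ hz => ?_⟩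
    by_contra hcon
    push Not at hcon
    have hpos : 0 < ‖τ‖ := lt_trans (by positivity) hcon
    have hτ0 : τ ≠ 0 := norm_pos_iff.1 hpos
    refine h2 (y := τ⁻¹) ?_ θ hθ ?_
    · rw [dist_zero_right, norm_inv]
      exact inv_lt_of_inv_lt₀ hε hcon
    · have : τ⁻¹ • (u + (θ : ℂ) • x) + a = τ⁻¹ • (u + (θ : ℂ) • x + τ • a) := by
        rw [smul_add _ _ (τ • a), inv_smul_smul₀ hτ0]
      rw [this, map_const_smul]
      exact mul_eq_zero_of_right _ hz
  set G : Set ℝ := {θ | θ ∈ Icc (0 : ℝ) 1 ∧ ∀ τ : ℂ, 0 ≤ τ.im → F θ τ ≠ 0} with hG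
  set B : Set ℝ := {θ | θ ∈ Icc (0 : ℝ) 1 ∧ ∃ τ : ℂ, 0 ≤ τ.im ∧ F θ τ = 0} with hB
  -- At real τ nonvanishing is assumed; at Im τ > 0 it is equivalent, given the root location, to
  -- the bound ‖f(a, …, a)‖ (Im τ)^d ≤ ‖F θ τ‖, which is closed in θ.
  have hGclosed : IsClosed G := by
    have : G = Icc 0 1 ∩ ⋂ τ : {τ : ℂ // 0 < τ.im},
        {θ | ‖f fun _ => a‖ * (τ : ℂ).im ^ d ≤ ‖F θ τ‖} := by
      ext θ
      simp only [hG, mem_ofPred_eq, mem_inter_iff, mem_iInter, Subtype.forall]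
      refine and_congr_right fun hθ => ⟨fun h τ hτ => ?_, fun h τ hτ => ?_⟩
      · obtain ⟨P, hP, hd, hc, -⟩ := exists_linePolynomial f (u + (θ : ℂ) • x) a
        have hdeg : P.natDegree = d :=
          le_antisymm hd (le_natDegree_of_ne_zero (by rw [hc]; exact ha))
        have := norm_mul_pow_im_le_norm_eval (P := P) (s := τ) ?_ hτ.le
        · rwa [leadingCoeff, hdeg, hc, hP] at this
        · intro s hs
          by_contra hs'
          exact h s (not_le.1 hs').le (by rw [← hs, hP])
      · rcases hτ.eq_or_lt with h' | h'
        · have : τ = (τ.re : ℂ) := Complex.ext rfl (by simpa using h'.symm)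
          rw [this]
          exact hreal θ hθ _
        · rw [← norm_pos_iff]
          exact lt_of_lt_of_le (by positivity) (h τ h')
    rw [this]
    refine isClosed_Icc.inter (isClosed_iInter fun τ => isClosed_le continuous_const ?_)
    exact (hFc.comp (continuous_id.prodMk continuous_const)).norm
  -- The bad parameters are the projection of a compact set, since the zeros are bounded uniformly
  -- in θ. Then [0, 1] is covered by the disjoint closed sets G and B, and connectedness leaves only
  -- G.
  have hBclosed : IsClosed B := by
    have : B = Prod.fst '' ((Icc (0 : ℝ) 1 ×ˢ Metric.closedBall (0 : ℂ) M) ∩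
        ({p : ℝ × ℂ | 0 ≤ p.2.im} ∩ {p : ℝ × ℂ | F p.1 p.2 = 0})) := by
      ext θ
      constructor
      · rintro ⟨hθ, τ, hτ, hz⟩
        exact ⟨(θ, τ), ⟨⟨hθ, by simpa using hM θ hθ τ hz⟩, hτ, hz⟩, rfl⟩
      · rintro ⟨⟨θ, τ⟩, ⟨⟨hθ, -⟩, hτ, hz⟩, rfl⟩
        exact ⟨hθ, τ, hτ, hz⟩
    rw [this]
    refine (IsCompact.image ?_ continuous_fst).isClosed
    refine (isCompact_Icc.prod (isCompact_closedBall _ _)).inter_right (IsClosed.inter ?_ ?_)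
    · exact isClosed_le continuous_const (Complex.continuous_im.comp continuous_snd)
    · exact isClosed_eq hFc continuous_const
  have hcov : Icc (0 : ℝ) 1 ⊆ G ∪ B := by
    intro θ hθ
    by_cases h : ∃ τ : ℂ, 0 ≤ τ.im ∧ F θ τ = 0
    · exact Or.inr ⟨hθ, h⟩
    · push Not at h
      exact Or.inl ⟨hθ, h⟩
  have h0G : (0 : ℝ) ∈ G := ⟨by simp, fun τ hτ => by simpa [hF] using h0 τ hτ⟩
  have hB1 : (1 : ℝ) ∉ B := by
    intro h1
    obtain ⟨θ, -, hθG, hθB⟩ := isPreconnected_closed_iff.1 isPreconnected_Icc G B hGclosed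
      hBclosed hcov ⟨0, by simp, h0G⟩ ⟨1, by simp, h1⟩
    obtain ⟨τ, hτ, hz⟩ := hθB.2
    exact hθG.2 τ hτ hz
  have h1G : (1 : ℝ) ∈ G := (hcov (by simp : (1 : ℝ) ∈ Icc (0 : ℝ) 1)).resolve_right hB1
  simpa [hF] using h1G.2 τ hτ

/-- The Gårding cone of `f` in the direction `e`. -/
def gardingCone (f : MultilinearMap ℂ (fun _ : Fin d => V) ℂ) (R : AddSubgroup V) (e : V) : Set V :=
  {a | a ∈ R ∧ ∀ t : ℝ, 0 ≤ t → (f fun _ => a + (t : ℂ) • e) ≠ 0}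

/-- This one-summand step makes the tube property hold for sums of elements of the Gårding cone,
without knowing beforehand that the cone is convex. The zeros of τ ↦ f(x + iαe + iβy + τb) are kept
in the lower half-plane along two homotopies, and τ = iβ is the value needed. -/
theorem add_tube_ne_zero {f : MultilinearMap ℂ (fun _ : Fin d => V) ℂ}
    (hf : Continuous f) {R : AddSubgroup V} (hR : ∀ x ∈ R, ∀ r : ℝ, (r : ℂ) • x ∈ R) {e : V}
    (he : e ∈ R)
    (hyp : ∀ x ∈ R, ∀ α : ℝ, 0 < α → (f fun _ => x + (Complex.I * α) • e) ≠ 0) {b : V}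
    (hb : b ∈ gardingCone f R e) {y : V}
    (hy : ∀ x ∈ R, ∀ α β : ℝ, 0 < α → 0 ≤ β →
      (f fun _ => x + (Complex.I * α) • e + (Complex.I * β) • y) ≠ 0) :
    ∀ x ∈ R, ∀ α β : ℝ, 0 < α → 0 ≤ β →
      (f fun _ => x + (Complex.I * α) • e + (Complex.I * β) • (y + b)) ≠ 0 := by
  intro x hx α β hα hβ
  have hb0 : (f fun _ => b) ≠ 0 := by simpa using hb.2 0 le_rfl
  have step0 : ∀ τ : ℂ, 0 ≤ τ.im → (f fun _ => (Complex.I * α) • e + τ • b) ≠ 0 := by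
    intro τ hτ
    by_cases hτ0 : τ = 0
    · simpa [hτ0] using hyp 0 R.zero_mem α hα
    set s : ℂ := Complex.I * α / τ with hs
    have hsτ : s * τ = Complex.I * α := by rw [hs]; field_simp
    have e1 : (Complex.I * α) • e + τ • b = τ • (b + s • e) := by
      rw [← hsτ]; module
    rw [e1, map_const_smul]
    refine mul_ne_zero (pow_ne_zero _ hτ0) ?_
    -- If s is not real, `hyp` applies to b + se, after a change of sign when Im s < 0. If s is
    -- real, sτ = iα with α > 0 and Im τ ≥ 0 forces s ≥ 0, where the definition of the Gårding cone
    -- applies.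
    rcases lt_trichotomy s.im 0 with h | h | h
    · have e2 : b + s • e = (-1 : ℂ) • ((-1 : ℂ) • b + ((-s.re : ℝ) : ℂ) • e +
          (Complex.I * ((-s.im : ℝ) : ℂ)) • e) := by
        conv_lhs => rw [← Complex.re_add_im s]
        push_cast
        module
      rw [e2, map_const_smul]
      refine mul_ne_zero (pow_ne_zero _ (by norm_num)) (hyp _ (R.add_mem ?_ (hR _ he _)) _ ?_)
      · simpa using R.neg_mem hb.1
      · linarith
    · have hsr : s = (s.re : ℂ) := Complex.ext rfl (by simpa using h)
      rw [hsr]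
      refine hb.2 _ ?_
      by_contra hneg
      push Not at hneg
      have := congrArg Complex.im hsτ
      rw [hsr] at this
      simp at this
      nlinarith
    · have e2 : b + s • e = b + ((s.re : ℝ) : ℂ) • e + (Complex.I * ((s.im : ℝ) : ℂ)) • e := by
        conv_lhs => rw [← Complex.re_add_im s]
        module
      rw [e2]
      exact hyp _ (R.add_mem hb.1 (hR _ he _)) _ h
  -- The term iβy is switched on first and x afterwards. For real τ the vector τb belongs to R and
  -- is absorbed in the real part, so `hy` excludes real zeros along both homotopies.
  have step1 : ∀ τ : ℂ, 0 ≤ τ.im →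
      (f fun _ => (Complex.I * α) • e + (Complex.I * β) • y + τ • b) ≠ 0 := by
    refine homotopy_ne_zero hf hb0 (fun θ hθ τ => ?_) step0
    have := hy _ (hR _ hb.1 τ) α (θ * β) hα (mul_nonneg hθ.1 hβ)
    convert this using 3
    push_cast
    module
  have step2 := homotopy_ne_zero (x := x) hf hb0 (fun θ hθ τ => ?_) step1 (Complex.I * β)
    (by simpa using hβ)
  · convert step2 using 3
    module
  · have := hy _ (R.add_mem (hR _ hb.1 τ) (hR _ hx θ)) α β hα hβ
    convert this using 3
    module

/-- The convex cone spanned by the Gårding cone, slightly shifted. -/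
def shiftedCone (f : MultilinearMap ℂ (fun _ : Fin d => V) ℂ) (R : AddSubgroup V) (e : V) : Set V :=
  {y | ∃ ε : ℝ, 0 < ε ∧ y - (ε : ℂ) • e ∈ AddSubmonoid.closure (gardingCone f R e)}

section Cone

variable {f : MultilinearMap ℂ (fun _ : Fin d => V) ℂ} {R : AddSubgroup V} {e : V}

omit [TopologicalSpace V] [IsTopologicalAddGroup V] [ContinuousSMul ℂ V] in
theorem add_smul_mem_shiftedCone {a : V} (ha : a ∈ gardingCone f R e) {ε : ℝ} (hε : 0 < ε) :
    a + (ε : ℂ) • e ∈ shiftedCone f R e :=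
  ⟨ε, hε, AddSubmonoid.subset_closure (by simpa using ha)⟩

omit [TopologicalSpace V] [IsTopologicalAddGroup V] [ContinuousSMul ℂ V] in
theorem add_mem_shiftedCone {x y : V} (hx : x ∈ shiftedCone f R e) (hy : y ∈ shiftedCone f R e) :
    x + y ∈ shiftedCone f R e := by
  obtain ⟨ε, hε, h1⟩ := hx
  obtain ⟨δ, hδ, h2⟩ := hy
  refine ⟨ε + δ, by positivity, ?_⟩
  convert add_mem h1 h2 using 1
  push_cast
  module

omit [TopologicalSpace V] [IsTopologicalAddGroup V] [ContinuousSMul ℂ V] in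
theorem smul_mem_gardingCone (hR : ∀ x ∈ R, ∀ r : ℝ, (r : ℂ) • x ∈ R) {x : V}
    (hx : x ∈ gardingCone f R e) {r : ℝ} (hr : 0 < r) : (r : ℂ) • x ∈ gardingCone f R e := by
  refine ⟨hR _ hx.1 _, fun t ht => ?_⟩
  have hr' : (r : ℂ) ≠ 0 := by exact_mod_cast hr.ne'
  have : (r : ℂ) • x + (t : ℂ) • e = (r : ℂ) • (x + ((t / r : ℝ) : ℂ) • e) := by
    rw [smul_add, smul_smul]
    congr 2
    push_cast
    field_simp
  rw [this, map_const_smul]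
  exact mul_ne_zero (pow_ne_zero _ hr') (hx.2 _ (by positivity))

omit [TopologicalSpace V] [IsTopologicalAddGroup V] [ContinuousSMul ℂ V] in
theorem smul_mem_shiftedCone (hR : ∀ x ∈ R, ∀ r : ℝ, (r : ℂ) • x ∈ R) {x : V}
    (hx : x ∈ shiftedCone f R e) {r : ℝ} (hr : 0 < r) : (r : ℂ) • x ∈ shiftedCone f R e := by
  obtain ⟨ε, hε, h⟩ := hx
  refine ⟨r * ε, by positivity, ?_⟩
  have e1 : (r : ℂ) • x - ((r * ε : ℝ) : ℂ) • e = (r : ℂ) • (x - (ε : ℂ) • e) := by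
    push_cast
    module
  rw [e1]
  generalize x - (ε : ℂ) • e = z at h
  induction h using AddSubmonoid.closure_induction with
  | mem z hz => exact AddSubmonoid.subset_closure (smul_mem_gardingCone hR hz hr)
  | zero => simp
  | add z w _ _ hz hw => rw [smul_add]; exact add_mem hz hw

/-- Induction on the number of summands, starting from y = 0, where the claim is hyperbolicity in
the direction e. -/
theorem closure_gardingCone_tube (hf : Continuous f) (hR : ∀ x ∈ R, ∀ r : ℝ, (r : ℂ) • x ∈ R)
    (he : e ∈ R)
    (hyp : ∀ x ∈ R, ∀ α : ℝ, 0 < α → (f fun _ => x + (Complex.I * α) • e) ≠ 0) {y : V}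
    (hy : y ∈ AddSubmonoid.closure (gardingCone f R e)) :
    y ∈ R ∧ ∀ x ∈ R, ∀ α β : ℝ, 0 < α → 0 ≤ β →
      (f fun _ => x + (Complex.I * α) • e + (Complex.I * β) • y) ≠ 0 := by
  induction hy using AddSubmonoid.closure_induction_right with
  | zero => exact ⟨R.zero_mem, fun x hx α β hα _ => by simpa using hyp x hx α hα⟩
  | add_right y _ b hb ih =>
    exact ⟨R.add_mem ih.1 hb.1, add_tube_ne_zero hf hR he hyp hb ih.2⟩

theorem shiftedCone_subset (hf : Continuous f) (hR : ∀ x ∈ R, ∀ r : ℝ, (r : ℂ) • x ∈ R)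
    (he : e ∈ R)
    (hyp : ∀ x ∈ R, ∀ α : ℝ, 0 < α → (f fun _ => x + (Complex.I * α) • e) ≠ 0) :
    shiftedCone f R e ⊆ R := by
  rintro y ⟨ε, hε, h⟩
  have := R.add_mem (closure_gardingCone_tube hf hR he hyp h).1 (hR _ he ε)
  simpa using this

theorem tubeNonvanishing_shiftedCone (hf : Continuous f)
    (hR : ∀ x ∈ R, ∀ r : ℝ, (r : ℂ) • x ∈ R) (he : e ∈ R)
    (hyp : ∀ x ∈ R, ∀ α : ℝ, 0 < α → (f fun _ => x + (Complex.I * α) • e) ≠ 0) :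
    TubeNonvanishing f R (shiftedCone f R e) := by
  rintro x hx y ⟨ε, hε, h⟩
  have := (closure_gardingCone_tube hf hR he hyp h).2 x hx ε 1 hε zero_le_one
  convert this using 3
  push_cast
  module

omit [TopologicalSpace V] [IsTopologicalAddGroup V] [ContinuousSMul ℂ V] in
theorem self_mem_gardingCone (he : e ∈ R)
    (hyp : ∀ x ∈ R, ∀ α : ℝ, 0 < α → (f fun _ => x + (Complex.I * α) • e) ≠ 0) :
    e ∈ gardingCone f R e := by
  have h1 : (f fun _ => e) ≠ 0 := by
    intro h
    have := hyp 0 R.zero_mem 1 one_pos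
    rw [zero_add, map_const_smul, h, mul_zero] at this
    exact this rfl
  refine ⟨he, fun t ht => ?_⟩
  have : e + (t : ℂ) • e = ((1 + t : ℝ) : ℂ) • e := by push_cast; module
  rw [this, map_const_smul]
  refine mul_ne_zero (pow_ne_zero _ ?_) h1
  exact_mod_cast (by positivity : (0 : ℝ) < 1 + t).ne'

/-- Gårding's inequality for the closed cone. -/
theorem garding_inequality (hs : IsSymmMultilinear f) (hf : Continuous f)
    (hR : ∀ x ∈ R, ∀ r : ℝ, (r : ℂ) • x ∈ R) (he : e ∈ R)
    (hyp : ∀ x ∈ R, ∀ α : ℝ, 0 < α → (f fun _ => x + (Complex.I * α) • e) ≠ 0)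
    (hreal : ∀ a : Fin d → V, (∀ i, a i ∈ R) → (f a).im = 0) (hpos : 0 < (f fun _ => e).re)
    (a : Fin d → V) (ha : ∀ i, ∀ δ : ℝ, 0 < δ → a i + (δ : ℂ) • e ∈ gardingCone f R e) :
    0 ≤ (f a).re := by
  have hee : e ∈ shiftedCone f R e := by
    refine ⟨1 / 2, by norm_num, AddSubmonoid.subset_closure ?_⟩
    have := smul_mem_gardingCone hR (self_mem_gardingCone he hyp) (r := 1 / 2) (by norm_num)
    convert this using 1
    push_cast
    module
  -- Join (e, …, e) to b inside the convex cone. The mixed values along the segment are real and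
  -- nonzero, so they keep the sign of f(e, …, e).
  have key : ∀ b : Fin d → V, (∀ i, b i ∈ shiftedCone f R e) → 0 < (f b).re := by
    intro b hb
    have hsub := shiftedCone_subset hf hR he hyp
    have hmem : ∀ θ ∈ Icc (0 : ℝ) 1, ∀ i,
        ((1 - θ : ℝ) : ℂ) • e + (θ : ℂ) • b i ∈ shiftedCone f R e := by
      intro θ hθ i
      rcases hθ.1.eq_or_lt with h | h
      · simpa [← h] using hee
      rcases hθ.2.eq_or_lt with h' | h'
      · simpa [h'] using hb i
      exact add_mem_shiftedCone (smul_mem_shiftedCone hR hee (by linarith))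
        (smul_mem_shiftedCone hR (hb i) h)
    set g : ℝ → ℝ := fun θ => (f fun i => ((1 - θ : ℝ) : ℂ) • e + (θ : ℂ) • b i).re with hg
    have hgc : Continuous g := by
      refine Complex.continuous_re.comp (hf.comp (continuous_pi fun i => ?_))
      fun_prop
    have hg0 : ∀ θ ∈ Icc (0 : ℝ) 1, g θ ≠ 0 := by
      intro θ hθ h0
      refine tube_apply_ne_zero hs ⟨e, hee⟩ (tubeNonvanishing_shiftedCone hf hR he hyp)
        (fun x hx y hy => add_mem_shiftedCone hx hy)
        (fun x hx r hr => smul_mem_shiftedCone hR hx hr) hR hsub _ (hmem θ hθ) ?_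
      exact Complex.ext h0 (hreal _ fun i => hsub (hmem θ hθ i))
    have hgs : 0 < g 0 := by simpa [hg] using hpos
    have hg1 : g 1 = (f b).re := by simp [hg]
    rw [← hg1]
    by_contra hneg
    push Not at hneg
    obtain ⟨θ, hθ, hz⟩ := intermediate_value_Icc' zero_le_one hgc.continuousOn ⟨hneg, hgs.le⟩
    exact hg0 θ hθ hz
  have hlim : Tendsto (fun δ : ℝ => (f fun i => a i + (δ : ℂ) • e).re) (𝓝[>] 0)
      (𝓝 (f fun i => a i + ((0 : ℝ) : ℂ) • e).re) := by
    refine Tendsto.mono_left (Continuous.tendsto ?_ 0) nhdsWithin_le_nhds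
    refine Complex.continuous_re.comp (hf.comp (continuous_pi fun i => ?_))
    fun_prop
  have h0 : (f fun i => a i + ((0 : ℝ) : ℂ) • e).re = (f a).re := by simp
  rw [← h0]
  refine ge_of_tendsto hlim ?_
  filter_upwards [self_mem_nhdsWithin] with δ hδ
  have hδ' : 0 < δ := hδ
  refine (key _ fun i => ?_).le
  have := add_smul_mem_shiftedCone (ha i (δ / 2) (by positivity)) (ε := δ / 2) (by positivity)
  convert this using 1
  push_cast
  module

end Cone

end Homotopy
-- The mixed discriminant as a symmetric multilinear form.
section Wedge

open Matrix
open scoped ComplexOrder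

variable {n m : ℕ}

theorem det_of_update (A : Fin n → Matrix (Fin n) (Fin n) ℂ) (l : Fin n)
    (B : Matrix (Fin n) (Fin n) ℂ) (σ : Equiv.Perm (Fin n)) :
    (Matrix.of fun i j => Function.update A l B (σ j) i j).det =
      ((Matrix.of fun i j => A (σ j) i j).updateCol (σ.symm l) fun i => B i (σ.symm l)).det := by
  congr 1
  ext i j
  by_cases h : j = σ.symm l
  · subst h; simp
  · have : σ j ≠ l := fun h' => h (by simp [← h'])
    simp [h, this]

/-- The complex multilinear form whose real part is `wedge`. -/
def wedgeMap (n : ℕ) : MultilinearMap ℂ (fun _ : Fin n => Matrix (Fin n) (Fin n) ℂ) ℂ where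
  toFun A := ∑ σ : Equiv.Perm (Fin n), (Matrix.of fun i j => A (σ j) i j).det
  map_update_add' := by
    intro inst A l x y
    obtain rfl : inst = instDecidableEqFin n := Subsingleton.elim _ _
    rw [← Finset.sum_add_distrib]
    refine Finset.sum_congr rfl fun σ _ => ?_
    rw [det_of_update, det_of_update, det_of_update]
    exact det_updateCol_add _ _ _ _
  map_update_smul' := by
    intro inst A l c x
    obtain rfl : inst = instDecidableEqFin n := Subsingleton.elim _ _
    rw [Finset.smul_sum]
    refine Finset.sum_congr rfl fun σ _ => ?_
    rw [det_of_update, det_of_update]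
    exact det_updateCol_smul _ _ _ _

theorem wedge_eq_re (A : Fin n → Matrix (Fin n) (Fin n) ℂ) : wedge A = (wedgeMap n A).re := rfl

theorem wedgeMap_apply (A : Fin n → Matrix (Fin n) (Fin n) ℂ) :
    wedgeMap n A = ∑ σ : Equiv.Perm (Fin n), (Matrix.of fun i j => A (σ j) i j).det := rfl

theorem wedgeMap_symm (n : ℕ) : IsSymmMultilinear (wedgeMap n) := by
  intro τ A
  rw [wedgeMap_apply, wedgeMap_apply]
  exact Fintype.sum_equiv (Equiv.mulLeft τ) _ _ fun σ => by simp

theorem continuous_wedgeMap (n : ℕ) : Continuous (wedgeMap n) := by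
  refine continuous_finsetSum _ fun σ _ => Continuous.matrix_det ?_
  refine continuous_matrix fun i j => ?_
  simp only [of_apply]
  fun_prop

theorem wedgeMap_const (Z : Matrix (Fin n) (Fin n) ℂ) :
    (wedgeMap n fun _ => Z) = (n.factorial : ℂ) * Z.det := by
  rw [wedgeMap_apply]
  have : (Matrix.of fun i j => Z i j) = Z := rfl
  simp [this, Fintype.card_perm]

/-- Expand both sides as sums over pairs (σ, τ) of permutations; the substitution τ ↦ τ⁻¹, σ ↦ στ⁻¹
matches the terms. Hence the form is real on Hermitian matrices. -/
theorem wedgeMap_star (A : Fin n → Matrix (Fin n) (Fin n) ℂ) :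
    star (wedgeMap n A) = wedgeMap n fun i => (A i)ᴴ := by
  rw [wedgeMap_apply, wedgeMap_apply, star_sum]
  have h1 : ∀ σ : Equiv.Perm (Fin n), star (Matrix.of fun i j => A (σ j) i j).det =
      ∑ τ : Equiv.Perm (Fin n), (Equiv.Perm.sign τ : ℂ) * ∏ i, (A (σ i))ᴴ i (τ i) := by
    intro σ
    rw [← det_conjTranspose, ← det_transpose, det_apply']
    rfl
  have h2 : ∀ σ : Equiv.Perm (Fin n), (Matrix.of fun i j => (A (σ j))ᴴ i j).det =
      ∑ τ : Equiv.Perm (Fin n), (Equiv.Perm.sign τ : ℂ) * ∏ i, (A (σ i))ᴴ (τ i) i := by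
    intro σ
    rw [det_apply']
    rfl
  simp_rw [h1, h2]
  rw [Finset.sum_comm]
  conv_rhs => rw [Finset.sum_comm]
  refine Fintype.sum_equiv (Equiv.inv _) _ _ fun τ => ?_
  refine Fintype.sum_equiv (Equiv.mulRight τ⁻¹) _ _ fun σ => ?_
  rw [Equiv.inv_apply, Equiv.Perm.sign_inv]
  congr 1
  refine Fintype.prod_equiv τ _ _ fun i => ?_
  simp

/-- On the diagonal the form is n! det. A kernel vector v ≠ 0 of X + iY would give v*Xv + i v*Yv =
0, whose imaginary part is v*Yv > 0. -/
theorem tubeNonvanishing_wedgeMap (n : ℕ) :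
    TubeNonvanishing (wedgeMap n) (selfAdjoint (Matrix (Fin n) (Fin n) ℂ)) {Y | Y.PosDef} := by
  intro X hX Y hY
  rw [wedgeMap_const]
  refine mul_ne_zero (by exact_mod_cast n.factorial_ne_zero) fun h => ?_
  obtain ⟨v, hv, h0⟩ := exists_mulVec_eq_zero_iff.2 h
  have hX' : X.IsHermitian := hX
  have hYp : 0 < star v ⬝ᵥ (Y *ᵥ v) := hY.dotProduct_mulVec_pos hv
  have h1 : star v ⬝ᵥ (X *ᵥ v) + Complex.I * (star v ⬝ᵥ (Y *ᵥ v)) = 0 := by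
    have := congrArg (fun w => star v ⬝ᵥ w) h0
    simpa [add_mulVec, smul_mulVec, dotProduct_add] using this
  have h2 : (star v ⬝ᵥ (X *ᵥ v)).im = 0 := by
    have := hX'.im_star_dotProduct_mulVec_self v
    simpa using this
  have h3 := congrArg Complex.im h1
  rw [Complex.lt_def] at hYp
  simp [h2] at h3
  have h4 := hYp.1
  simp at h4
  linarith

theorem continuous_fixLast {d : ℕ} {V : Type*} [AddCommGroup V] [Module ℂ V] [TopologicalSpace V]
    {f : MultilinearMap ℂ (fun _ : Fin (d + 1) => V) ℂ} (hf : Continuous f) (a : V) :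
    Continuous (fixLast f a) := by
  refine hf.comp (continuous_pi fun i => ?_)
  refine Fin.lastCases ?_ (fun k => ?_) i
  · simpa using continuous_const
  · simpa using continuous_apply k

/-- Fixing a in the last k slots preserves symmetry, continuity and nonvanishing on the tube. With a
= β this makes α_1 ∧ ⋯ ∧ α_m ∧ β^(n-m) a form of degree m to which Gårding's inequality applies. -/
theorem exists_fix {V : Type*} [AddCommGroup V] [Module ℂ V] [TopologicalSpace V]
    {R : AddSubgroup V} {K : Set V} (hK : ∀ x ∈ K, ∀ y ∈ K, x + y ∈ K)
    (hK' : ∀ x ∈ K, ∀ r : ℝ, 0 < r → (r : ℂ) • x ∈ K)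
    (hR : ∀ x ∈ R, ∀ r : ℝ, (r : ℂ) • x ∈ R) (hKR : K ⊆ R) {a : V} (ha : a ∈ K) (k : ℕ)
    (f : MultilinearMap ℂ (fun _ : Fin (m + k) => V) ℂ) (hs : IsSymmMultilinear f)
    (hc : Continuous f) (ht : TubeNonvanishing f R K) :
    ∃ g : MultilinearMap ℂ (fun _ : Fin m => V) ℂ, IsSymmMultilinear g ∧ Continuous g ∧
      TubeNonvanishing g R K ∧
      ∀ x, g x = f fun i => if h : (i : ℕ) < m then x ⟨i, h⟩ else a := by
  induction k with
  | zero => exact ⟨f, hs, hc, ht, fun x => by congr 1; funext i; simp⟩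
  | succ k ih =>
    obtain ⟨g, h1, h2, h3, h4⟩ := ih (fixLast f a) (hs.fixLast a) (continuous_fixLast hc a)
      (ht.fixLast hs hK hK' hR hKR ha)
    refine ⟨g, h1, h2, h3, fun x => ?_⟩
    rw [h4, fixLast_apply]
    congr 1
    funext i
    refine Fin.lastCases ?_ (fun j => ?_) i <;> simp

theorem wedge_card_eq {S : Finset (Fin n)} (A B : Matrix (Fin n) (Fin n) ℂ) :
    wedgeMap n (S.piecewise (fun _ => A) fun _ => B) =
      wedgeMap n fun i : Fin n => if (i : ℕ) < S.card then A else B := by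
  classical
  have hS : S.card ≤ n := by simpa using S.card_le_univ
  have hcard : Fintype.card {i : Fin n // (i : ℕ) < S.card} = Fintype.card {i // i ∈ S} := by
    rw [Fintype.card_coe]
    have := Fintype.card_congr (Fin.castLEquiv hS).symm
    simpa using this
  have e := Fintype.equivOfCardEq hcard
  rw [← wedgeMap_symm n e.extendSubtype]
  congr 1
  funext i
  by_cases h : (i : ℕ) < S.card
  · have := e.extendSubtype_mem i h
    simp [h, Finset.piecewise, this]
  · have := e.extendSubtype_not_mem i h
    simp [h, Finset.piecewise, this]

end Wedge
-- Gårding's inequality for Γ_m.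
section MixedWedge

open Matrix
open scoped ComplexOrder

variable {n m : ℕ}

theorem smul_mem_selfAdjoint {X : Matrix (Fin n) (Fin n) ℂ}
    (hX : X ∈ selfAdjoint (Matrix (Fin n) (Fin n) ℂ)) (r : ℝ) :
    (r : ℂ) • X ∈ selfAdjoint (Matrix (Fin n) (Fin n) ℂ) := by
  rw [selfAdjoint.mem_iff] at hX ⊢
  rw [star_smul, hX]
  simp

theorem PosDef.ofReal_smul {X : Matrix (Fin n) (Fin n) ℂ} (hX : X.PosDef) {r : ℝ} (hr : 0 < r) :
    ((r : ℂ) • X).PosDef :=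
  hX.smul (Complex.zero_lt_real.2 hr)

/-- Multilinear expansion in powers of s: the coefficients are numbers A^j ∧ β^(n-j) with 0 ≤ j ≤ m,
nonnegative by the definition of Γ_m, and the term with j = 0 is s^m n! > 0. So shifts of A by
positive multiples of β lie in the Gårding cone. -/
theorem re_wedgeMap_add_pos {k : ℕ} {A : Matrix (Fin (m + k)) (Fin (m + k)) ℂ}
    (hA : A ∈ Gam (m + k) m)
    {g : MultilinearMap ℂ (fun _ : Fin m => Matrix (Fin (m + k)) (Fin (m + k)) ℂ) ℂ}
    (hg : ∀ x, g x = wedgeMap (m + k) fun i => if h : (i : ℕ) < m then x ⟨i, h⟩ else 1)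
    {s : ℝ} (hs : 0 < s) : 0 < (g fun _ => A + (s : ℂ) • 1).re := by
  classical
  have h1 := g.map_add_univ (fun _ => A) (fun _ => (s : ℂ) • 1)
  simp only [Pi.add_def] at h1
  have h2 : ∀ S : Finset (Fin m), g (S.piecewise (fun _ => A) fun _ => (s : ℂ) • 1) =
      ((s ^ Sᶜ.card : ℝ) : ℂ) * wedgeMap (m + k)
        fun i : Fin (m + k) => if (i : ℕ) < S.card then A else 1 := by
    intro S
    have h2 := g.map_piecewise_smul (fun _ => (s : ℂ))
      (S.piecewise (fun _ => A) fun _ => 1) Sᶜ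
    have h3 : (Sᶜ.piecewise (fun i => (fun _ => (s : ℂ)) i •
          (S.piecewise (fun _ => A) fun _ => 1) i)
        (S.piecewise (fun _ => A) fun _ => 1)) =
        S.piecewise (fun _ => A) (fun _ => (s : ℂ) • (1 : Matrix _ _ ℂ)) := by
      funext i
      by_cases hi : i ∈ S <;> simp [Finset.piecewise, hi]
    rw [h3] at h2
    rw [h2, Finset.prod_const, smul_eq_mul, Complex.ofReal_pow, hg]
    congr 1
    have h4 : (S.map (Fin.castAddEmb k)).card = S.card := Finset.card_map _
    rw [← h4, ← wedge_card_eq]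
    congr 1
    funext i
    by_cases hi : (i : ℕ) < m
    · have hi' : i = Fin.castAdd k ⟨i, hi⟩ := rfl
      have h5 : i ∈ S.map (Fin.castAddEmb k) ↔ (⟨i, hi⟩ : Fin m) ∈ S := by
        conv_lhs => rw [hi']
        exact Finset.mem_map' (Fin.castAddEmb k)
      simp only [hi, Finset.piecewise, h5, dite_true]
    · have h5 : i ∉ S.map (Fin.castAddEmb k) := by
        simp only [Finset.mem_map, not_exists, not_and]
        rintro j - rfl
        exact hi (by simp)
      simp [hi, Finset.piecewise, h5]
  rw [h1, Complex.re_sum]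
  simp_rw [h2, Complex.re_ofReal_mul]
  refine Finset.sum_pos' (fun S _ => ?_) ⟨∅, Finset.mem_univ _, ?_⟩
  · refine mul_nonneg (by positivity) ?_
    rcases Nat.eq_zero_or_pos S.card with h | h
    · simp only [h, Nat.not_lt_zero, if_false]
      rw [wedgeMap_const]
      simp
    · have := hA.2 S.card h (by simpa using S.card_le_univ)
      rwa [wedge_eq_re] at this
  · refine mul_pos (by positivity) ?_
    simp only [Finset.card_empty, Nat.not_lt_zero, if_false]
    rw [wedgeMap_const]
    simp [Nat.factorial_pos]

theorem wedgeMap_im_eq_zero {A : Fin n → Matrix (Fin n) (Fin n) ℂ}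
    (hA : ∀ i, (A i).IsHermitian) : (wedgeMap n A).im = 0 := by
  have h := wedgeMap_star A
  have : (fun i => (A i)ᴴ) = A := funext fun i => hA i
  rw [this] at h
  exact Complex.conj_eq_iff_im.1 h

/-- Gårding's inequality for mixed discriminants: `m` of the entries lie in `Γ_m` or are positive
semidefinite, and the other entries are the identity. -/
theorem wedge_nonneg (hmn : m ≤ n) {A : Fin n → Matrix (Fin n) (Fin n) ℂ}
    (hA : ∀ i : Fin n, (i : ℕ) < m → A i ∈ Gam n m ∨ (A i).PosSemidef)
    (hA' : ∀ i : Fin n, m ≤ (i : ℕ) → A i = 1) : 0 ≤ wedge A := by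
  obtain ⟨k, rfl⟩ := Nat.exists_eq_add_of_le hmn
  set R := selfAdjoint (Matrix (Fin (m + k)) (Fin (m + k)) ℂ) with hRdef
  set K : Set (Matrix (Fin (m + k)) (Fin (m + k)) ℂ) := {Y | Y.PosDef} with hKdef
  have hR : ∀ x ∈ R, ∀ r : ℝ, (r : ℂ) • x ∈ R := fun x hx r => smul_mem_selfAdjoint hx r
  have h1K : (1 : Matrix (Fin (m + k)) (Fin (m + k)) ℂ) ∈ K := PosDef.one
  have hK' : ∀ x ∈ K, ∀ r : ℝ, 0 < r → (r : ℂ) • x ∈ K :=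
    fun x hx r hr => PosDef.ofReal_smul hx hr
  obtain ⟨g, g1, g2, g3, g4⟩ := exists_fix (R := R) (K := K) (m := m)
    (fun x hx y hy => PosDef.add hx hy) hK' hR (fun x hx => hx.1) h1K k (wedgeMap (m + k))
    (wedgeMap_symm _) (continuous_wedgeMap _) (tubeNonvanishing_wedgeMap _)
  have hgA : wedge A = (g fun i => A (Fin.castAdd k i)).re := by
    rw [wedge_eq_re, g4]
    congr 2
    funext i
    by_cases hi : (i : ℕ) < m
    · simp only [hi, dite_true]; rfl
    · simp only [hi, dite_false]; exact hA' i (not_lt.1 hi)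
  rw [hgA]
  refine garding_inequality (R := R) (e := 1) g1 g2 hR PosDef.one.1 ?_ ?_ ?_ _ ?_
  · intro x hx α hα
    have := g3 x hx _ (hK' _ h1K α hα)
    rwa [smul_smul] at this
  · intro a ha
    rw [g4]
    refine wedgeMap_im_eq_zero fun i => ?_
    by_cases hi : (i : ℕ) < m
    · simp only [hi, dite_true]; exact ha ⟨i, hi⟩
    · simp only [hi, dite_false]; exact isHermitian_one
  · rw [g4]
    have : (fun i : Fin (m + k) => if h : (i : ℕ) < m then
        (1 : Matrix (Fin (m + k)) (Fin (m + k)) ℂ) else 1) = fun _ => 1 := by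
      funext i; simp
    rw [this, wedgeMap_const]
    simp [Nat.factorial_pos]
  · intro i δ hδ
    have e1 : ∀ t : ℝ, A (Fin.castAdd k i) + (δ : ℂ) • 1 + (t : ℂ) • 1 =
        A (Fin.castAdd k i) + ((δ + t : ℝ) : ℂ) • 1 := by
      intro t; push_cast; module
    have h1R : (1 : Matrix (Fin (m + k)) (Fin (m + k)) ℂ) ∈ R := PosDef.one.1
    rcases hA (Fin.castAdd k i) (by simp) with h | h
    · refine ⟨R.add_mem h.1 (hR _ h1R _), fun t ht h0 => ?_⟩
      have := re_wedgeMap_add_pos h g4 (s := δ + t) (by linarith)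
      rw [e1] at h0
      rw [h0] at this
      simp at this
    -- A semidefinite matrix plus δ + t > 0 times the identity is positive definite, where the form
    -- cannot vanish on the diagonal.
    · refine ⟨R.add_mem h.1 (hR _ h1R _), fun t ht => ?_⟩
      rw [e1]
      refine g3.apply_ne_zero ?_
      exact PosDef.posSemidef_add h (hK' _ h1K _ (by linarith))

end MixedWedge

/-! ### The operators of the definition as sums of squares of directional derivatives. -/

section Hessian

open Matrix
open scoped ComplexOrder

variable {n m : ℕ}

/-- The second-order operator `∑ₖ ∂ₐₖ²`. -/
def sqSum {ι : Type*} [Fintype ι] (a : ι → Cn n) (η : Cn n → ℝ) (z : Cn n) : ℝ :=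
  ∑ k, fderiv ℝ (fderiv ℝ η) z (a k) (a k)

/-- The Levi form in the direction c is a quarter of the sum of the second derivatives in the real
directions c and ic; the mixed terms cancel. This converts rank-one complex forms into squares of
real derivatives. -/
theorem re_sum_complexHessian (η : Cn n → ℝ) (z : Cn n) (c : Fin n → ℂ) :
    (∑ j, ∑ k, c j * star (c k) * complexHessian η z j k).re =
      1 / 4 * (fderiv ℝ (fderiv ℝ η) z (WithLp.toLp 2 c) (WithLp.toLp 2 c) +
        fderiv ℝ (fderiv ℝ η) z (Complex.I • WithLp.toLp 2 c) (Complex.I • WithLp.toLp 2 c)) := by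
  set D := fderiv ℝ (fderiv ℝ η) z with hD
  have h1 : (WithLp.toLp 2 c : Cn n) =
      ∑ j, ((c j).re • basisVec j + (c j).im • (Complex.I • basisVec j)) := by
    ext i
    simp only [basisVec, WithLp.ofLp_sum, WithLp.ofLp_add, WithLp.ofLp_smul,
      Finset.sum_apply, Pi.add_apply, Pi.smul_apply, PiLp.single_apply]
    simp [Finset.sum_add_distrib]
  have h2 : Complex.I • (WithLp.toLp 2 c : Cn n) =
      ∑ j, ((c j).re • (Complex.I • basisVec j) + (-(c j).im) • basisVec j) := by
    rw [h1, Finset.smul_sum]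
    refine Finset.sum_congr rfl fun j _ => ?_
    rw [smul_add, smul_comm Complex.I (c j).re, smul_comm Complex.I (c j).im, smul_smul Complex.I,
      Complex.I_mul_I]
    module
  rw [h2, h1]
  simp only [map_sum, map_add, map_smul, _root_.sum_apply,
    _root_.add_apply, _root_.smul_apply, smul_eq_mul, Complex.re_sum]
  rw [Finset.sum_comm, ← Finset.sum_add_distrib, Finset.mul_sum]
  refine Finset.sum_congr rfl fun k _ => ?_
  simp only [Finset.mul_sum, ← Finset.sum_add_distrib]
  refine Finset.sum_congr rfl fun j _ => ?_
  simp only [complexHessian, iteratedFDeriv_two_apply, Matrix.of_apply, ← hD]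
  simp
  ring

/-- The arguments of the wedge product in `hessWedge`, with the Hessian replaced by `H`. -/
def hessArgs (m : ℕ) (A : Fin n → Matrix (Fin n) (Fin n) ℂ) (H : Matrix (Fin n) (Fin n) ℂ) :
    Fin n → Matrix (Fin n) (Fin n) ℂ :=
  fun i => if (i : ℕ) = 0 then H else if (i : ℕ) < m then A i else 1

theorem hessArgs_eq_update (hn : 0 < n) (A : Fin n → Matrix (Fin n) (Fin n) ℂ)
    (H : Matrix (Fin n) (Fin n) ℂ) :
    hessArgs m A H = Function.update (hessArgs m A 0) ⟨0, hn⟩ H := by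
  funext i
  by_cases hi : i = ⟨0, hn⟩
  · subst hi; simp [hessArgs]
  · have : (i : ℕ) ≠ 0 := fun h => hi (Fin.ext h)
    simp [hessArgs, hi, this]

theorem wedgeMap_hessArgs (hn : 0 < n) (A : Fin n → Matrix (Fin n) (Fin n) ℂ)
    (H : Matrix (Fin n) (Fin n) ℂ) :
    wedgeMap n (hessArgs m A H) =
      ∑ j, ∑ k, H j k * wedgeMap n (hessArgs m A (Matrix.single j k 1)) := by
  set L := (wedgeMap n).toLinearMap (hessArgs m A 0) ⟨0, hn⟩ with hL
  have h1 : ∀ H, wedgeMap n (hessArgs m A H) = L H := fun H => by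
    rw [hessArgs_eq_update hn]; rfl
  simp_rw [h1]
  conv_lhs => rw [Matrix.matrix_eq_sum_single H]
  rw [map_sum]
  refine Finset.sum_congr rfl fun j _ => ?_
  rw [map_sum]
  refine Finset.sum_congr rfl fun k _ => ?_
  have : Matrix.single j k (H j k) = H j k • Matrix.single j k (1 : ℂ) := by simp
  rw [this, map_smul, smul_eq_mul]

open scoped MatrixOrder in
theorem exists_eq_conjTranspose_mul_self {G : Matrix (Fin n) (Fin n) ℂ} (hG : G.PosSemidef) :
    ∃ C : Matrix (Fin n) (Fin n) ℂ, G = Cᴴ * C := by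
  obtain ⟨X, hX, -, rfl⟩ := CFC.exists_sqrt_of_isSelfAdjoint_of_quasispectrumRestricts
    hG.isHermitian (QuasispectrumRestricts.nnreal_of_nonneg hG.nonneg)
  exact ⟨X, by rw [← star_eq_conjTranspose, hX.star_eq]⟩

/-- For `α₁, …, αₘ₋₁` in `Γ_m` the operator `dd^c · ∧ α₁ ∧ ⋯ ∧ αₘ₋₁ ∧ β^(n-m)` is a sum of squares
of directional derivatives. -/
theorem exists_hessWedge_eq_sqSum (hm : 1 ≤ m) (hmn : m ≤ n)
    {A : Fin n → Matrix (Fin n) (Fin n) ℂ} (hA : ∀ i, A i ∈ Gam n m) :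
    ∃ a : Fin n ⊕ Fin n → Cn n, ∀ η z, hessWedge m A η z = sqSum a η z := by
  have hn : 0 < n := lt_of_lt_of_le hm hmn
  set G : Matrix (Fin n) (Fin n) ℂ :=
    Matrix.of fun j k => wedgeMap n (hessArgs m A (Matrix.single j k 1)) with hG
  -- G represents the operator as a linear functional of the Hessian. Its quadratic form at x is the
  -- wedge with a rank-one semidefinite matrix, which Gårding's inequality makes nonnegative.
  have hquad : ∀ x : Fin n → ℂ, star x ⬝ᵥ (G *ᵥ x) =
      wedgeMap n (hessArgs m A (vecMulVec (star x) x)) := by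
    intro x
    rw [wedgeMap_hessArgs hn]
    simp only [dotProduct, mulVec, hG, of_apply, vecMulVec_apply, Finset.mul_sum]
    refine Finset.sum_congr rfl fun j _ => Finset.sum_congr rfl fun k _ => ?_
    ring
  have hherm : ∀ H : Matrix (Fin n) (Fin n) ℂ,
      (fun i => (hessArgs m A H i)ᴴ) = hessArgs m A Hᴴ := by
    intro H
    funext i
    simp only [hessArgs]
    split_ifs
    · rfl
    · exact (hA i).1
    · exact isHermitian_one
  have hGpos : G.PosSemidef := by
    refine PosSemidef.of_dotProduct_mulVec_nonneg ?_ fun x => ?_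
    · ext j k
      rw [conjTranspose_apply]
      simp only [hG, of_apply]
      rw [wedgeMap_star, hherm, conjTranspose_single, star_one]
    · rw [hquad]
      have hp : (vecMulVec (star x) x).PosSemidef := posSemidef_vecMulVec_star_self x
      rw [Complex.nonneg_iff]
      constructor
      · rw [← wedge_eq_re]
        refine wedge_nonneg hmn (fun i hi => ?_) fun i hi => ?_
        · by_cases h0 : (i : ℕ) = 0
          · right; simpa [hessArgs, h0] using hp
          · left; simpa [hessArgs, h0, hi] using hA i
        · have h0 : (i : ℕ) ≠ 0 := by omega
          simp [hessArgs, h0, hi]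
      · refine (wedgeMap_im_eq_zero fun i => ?_).symm
        simp only [hessArgs]
        split_ifs
        · exact hp.1
        · exact (hA i).1
        · exact isHermitian_one
  obtain ⟨C, hC⟩ := exists_eq_conjTranspose_mul_self hGpos
  set v : Fin n → Cn n := fun l => WithLp.toLp 2 fun j => star (C l j) with hv
  -- With G = C*C, each row of C contributes the square of a complex derivative, that is, two real
  -- directions v and iv. The factors 1/2 absorb the 1/4 of the complex Hessian.
  refine ⟨Sum.elim (fun l => (1 / 2 : ℝ) • v l) fun l => (1 / 2 : ℝ) • (Complex.I • v l),
    fun η z => ?_⟩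
  have h1 : hessWedge m A η z = (wedgeMap n (hessArgs m A (complexHessian η z))).re := rfl
  rw [h1, wedgeMap_hessArgs hn]
  have h2 : ∀ j k, wedgeMap n (hessArgs m A (Matrix.single j k 1)) =
      ∑ l, star (C l j) * C l k := by
    intro j k
    have : G j k = (Cᴴ * C) j k := by rw [hC]
    rw [mul_apply] at this
    exact this
  have h3 : ∑ j, ∑ k, complexHessian η z j k *
      wedgeMap n (hessArgs m A (Matrix.single j k 1)) =
      ∑ l, ∑ j, ∑ k, star (C l j) * star (star (C l k)) * complexHessian η z j k := by
    simp_rw [h2, Finset.mul_sum, star_star]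
    rw [Finset.sum_comm (γ := Fin n) (s := Finset.univ) (t := Finset.univ)
      (f := fun l j => ∑ k, star (C l j) * C l k * complexHessian η z j k)]
    refine Finset.sum_congr rfl fun j _ => ?_
    rw [Finset.sum_comm]
    refine Finset.sum_congr rfl fun k _ => Finset.sum_congr rfl fun l _ => ?_
    ring
  rw [h3, Complex.re_sum, sqSum, Fintype.sum_sum_type, ← Finset.sum_add_distrib]
  refine Finset.sum_congr rfl fun l _ => ?_
  rw [re_sum_complexHessian η z fun j => star (C l j)]
  simp only [Sum.elim_inl, Sum.elim_inr, map_smul, _root_.smul_apply, smul_eq_mul]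
  ring

/-- The sum does not depend on i; summing over i and exchanging the sums gives n times it. -/
theorem sum_perm_apply (hn : 0 < n) (h : Fin n → ℝ) (i : Fin n) :
    ∑ σ : Equiv.Perm (Fin n), h (σ i) = (n.factorial / n : ℝ) * ∑ j, h j := by
  have h1 : ∀ j, ∑ σ : Equiv.Perm (Fin n), h (σ j) = ∑ σ : Equiv.Perm (Fin n), h (σ i) :=
    fun j => Fintype.sum_equiv (Equiv.mulRight (Equiv.swap i j)) _ _ fun σ => by simp
  have h2 : ∑ j, ∑ σ : Equiv.Perm (Fin n), h (σ j) = n.factorial * ∑ j, h j := by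
    rw [Finset.sum_comm]
    have : ∀ σ : Equiv.Perm (Fin n), ∑ j, h (σ j) = ∑ j, h j := fun σ => Equiv.sum_comp σ h
    simp [this, Fintype.card_perm]
  simp_rw [h1] at h2
  rw [Finset.sum_const, Finset.card_univ, Fintype.card_fin, nsmul_eq_mul] at h2
  have hn' : (n : ℝ) ≠ 0 := by exact_mod_cast hn.ne'
  field_simp
  linarith

/-- The real orthonormal basis `e₁, …, eₙ, ie₁, …, ieₙ` of `ℂⁿ`. -/
def stdVec (n : ℕ) : Fin n ⊕ Fin n → Cn n :=
  Sum.elim basisVec fun l => Complex.I • basisVec l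

theorem one_mem_Gam : (1 : Matrix (Fin n) (Fin n) ℂ) ∈ Gam n m := by
  refine ⟨isHermitian_one, fun k _ _ => ?_⟩
  simp only [ite_self]
  rw [wedge_eq_re, wedgeMap_const]
  simp

/-- With β in all other slots, each determinant is that of the identity with one column replaced,
namely a diagonal entry of the Hessian. Only the trace remains, a multiple of the Laplacian. -/
theorem exists_hessWedge_one (hn : 0 < n) : ∃ c : ℝ, 0 < c ∧ ∀ (η : Cn n → ℝ) z,
    hessWedge m (fun _ => 1) η z = c * sqSum (stdVec n) η z := by
  refine ⟨(n.factorial / n : ℝ) * (1 / 4), by positivity, fun η z => ?_⟩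
  have h1 : hessWedge m (fun _ => 1) η z =
      ∑ σ : Equiv.Perm (Fin n), (complexHessian η z (σ ⟨0, hn⟩) (σ ⟨0, hn⟩)).re := by
    have h2 : hessWedge m (fun _ => 1) η z =
      (wedgeMap n fun i : Fin n => if i = ⟨0, hn⟩ then complexHessian η z else 1).re := by
      rw [← wedge_eq_re, hessWedge]
      congr 1
      funext i
      simp [Fin.ext_iff]
    rw [h2, wedgeMap_apply, Complex.re_sum]
    refine Fintype.sum_equiv (Equiv.inv _) _ _ fun σ => ?_
    have h3 : (Matrix.of fun i j =>
        (if σ j = ⟨0, hn⟩ then complexHessian η z else 1 : Matrix (Fin n) (Fin n) ℂ) i j) =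
        (1 : Matrix (Fin n) (Fin n) ℂ).updateCol (σ⁻¹ ⟨0, hn⟩)
          fun i => complexHessian η z i (σ⁻¹ ⟨0, hn⟩) := by
      ext i j
      by_cases hj : j = σ⁻¹ ⟨0, hn⟩
      · subst hj; simp
      · have : σ j ≠ ⟨0, hn⟩ := fun h => hj (by rw [← h]; simp)
        rw [of_apply, if_neg this, updateCol_ne hj]
    rw [h3, ← cramer_apply, cramer_one]
    rfl
  rw [h1, sum_perm_apply hn fun j => (complexHessian η z j j).re, mul_assoc, sqSum,
    Fintype.sum_sum_type, ← Finset.sum_add_distrib, Finset.mul_sum (a := (1 / 4 : ℝ))]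
  congr 1
  refine Finset.sum_congr rfl fun j _ => ?_
  simp only [complexHessian, iteratedFDeriv_two_apply, Matrix.of_apply]
  simp [stdVec]

end Hessian
-- Distributional inequalities for sums of squares, and mollification.
section Distribution

open Topology Filter
open scoped Convolution

variable {n : ℕ} {ι : Type*} [Fintype ι]

/-- Nonnegative test functions on `U`. -/
structure IsTestFn (η : Cn n → ℝ) (U : Set (Cn n)) : Prop where
  smooth : ContDiff ℝ ∞ η
  compact : HasCompactSupport η
  subset : tsupport η ⊆ U
  nonneg : ∀ z, 0 ≤ η z

/-- `∑ₖ ∂ₐₖ² u ≥ 0` on `U` in the sense of distributions. -/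
def SubDist (a : ι → Cn n) (u : Cn n → ℝ) (U : Set (Cn n)) : Prop :=
  ∀ η, IsTestFn η U → 0 ≤ ∫ z, u z * sqSum a η z

theorem contDiff_fderiv_apply {η : Cn n → ℝ} {k : ℕ} (hη : ContDiff ℝ (k + 1 : ℕ) η) (v : Cn n) :
    ContDiff ℝ k fun z => fderiv ℝ η z v :=
  (hη.fderiv_right (m := k) (by norm_cast)).clm_apply contDiff_const

theorem sqSum_eq {η : Cn n → ℝ} (hη : ContDiff ℝ 2 η) (a : ι → Cn n) (z : Cn n) :
    sqSum a η z = ∑ k, fderiv ℝ (fun y => fderiv ℝ η y (a k)) z (a k) := by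
  refine Finset.sum_congr rfl fun k _ => ?_
  have h1 : DifferentiableAt ℝ (fderiv ℝ η) z :=
    ((hη.fderiv_right (m := 1) (by norm_num)).differentiable (by norm_num)) z
  rw [fderiv_clm_apply h1 (differentiableAt_const _)]
  simp

theorem continuous_sqSum {η : Cn n → ℝ} (hη : ContDiff ℝ 2 η) (a : ι → Cn n) :
    Continuous (sqSum a η) := by
  rw [funext (sqSum_eq hη a)]
  refine continuous_finsetSum _ fun k _ => ?_
  have h1 : ContDiff ℝ (1 : ℕ) fun y => fderiv ℝ η y (a k) :=
    contDiff_fderiv_apply (k := 1) (by exact_mod_cast hη) _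
  exact (contDiff_fderiv_apply (k := 0) h1 (a k)).continuous

theorem sqSum_eq_zero {η : Cn n → ℝ} (a : ι → Cn n) {z : Cn n} (hz : z ∉ tsupport η) :
    sqSum a η z = 0 := by
  have h1 : fderiv ℝ (fderiv ℝ η) z = 0 := by
    have : z ∉ tsupport (fderiv ℝ (fderiv ℝ η)) := fun h =>
      hz (tsupport_fderiv_subset ℝ (tsupport_fderiv_subset ℝ h))
    exact image_eq_zero_of_notMem_tsupport this
  simp [sqSum, h1]

theorem hasCompactSupport_sqSum {η : Cn n → ℝ} (hη : HasCompactSupport η) (a : ι → Cn n) :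
    HasCompactSupport (sqSum a η) :=
  HasCompactSupport.intro hη fun _ hz => sqSum_eq_zero a hz

theorem sqSum_add {f g : Cn n → ℝ} (hf : ContDiff ℝ 2 f) (hg : ContDiff ℝ 2 g) (a : ι → Cn n)
    (z : Cn n) : sqSum a (fun y => f y + g y) z = sqSum a f z + sqSum a g z := by
  have h0 : fderiv ℝ (fun y => f y + g y) = fun y => fderiv ℝ f y + fderiv ℝ g y := by
    funext y
    exact fderiv_fun_add (hf.differentiable (by norm_num) y) (hg.differentiable (by norm_num) y)
  rw [sqSum, h0, sqSum, sqSum, ← Finset.sum_add_distrib]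
  refine Finset.sum_congr rfl fun k _ => ?_
  rw [fderiv_fun_add]
  · rfl
  · exact (hf.fderiv_right (m := 1) (by norm_num)).differentiable (by norm_num) z
  · exact (hg.fderiv_right (m := 1) (by norm_num)).differentiable (by norm_num) z

theorem sqSum_comp_sub (η : Cn n → ℝ) (a : ι → Cn n) (w z : Cn n) :
    sqSum a (fun y => η (y - w)) z = sqSum a η (z - w) := by
  have h0 : fderiv ℝ (fun y => η (y - w)) = fun y => fderiv ℝ η (y - w) := by
    funext y
    exact fderiv_comp_sub w
  simp only [sqSum, h0]
  rw [fderiv_comp_sub (f := fderiv ℝ η) w]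

theorem fderiv_comp_const_sub {F : Type*} [NormedAddCommGroup F] [NormedSpace ℝ F] {f : Cn n → F}
    {w z : Cn n} (hf : DifferentiableAt ℝ f (w - z)) :
    fderiv ℝ (fun y => f (w - y)) z = -fderiv ℝ f (w - z) := by
  have h1 : HasFDerivAt (fun y => w - y) (-ContinuousLinearMap.id ℝ (Cn n)) z :=
    (hasFDerivAt_id z).const_sub w
  have h2 : HasFDerivAt (fun y => f (w - y)) _ z := hf.hasFDerivAt.comp z h1
  rw [h2.fderiv]
  simp

theorem sqSum_comp_sub_left {η : Cn n → ℝ} (hη : ContDiff ℝ 2 η) (a : ι → Cn n) (w z : Cn n) :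
    sqSum a (fun y => η (w - y)) z = sqSum a η (w - z) := by
  have h0 : fderiv ℝ (fun y => η (w - y)) = fun y => -fderiv ℝ η (w - y) := by
    funext y
    exact fderiv_comp_const_sub (hη.differentiable (by norm_num) _)
  have h1 : fderiv ℝ (fun y => -fderiv ℝ η (w - y)) z = fderiv ℝ (fderiv ℝ η) (w - z) := by
    rw [fderiv_fun_neg, fderiv_comp_const_sub, neg_neg]
    exact (hη.fderiv_right (m := 1) (by norm_num)).differentiable (by norm_num) _
  simp only [sqSum, h0, h1]

theorem integral_mul_fderiv_eq {f g : Cn n → ℝ} (hf : ContDiff ℝ 1 f) (hg : ContDiff ℝ 1 g)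
    (h : HasCompactSupport f ∨ HasCompactSupport g) (v : Cn n) :
    ∫ z, f z * fderiv ℝ g z v = -∫ z, fderiv ℝ f z v * g z := by
  have cf : Continuous fun z => fderiv ℝ f z v :=
    (contDiff_fderiv_apply (k := 0) (by exact_mod_cast hf) v).continuous
  have cg : Continuous fun z => fderiv ℝ g z v :=
    (contDiff_fderiv_apply (k := 0) (by exact_mod_cast hg) v).continuous
  refine integral_mul_fderiv_eq_neg_fderiv_mul_of_integrable ?_ ?_ ?_ ?_ ?_
  · refine (cf.mul hg.continuous).integrable_of_hasCompactSupport ?_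
    rcases h with h | h
    · exact (h.fderiv_apply ℝ v).mul_right
    · exact h.mul_left
  · refine (hf.continuous.mul cg).integrable_of_hasCompactSupport ?_
    rcases h with h | h
    · exact h.mul_right
    · exact (h.fderiv_apply ℝ v).mul_left
  · refine (hf.continuous.mul hg.continuous).integrable_of_hasCompactSupport ?_
    rcases h with h | h
    · exact h.mul_right
    · exact h.mul_left
  · exact fun x _ => hf.differentiable (by norm_num) x
  · exact fun x _ => hg.differentiable (by norm_num) x

/-- Two integrations by parts in each direction: the operator is formally self-adjoint since its
coefficients are constant. -/
theorem integral_mul_sqSum {f η : Cn n → ℝ} (hf : ContDiff ℝ 2 f) (hη : ContDiff ℝ 2 η)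
    (h : HasCompactSupport η) (a : ι → Cn n) :
    ∫ z, f z * sqSum a η z = ∫ z, sqSum a f z * η z := by
  have d1 : ∀ {g : Cn n → ℝ}, ContDiff ℝ 2 g → ∀ v, ContDiff ℝ 1 fun z => fderiv ℝ g z v :=
    fun hg v => by exact_mod_cast contDiff_fderiv_apply (k := 1) (by exact_mod_cast hg) v
  have d0 : ∀ {g : Cn n → ℝ}, ContDiff ℝ 2 g → ∀ v,
      Continuous fun z => fderiv ℝ (fun y => fderiv ℝ g y v) z v :=
    fun hg v => (contDiff_fderiv_apply (k := 0) (by exact_mod_cast d1 hg v) v).continuous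
  simp_rw [sqSum_eq hf, sqSum_eq hη, Finset.mul_sum, Finset.sum_mul]
  rw [integral_finsetSum, integral_finsetSum]
  · refine Finset.sum_congr rfl fun k _ => ?_
    rw [integral_mul_fderiv_eq (hf.of_le (by norm_num)) (d1 hη _) (Or.inr (h.fderiv_apply ℝ _)),
      integral_mul_fderiv_eq (d1 hf _) (hη.of_le (by norm_num)) (Or.inr h), neg_neg]
  · intro k _
    exact ((d0 hf _).mul hη.continuous).integrable_of_hasCompactSupport h.mul_left
  · intro k _
    refine (hf.continuous.mul (d0 hη _)).integrable_of_hasCompactSupport ?_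
    exact ((h.fderiv_apply ℝ _).fderiv_apply ℝ _).mul_left

theorem fderiv_convolution_apply {ρ g : Cn n → ℝ} (hρ : ContDiff ℝ 1 ρ) (hc : HasCompactSupport ρ)
    (hg : LocallyIntegrable g) (v : Cn n) (x : Cn n) :
    fderiv ℝ (ρ ⋆[ContinuousLinearMap.lsmul ℝ ℝ, volume] g) x v =
      ((fun y => fderiv ℝ ρ y v) ⋆[ContinuousLinearMap.lsmul ℝ ℝ, volume] g) x := by
  rw [(hc.hasFDerivAt_convolution_left (ContinuousLinearMap.lsmul ℝ ℝ) hρ hg x).fderiv,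
    convolution_def, convolution_def, ContinuousLinearMap.integral_apply]
  · rfl
  · exact (hc.fderiv ℝ).convolutionExists_left _ (hρ.continuous_fderiv (by norm_num)) hg x

theorem sqSum_convolution {ρ g : Cn n → ℝ} (hρ : ContDiff ℝ 2 ρ) (hc : HasCompactSupport ρ)
    (hg : LocallyIntegrable g) (a : ι → Cn n) (z : Cn n) :
    sqSum a (ρ ⋆[ContinuousLinearMap.lsmul ℝ ℝ, volume] g) z =
      ∫ w, g w * sqSum a (fun y => ρ (z - y)) w := by
  have d1 : ∀ v, ContDiff ℝ 1 fun z => fderiv ℝ ρ z v :=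
    fun v => by exact_mod_cast contDiff_fderiv_apply (k := 1) (by exact_mod_cast hρ) v
  have d0 : ∀ v, Continuous fun z => fderiv ℝ (fun y => fderiv ℝ ρ y v) z v :=
    fun v => (contDiff_fderiv_apply (k := 0) (by exact_mod_cast d1 v) v).continuous
  have hsm : ContDiff ℝ 2 (ρ ⋆[ContinuousLinearMap.lsmul ℝ ℝ, volume] g) :=
    hc.contDiff_convolution_left (n := 2) _ hρ hg
  rw [sqSum_eq hsm]
  have h1 : ∀ v, (fun y => fderiv ℝ (ρ ⋆[ContinuousLinearMap.lsmul ℝ ℝ, volume] g) y v) =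
      ((fun y => fderiv ℝ ρ y v) ⋆[ContinuousLinearMap.lsmul ℝ ℝ, volume] g) :=
    fun v => funext fun y => fderiv_convolution_apply (hρ.of_le (by norm_num)) hc hg v y
  simp_rw [h1, sqSum_comp_sub_left hρ]
  have h2 : ∀ v, fderiv ℝ ((fun y => fderiv ℝ ρ y v) ⋆[ContinuousLinearMap.lsmul ℝ ℝ, volume] g) z v
      = ∫ w, fderiv ℝ (fun y => fderiv ℝ ρ y v) w v * g (z - w) := by
    intro v
    rw [fderiv_convolution_apply (d1 v) (hc.fderiv_apply ℝ v) hg v z, convolution_def]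
    rfl
  simp_rw [h2]
  rw [← integral_sub_left_eq_self (fun w => g w * sqSum a ρ (z - w)) volume z,
    ← integral_finsetSum]
  · congr 1
    funext w
    rw [sub_sub_cancel, sqSum_eq hρ, Finset.mul_sum]
    exact Finset.sum_congr rfl fun k _ => mul_comm _ _
  · intro k _
    exact ((hc.fderiv_apply ℝ _).fderiv_apply ℝ _).convolutionExists_left
      (ContinuousLinearMap.lsmul ℝ ℝ) (d0 (a k)) hg z

/-- Continuous functions are locally uniform limits of smooth functions, with preservation of the
inequalities `∑ₖ ∂ₐₖ² u ≥ 0`. -/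
theorem exists_smooth_approx {U K : Set (Cn n)} (hU : IsOpen U) (hK : IsCompact K) (hKU : K ⊆ U)
    {u : Cn n → ℝ} (hu : ContinuousOn u U) {ε : ℝ} (hε : 0 < ε) :
    ∃ w : Cn n → ℝ, ContDiff ℝ ∞ w ∧ HasCompactSupport w ∧ (∀ z ∈ K, |w z - u z| ≤ ε) ∧
      ∀ a : ι → Cn n, SubDist a u U → ∀ z ∈ K, 0 ≤ sqSum a w z := by
  obtain ⟨δ, hδ, hδU⟩ := hK.exists_cthickening_subset_open hU hKU
  set K₁ := Metric.cthickening δ K with hK₁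
  have hK₁c : IsCompact K₁ := hK.cthickening
  have huc : UniformContinuousOn u K₁ :=
    hK₁c.uniformContinuousOn_of_continuous (hu.mono hδU)
  obtain ⟨δ', hδ', huc'⟩ := Metric.uniformContinuousOn_iff.1 huc ε hε
  set r := min δ δ' with hr
  have hr0 : 0 < r := lt_min hδ hδ'
  let φ : ContDiffBump (0 : Cn n) := ⟨r / 2, r, by positivity, by linarith⟩
  have hφr : φ.rOut = r := rfl
  set g : Cn n → ℝ := K₁.indicator u with hg
  have hgi : Integrable g := (integrable_indicator_iff hK₁c.measurableSet).2
    ((hu.mono hδU).integrableOn_compact hK₁c)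
  have hgc : HasCompactSupport g := HasCompactSupport.intro hK₁c fun z hz =>
    indicator_of_notMem hz u
  have hmem : ∀ z ∈ K, ∀ y, dist y z ≤ r → y ∈ K₁ := fun z hz y hy =>
    Metric.mem_cthickening_of_dist_le y z δ K hz (hy.trans (min_le_left _ _))
  have hφs : ContDiff ℝ ∞ (φ.normed volume) := φ.contDiff_normed
  have hφc : HasCompactSupport (φ.normed volume) := φ.hasCompactSupport_normed
  refine ⟨φ.normed volume ⋆[ContinuousLinearMap.lsmul ℝ ℝ, volume] g,
    hφc.contDiff_convolution_left (n := ⊤) _ hφs hgi.locallyIntegrable,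
    HasCompactSupport.convolution _ hφc hgc, fun z hz => ?_, fun a ha z hz => ?_⟩
  · have hgz : g z = u z := indicator_of_mem (hmem z hz z (by simpa using hr0.le)) u
    rw [← hgz, ← Real.dist_eq]
    refine φ.dist_normed_convolution_le hgi.aestronglyMeasurable fun y hy => ?_
    rw [hφr, Metric.mem_ball] at hy
    have hyK := hmem z hz y hy.le
    rw [hgz, show g y = u y from indicator_of_mem hyK u]
    exact (huc' y hyK z (hmem z hz z (by simpa using hr0.le))
      (hy.trans_le (min_le_right _ _))).le
  -- The derivatives fall on y ↦ ρ(z − y), which is a nonnegative test function supported in K₁ ⊆ U.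
  -- The cut-off of u to K₁ is therefore invisible, and the assumed inequality for u is the one
  -- needed.
  · rw [sqSum_convolution (hφs.of_le ENat.LEInfty.out) hφc hgi.locallyIntegrable]
    have hts : tsupport (fun y => φ.normed volume (z - y)) ⊆ K₁ := by
      refine closure_minimal (fun y hy => ?_) hK₁c.isClosed
      have : z - y ∈ Function.support (φ.normed volume) := hy
      rw [φ.support_normed_eq, hφr, mem_ball_zero_iff] at this
      exact hmem z hz y (by rw [dist_comm, dist_eq_norm]; exact this.le)
    have htest : IsTestFn (fun y => φ.normed volume (z - y)) U :=
      ⟨hφs.comp (contDiff_const.sub contDiff_id),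
        HasCompactSupport.of_support_subset_isCompact hK₁c (subset_closure.trans hts),
        hts.trans hδU, fun y => φ.nonneg_normed _⟩
    have := ha _ htest
    refine this.trans_eq ?_
    congr 1
    funext y
    by_cases hy : y ∈ tsupport (fun y => φ.normed volume (z - y))
    · rw [show g y = u y from indicator_of_mem (hts hy) u]
    · rw [sqSum_eq_zero a hy, mul_zero, mul_zero]

end Distribution
-- Stability under sums, maxima and localization.
section DistributionOperations

open Topology Filter
open scoped Manifold

variable {n : ℕ} {ι : Type*} [Fintype ι]

theorem IsTestFn.contDiff_two {η : Cn n → ℝ} {U : Set (Cn n)} (h : IsTestFn η U) :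
    ContDiff ℝ 2 η := h.smooth.of_le ENat.LEInfty.out

theorem IsTestFn.mono {η : Cn n → ℝ} {U V : Set (Cn n)} (h : IsTestFn η U) (hUV : U ⊆ V) :
    IsTestFn η V := ⟨h.smooth, h.compact, h.subset.trans hUV, h.nonneg⟩

theorem SubDist.mono {a : ι → Cn n} {u : Cn n → ℝ} {U V : Set (Cn n)} (h : SubDist a u V)
    (hUV : U ⊆ V) : SubDist a u U := fun η hη => h η (hη.mono hUV)

theorem SubDist.congr {a : ι → Cn n} {u v : Cn n → ℝ} {U : Set (Cn n)} (h : SubDist a u U)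
    (huv : EqOn u v U) : SubDist a v U := by
  intro η hη
  refine (h η hη).trans_eq (integral_congr_ae (Eventually.of_forall fun z => ?_))
  by_cases hz : z ∈ tsupport η
  · simp only [huv (hη.subset hz)]
  · simp only [sqSum_eq_zero a hz, mul_zero]

theorem integrable_mul_sqSum {u η : Cn n → ℝ} (hη : ContDiff ℝ 2 η) (hc : HasCompactSupport η)
    (hu : IntegrableOn u (tsupport η)) (a : ι → Cn n) :
    Integrable fun z => u z * sqSum a η z := by
  obtain ⟨C, hC⟩ := (hasCompactSupport_sqSum hc a).exists_bound_of_continuous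
    (continuous_sqSum hη a)
  rw [← integrableOn_iff_integrable_of_support_subset (s := tsupport η)]
  · exact Integrable.mul_bdd (c := C) hu (continuous_sqSum hη a).aestronglyMeasurable
      (Eventually.of_forall hC)
  · intro z hz
    by_contra hz'
    exact hz (by simp [sqSum_eq_zero a hz'])

theorem IsTestFn.integrable_mul {u η : Cn n → ℝ} {U : Set (Cn n)} (hη : IsTestFn η U)
    (hu : ContinuousOn u U) (a : ι → Cn n) : Integrable fun z => u z * sqSum a η z :=
  integrable_mul_sqSum hη.contDiff_two hη.compact
    ((hu.mono hη.subset).integrableOn_compact hη.compact) a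

theorem subDist_const (a : ι → Cn n) (c : ℝ) (U : Set (Cn n)) : SubDist a (fun _ => c) U := by
  intro η hη
  rw [integral_mul_sqSum contDiff_const hη.contDiff_two hη.compact]
  simp [sqSum]

theorem SubDist.add {a : ι → Cn n} {u v : Cn n → ℝ} {U : Set (Cn n)} (hu : ContinuousOn u U)
    (hv : ContinuousOn v U) (hua : SubDist a u U) (hva : SubDist a v U) :
    SubDist a (fun z => u z + v z) U := by
  intro η hη
  simp_rw [add_mul]
  rw [integral_add (hη.integrable_mul hu a) (hη.integrable_mul hv a)]
  exact add_nonneg (hua η hη) (hva η hη)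

theorem SubDist.const_mul {a : ι → Cn n} {u : Cn n → ℝ} {U : Set (Cn n)} (h : SubDist a u U)
    {c : ℝ} (hc : 0 ≤ c) : SubDist a (fun z => c * u z) U := by
  intro η hη
  simp_rw [mul_assoc]
  rw [integral_const_mul]
  exact mul_nonneg hc (h η hη)

theorem sqSum_const_mul {f : Cn n → ℝ} (hf : ContDiff ℝ 2 f) (c : ℝ) (a : ι → Cn n) (z : Cn n) :
    sqSum a (fun y => c * f y) z = c * sqSum a f z := by
  have h0 : fderiv ℝ (fun y => c * f y) = fun y => c • fderiv ℝ f y := by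
    funext y
    exact fderiv_const_mul (hf.differentiable (by norm_num) y) c
  rw [sqSum, h0, sqSum, Finset.mul_sum]
  refine Finset.sum_congr rfl fun k _ => ?_
  have h1 : DifferentiableAt ℝ (fderiv ℝ f) z :=
    (hf.fderiv_right (m := 1) (by norm_num)).differentiable (by norm_num) z
  have h2 : HasFDerivAt (fun y => c • fderiv ℝ f y) (c • fderiv ℝ (fderiv ℝ f) z) z :=
    h1.hasFDerivAt.const_smul c
  rw [h2.fderiv]
  rfl

/-- A smooth function `s > 0` with `s² = r² + κ²` satisfies `s ∑ ∂ₖ² s ≥ r ∑ ∂ₖ² r`. -/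
theorem mul_sqSum_le_of_sq_eq {r s : Cn n → ℝ} {κ : ℝ} (hr : ContDiff ℝ 2 r)
    (hs : ContDiff ℝ 2 s) (hs0 : ∀ z, 0 < s z) (h : ∀ z, s z * s z = r z * r z + κ * κ)
    (a : ι → Cn n) (z : Cn n) : r z * sqSum a r z ≤ s z * sqSum a s z := by
  rw [sqSum_eq hr, sqSum_eq hs, Finset.mul_sum, Finset.mul_sum]
  refine Finset.sum_le_sum fun k _ => ?_
  set v := a k
  have d1 : ∀ {g : Cn n → ℝ}, ContDiff ℝ 2 g → ∀ y, DifferentiableAt ℝ g y :=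
    fun hg y => hg.differentiable (by norm_num) y
  have d2 : ∀ {g : Cn n → ℝ}, ContDiff ℝ 2 g → ∀ y,
      DifferentiableAt ℝ (fun y => fderiv ℝ g y v) y := fun {g} hg y => by
    have : ContDiff ℝ (1 : ℕ) fun y => fderiv ℝ g y v :=
      contDiff_fderiv_apply (k := 1) (by exact_mod_cast hg) v
    exact this.differentiable (by norm_num) y
  have e1 : ∀ y, s y * fderiv ℝ s y v = r y * fderiv ℝ r y v := by
    intro y
    have h1 : fderiv ℝ (fun y => s y * s y) y v = fderiv ℝ (fun y => r y * r y + κ * κ) y v := by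
      rw [funext h]
    rw [fderiv_add_const, fderiv_fun_mul (d1 hs y) (d1 hs y),
      fderiv_fun_mul (d1 hr y) (d1 hr y)] at h1
    simp at h1
    linarith
  have e2 : s z * fderiv ℝ (fun y => fderiv ℝ s y v) z v + fderiv ℝ s z v * fderiv ℝ s z v =
      r z * fderiv ℝ (fun y => fderiv ℝ r y v) z v + fderiv ℝ r z v * fderiv ℝ r z v := by
    have h1 : fderiv ℝ (fun y => s y * fderiv ℝ s y v) z v =
        fderiv ℝ (fun y => r y * fderiv ℝ r y v) z v := by rw [funext e1]
    rw [fderiv_fun_mul (d1 hs z) (d2 hs z), fderiv_fun_mul (d1 hr z) (d2 hr z)] at h1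
    simpa using h1
  -- From ss′ = rr′ and r² ≤ s² one gets s′² ≤ r′². Subtracting this from the second derivative `e2`
  -- of s² = r² + κ² leaves ss″ ≥ rr″ in each direction.
  have e3 : fderiv ℝ s z v * fderiv ℝ s z v ≤ fderiv ℝ r z v * fderiv ℝ r z v := by
    set x := fderiv ℝ s z v
    set y := fderiv ℝ r z v
    have hsz := hs0 z
    have h1 : (s z * x) * (s z * x) ≤ (s z * y) * (s z * y) := by
      have : (s z * x) * (s z * x) = (r z * r z) * (y * y) := by rw [e1]; ring
      have h3 : (s z * y) * (s z * y) = (r z * r z + κ * κ) * (y * y) := by rw [← h]; ring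
      rw [this, h3]
      nlinarith [mul_nonneg (mul_self_nonneg κ) (mul_self_nonneg y)]
    have h2 : (s z * s z) * (x * x) ≤ (s z * s z) * (y * y) := by linarith
    exact le_of_mul_le_mul_left h2 (mul_pos hsz hsz)
  linarith

/-- A smooth regularization of the maximum. -/
theorem exists_smooth_max {p q : Cn n → ℝ} (hp : ContDiff ℝ ∞ p) (hq : ContDiff ℝ ∞ q) {κ : ℝ}
    (hκ : 0 < κ) : ∃ g : Cn n → ℝ, ContDiff ℝ ∞ g ∧ (∀ z, |g z - max (p z) (q z)| ≤ κ) ∧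
      ∀ (a : ι → Cn n) z, 0 ≤ sqSum a p z → 0 ≤ sqSum a q z → 0 ≤ sqSum a g z := by
  set r : Cn n → ℝ := fun z => p z + (-1) * q z with hr
  set s : Cn n → ℝ := fun z => Real.sqrt (r z * r z + κ * κ) with hs
  have hrs : ContDiff ℝ ∞ r := hp.add (contDiff_const.mul hq)
  have hpos : ∀ z, 0 < r z * r z + κ * κ := fun z =>
    add_pos_of_nonneg_of_pos (mul_self_nonneg _) (mul_pos hκ hκ)
  have hss : ContDiff ℝ ∞ s := ((hrs.mul hrs).add contDiff_const).sqrt fun z => (hpos z).ne'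
  have hs0 : ∀ z, 0 < s z := fun z => Real.sqrt_pos.2 (hpos z)
  have hsq : ∀ z, s z * s z = r z * r z + κ * κ := fun z => Real.mul_self_sqrt (hpos z).le
  have h2 : ∀ {f : Cn n → ℝ}, ContDiff ℝ ∞ f → ContDiff ℝ 2 f :=
    fun hf => hf.of_le ENat.LEInfty.out
  refine ⟨fun z => (1 / 2) * ((p z + q z) + s z), contDiff_const.mul ((hp.add hq).add hss),
    fun z => ?_, fun a z ha hb => ?_⟩
  · have h1 : |r z| ≤ s z := by
      rw [← Real.sqrt_mul_self_eq_abs]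
      exact Real.sqrt_le_sqrt (by nlinarith)
    have h3 : s z ≤ |r z| + κ := by
      refine Real.sqrt_le_iff.2 ⟨by positivity, ?_⟩
      nlinarith [abs_mul_abs_self (r z), mul_nonneg (abs_nonneg (r z)) hκ.le]
    have h4 : r z = p z - q z := by simp [hr]; ring
    have h5 : max (p z) (q z) = (p z + q z + |r z|) / 2 := by
      rw [h4]
      rcases le_total (p z) (q z) with h | h
      · rw [max_eq_right h, abs_of_nonpos (by linarith)]; ring
      · rw [max_eq_left h, abs_of_nonneg (by linarith)]; ring
    rw [h5, abs_le]
    constructor <;> linarith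
  · rw [sqSum_const_mul ((h2 (hp.add hq)).add (h2 hss)), sqSum_add (h2 (hp.add hq)) (h2 hss),
      sqSum_add (h2 hp) (h2 hq)]
    have h1 := mul_sqSum_le_of_sq_eq (h2 hrs) (h2 hss) hs0 hsq a z
    have h3 : sqSum a r z = sqSum a p z - sqSum a q z := by
      rw [hr, sqSum_add (h2 hp) (h2 (contDiff_const.mul hq)), sqSum_const_mul (h2 hq)]
      ring
    have h4 : |r z| ≤ s z := by
      rw [← Real.sqrt_mul_self_eq_abs]
      exact Real.sqrt_le_sqrt (by nlinarith)
    rw [abs_le] at h4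
    rw [h3] at h1
    -- Writing L for `sqSum a`, sLs ≥ r(Lp − Lq) gives s(Lp + Lq + Ls) ≥ (s + r)Lp + (s − r)Lq, and
    -- |r| ≤ s.
    have h5 : 0 ≤ s z * (sqSum a p z + sqSum a q z + sqSum a s z) := by
      nlinarith [mul_nonneg (by linarith : 0 ≤ s z + r z) ha,
        mul_nonneg (by linarith : 0 ≤ s z - r z) hb]
    have := nonneg_of_mul_nonneg_right h5 (hs0 z)
    linarith

/-- For smooth functions use the regularized maximum. Approximating u and v uniformly on the support
of η costs 2ε ∫ |Lη|, where L is the operator. -/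
theorem SubDist.max {a : ι → Cn n} {u v : Cn n → ℝ} {U : Set (Cn n)} (hU : IsOpen U)
    (hu : ContinuousOn u U) (hv : ContinuousOn v U) (hua : SubDist a u U) (hva : SubDist a v U) :
    SubDist a (fun z => max (u z) (v z)) U := by
  intro η hη
  set K := tsupport η with hK
  have hL : Integrable fun z => |sqSum a η z| :=
    ((continuous_sqSum hη.contDiff_two a).integrable_of_hasCompactSupport
      (hasCompactSupport_sqSum hη.compact a)).abs
  set C := ∫ z, |sqSum a η z| with hC
  have hC0 : 0 ≤ C := integral_nonneg fun z => abs_nonneg _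
  have hmax : ContinuousOn (fun z => Max.max (u z) (v z)) U := hu.sup hv
  have key : ∀ ε : ℝ, 0 < ε → -(2 * ε * C) ≤ ∫ z, Max.max (u z) (v z) * sqSum a η z := by
    intro ε hε
    obtain ⟨p, hp, -, hpu, hpa⟩ := exists_smooth_approx (ι := ι) hU hη.compact hη.subset hu hε
    obtain ⟨q, hq, -, hqv, hqa⟩ := exists_smooth_approx (ι := ι) hU hη.compact hη.subset hv hε
    obtain ⟨g, hg, hgm, hga⟩ := exists_smooth_max (ι := ι) hp hq hε
    have h1 : 0 ≤ ∫ z, g z * sqSum a η z := by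
      rw [integral_mul_sqSum (hg.of_le ENat.LEInfty.out) hη.contDiff_two hη.compact]
      refine integral_nonneg fun z => ?_
      by_cases hz : z ∈ K
      · exact mul_nonneg (hga a z (hpa a hua z hz) (hqa a hva z hz)) (hη.nonneg z)
      · simp [image_eq_zero_of_notMem_tsupport hz]
    have h2 : ∀ z, g z * sqSum a η z - 2 * ε * |sqSum a η z| ≤
        Max.max (u z) (v z) * sqSum a η z := by
      intro z
      by_cases hz : z ∈ K
      · have h3 := abs_max_sub_max_le_max (p z) (q z) (u z) (v z)
        have h4 : |g z - Max.max (u z) (v z)| ≤ 2 * ε := by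
          have := abs_sub_le (g z) (Max.max (p z) (q z)) (Max.max (u z) (v z))
          have h5 := max_le (hpu z hz) (hqv z hz)
          linarith [hgm z]
        have h6 : (g z - Max.max (u z) (v z)) * sqSum a η z ≤ 2 * ε * |sqSum a η z| := by
          refine (le_abs_self _).trans ?_
          rw [abs_mul]
          exact mul_le_mul_of_nonneg_right h4 (abs_nonneg _)
        linarith
      · simp [sqSum_eq_zero a hz]
    have hgi := hη.integrable_mul (hg.continuous.continuousOn) a
    have h3 := integral_mono (hgi.sub (hL.const_mul (2 * ε))) (hη.integrable_mul hmax a) h2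
    rw [integral_sub' hgi (hL.const_mul _), integral_const_mul] at h3
    linarith
  by_contra hneg
  push Not at hneg
  set I := ∫ z, Max.max (u z) (v z) * sqSum a η z
  -- This ε makes the error 2εC at most −I/2, so I ≥ I/2, impossible for I < 0.
  have h1 := key (-I / (4 * (C + 1))) (div_pos (by linarith) (by linarith))
  have h2 : 2 * (-I / (4 * (C + 1))) * C = (-I / 2) * (C / (C + 1)) := by field_simp; ring
  have h3 : C / (C + 1) ≤ 1 := by rw [div_le_one (by linarith)]; linarith
  rw [h2] at h1
  nlinarith [mul_le_mul_of_nonneg_left h3 (by linarith : 0 ≤ -I / 2)]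

/-- The inequality is local: split η as χη + (1 − χ)η, where χ = 1 near the part of the support of η
outside V and χ is supported in a compact subset of U. -/
theorem SubDist.union {a : ι → Cn n} {u : Cn n → ℝ} {U V : Set (Cn n)} (hU : IsOpen U)
    (hV : IsOpen V) (hu : ContinuousOn u (U ∪ V)) (hua : SubDist a u U) (hva : SubDist a u V) :
    SubDist a u (U ∪ V) := by
  intro η hη
  have hK₁ : IsCompact (tsupport η \ V) := hη.compact.diff hV
  have hK₁U : tsupport η \ V ⊆ U := fun z hz => (hη.subset hz.1).resolve_right hz.2
  obtain ⟨L, hL, hKL, hLU⟩ := exists_compact_between hK₁ hU hK₁U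
  obtain ⟨χ, hχ1, hχ0, hχ⟩ := exists_contMDiffMap_one_nhds_of_subset_interior (n := ⊤)
    𝓘(ℝ, Cn n) hK₁.isClosed hKL
  have hχs : ContDiff ℝ ∞ χ := χ.contMDiff.contDiff
  have t1 : IsTestFn (fun z => χ z * η z) U := by
    have hs : tsupport (fun z => χ z * η z) ⊆ L := by
      refine closure_minimal (fun z hz => ?_) hL.isClosed
      by_contra hz'
      exact hz (by simp [hχ0 z hz'])
    exact ⟨hχs.mul hη.smooth, hη.compact.mul_left, hs.trans hLU,
      fun z => mul_nonneg (hχ z).1 (hη.nonneg z)⟩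
  have t2 : IsTestFn (fun z => (1 - χ z) * η z) V := by
    refine ⟨(contDiff_const.sub hχs).mul hη.smooth, hη.compact.mul_left, fun z hz => ?_,
      fun z => mul_nonneg (by linarith [(hχ z).2]) (hη.nonneg z)⟩
    by_contra hzV
    have hz1 : z ∈ tsupport η := closure_mono (Function.support_mul_subset_right _ _) hz
    have h1 : ∀ᶠ y in 𝓝 z, χ y = 1 := eventually_nhdsSet_iff_forall.1 hχ1 z ⟨hz1, hzV⟩
    refine (notMem_tsupport_iff_eventuallyEq.2 ?_) hz
    filter_upwards [h1] with y hy
    simp [hy]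
  have h1 : ∀ z, sqSum a η z =
      sqSum a (fun z => χ z * η z) z + sqSum a (fun z => (1 - χ z) * η z) z := by
    intro z
    rw [← sqSum_add t1.contDiff_two t2.contDiff_two]
    congr 1
    funext y
    ring
  simp_rw [h1, mul_add]
  rw [integral_add (t1.integrable_mul (hu.mono subset_union_left) a)
    (t2.integrable_mul (hu.mono subset_union_right) a)]
  exact add_nonneg (hua _ t1) (hva _ t2)

end DistributionOperations
-- The Laplacian and the sub-mean value inequality.
section MeanValue

open Topology Filter Metric

variable {n : ℕ}

theorem inner_real_eq (w v : Cn n) : inner ℝ w v = ∑ i, (star (w i) * v i).re := by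
  rw [PiLp.inner_apply]
  refine Finset.sum_congr rfl fun i _ => ?_
  rw [Complex.inner, mul_comm]
  rfl

theorem sum_inner_smul_stdVec (w : Cn n) : ∑ k, (inner ℝ w (stdVec n k) : ℝ) • stdVec n k = w := by
  have h1 : ∀ l, (inner ℝ w (basisVec l) : ℝ) = (w l).re := fun l => by
    rw [inner_real_eq]
    simp [basisVec, PiLp.single_apply, apply_ite Complex.re]
  have h2 : ∀ l, (inner ℝ w (Complex.I • basisVec l) : ℝ) = (w l).im := fun l => by
    rw [inner_real_eq]
    simp [basisVec, PiLp.single_apply, apply_ite Complex.re]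
  rw [Fintype.sum_sum_type]
  simp only [stdVec, Sum.elim_inl, Sum.elim_inr, h1, h2]
  ext i
  simp [basisVec, Pi.single_apply]

/-- The function `(1 - ‖w‖²)⁺ / 2`. -/
def paraboloid (w : Cn n) : ℝ := (1 - min ‖w‖ 1 ^ 2) / 2

theorem paraboloid_nonneg (w : Cn n) : 0 ≤ paraboloid w := by
  have h1 : min ‖w‖ 1 ≤ 1 := min_le_right _ _
  have h0 : 0 ≤ min ‖w‖ 1 := le_min (norm_nonneg _) zero_le_one
  have : min ‖w‖ 1 ^ 2 ≤ 1 := pow_le_one₀ h0 h1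
  unfold paraboloid
  linarith

theorem paraboloid_eq_zero {w : Cn n} (hw : 1 ≤ ‖w‖) : paraboloid w = 0 := by
  simp [paraboloid, min_eq_right hw]

theorem hasCompactSupport_paraboloid : HasCompactSupport (paraboloid (n := n)) :=
  HasCompactSupport.intro (isCompact_closedBall (0 : Cn n) 1) fun w hw =>
    paraboloid_eq_zero (by simpa using (not_le.1 (by simpa using hw) : 1 < ‖w‖).le)

theorem lipschitzWith_paraboloid : LipschitzWith 1 (paraboloid (n := n)) := by
  refine LipschitzWith.of_dist_le_mul fun x y => ?_
  rw [NNReal.coe_one, one_mul, Real.dist_eq, dist_eq_norm]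
  have hx1 : min ‖x‖ 1 ≤ 1 := min_le_right _ _
  have hx0 : 0 ≤ min ‖x‖ 1 := le_min (norm_nonneg _) zero_le_one
  have hy1 : min ‖y‖ 1 ≤ 1 := min_le_right _ _
  have hy0 : 0 ≤ min ‖y‖ 1 := le_min (norm_nonneg _) zero_le_one
  have h1 : |min ‖y‖ 1 - min ‖x‖ 1| ≤ ‖x - y‖ := by
    have h2 := abs_min_sub_min_le_max ‖y‖ 1 ‖x‖ 1
    rw [sub_self, abs_zero] at h2
    refine h2.trans (max_le ?_ (norm_nonneg _))
    rw [norm_sub_rev]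
    exact abs_norm_sub_norm_le y x
  have h2 : paraboloid x - paraboloid y =
      (min ‖y‖ 1 - min ‖x‖ 1) * ((min ‖y‖ 1 + min ‖x‖ 1) / 2) := by
    unfold paraboloid; ring
  rw [h2, abs_mul, abs_of_nonneg (by positivity : 0 ≤ (min ‖y‖ 1 + min ‖x‖ 1) / 2)]
  calc _ ≤ |min ‖y‖ 1 - min ‖x‖ 1| * 1 :=
        mul_le_mul_of_nonneg_left (by linarith) (abs_nonneg _)
    _ ≤ _ := by rwa [mul_one]

theorem lineDeriv_paraboloid_of_lt {w : Cn n} (hw : ‖w‖ < 1) (v : Cn n) :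
    lineDeriv ℝ paraboloid w v = -inner ℝ w v := by
  have h1 : HasDerivAt (fun t : ℝ => w + t • v) v 0 := by
    simpa using ((hasDerivAt_id (0 : ℝ)).smul_const v).const_add w
  have h2 : HasDerivAt (fun t : ℝ => (1 - ‖w + t • v‖ ^ 2) / 2) (-inner ℝ w v) 0 := by
    have h3 := (h1.norm_sq.const_sub 1).div_const 2
    rw [zero_smul, add_zero] at h3
    have h4 : -(2 * inner ℝ w v) / 2 = -(inner ℝ w v : ℝ) := by ring
    rwa [h4] at h3
  refine HasDerivAt.deriv (h2.congr_of_eventuallyEq ?_)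
  have h3 : Tendsto (fun t : ℝ => ‖w + t • v‖) (𝓝 0) (𝓝 ‖w‖) := by
    have : Continuous fun t : ℝ => ‖w + t • v‖ := by fun_prop
    simpa using this.tendsto 0
  filter_upwards [h3.eventually_lt_const hw] with t ht
  simp [paraboloid, min_eq_left ht.le]

theorem lineDeriv_paraboloid_of_gt {w : Cn n} (hw : 1 < ‖w‖) (v : Cn n) :
    lineDeriv ℝ paraboloid w v = 0 := by
  have h2 : HasDerivAt (fun _ : ℝ => (0 : ℝ)) 0 0 := hasDerivAt_const _ _
  refine HasDerivAt.deriv (h2.congr_of_eventuallyEq ?_)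
  have h3 : Tendsto (fun t : ℝ => ‖w + t • v‖) (𝓝 0) (𝓝 ‖w‖) := by
    have : Continuous fun t : ℝ => ‖w + t • v‖ := by fun_prop
    simpa using this.tendsto 0
  filter_upwards [h3.eventually_const_lt hw] with t ht
  exact paraboloid_eq_zero ht.le

/-- The Lipschitz function `paraboloid` has gradient −w inside the unit ball and 0 outside.
Integrating by parts against it replaces the divergence theorem on the ball, without a surface
integral. -/
theorem integral_inner_mul_eq {h : Cn n → ℝ} {C : NNReal} (hh : LipschitzWith C h) (v : Cn n) :
    ∫ w in closedBall (0 : Cn n) 1, h w * inner ℝ w v = ∫ w, lineDeriv ℝ h w v * paraboloid w := by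
  rw [LipschitzWith.integral_lineDeriv_mul_eq hh lipschitzWith_paraboloid
    hasCompactSupport_paraboloid v, ← integral_indicator isClosed_closedBall.measurableSet]
  refine integral_congr_ae ?_
  have hnull : volume (sphere (0 : Cn n) 1) = 0 :=
    Measure.addHaar_sphere_of_ne_zero _ _ one_ne_zero
  filter_upwards [measure_eq_zero_iff_ae_notMem.1 hnull] with w hw
  rw [mem_sphere_zero_iff_norm] at hw
  rcases lt_or_gt_of_ne hw with h1 | h1
  · rw [indicator_of_mem (by simpa using h1.le), lineDeriv_paraboloid_of_lt h1]
    simp [mul_comm]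
  · rw [indicator_of_notMem (by simpa using h1), lineDeriv_paraboloid_of_gt h1]
    simp

theorem setIntegral_closedBall_comp (f : Cn n → ℝ) (z : Cn n) {R : ℝ} (hR : 0 < R) :
    ∫ w in closedBall (0 : Cn n) 1, f (z + R • w) =
      |(R ^ Module.finrank ℝ (Cn n))⁻¹| * ∫ w in closedBall z R, f w := by
  rw [← integral_indicator isClosed_closedBall.measurableSet,
    ← integral_indicator isClosed_closedBall.measurableSet]
  have h1 := Measure.integral_comp_smul volume (fun y => (closedBall z R).indicator f (z + y)) R
  rw [integral_add_left_eq_self (fun y => (closedBall z R).indicator f y) z, smul_eq_mul] at h1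
  rw [← h1]
  congr 1
  funext w
  have hmem : w ∈ closedBall (0 : Cn n) 1 ↔ z + R • w ∈ closedBall z R := by
    rw [mem_closedBall_zero_iff, mem_closedBall_iff_norm, add_sub_cancel_left, norm_smul,
      Real.norm_of_nonneg hR.le]
    constructor
    · intro h; nlinarith
    · intro h; by_contra h'; nlinarith
  by_cases hw : w ∈ closedBall (0 : Cn n) 1
  · rw [indicator_of_mem hw, indicator_of_mem (hmem.1 hw)]
  · rw [indicator_of_notMem hw, indicator_of_notMem fun h => hw (hmem.2 h)]

theorem integrableOn_closedBall {f : Cn n → ℝ} (hf : Continuous f) (z : Cn n) (r : ℝ) :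
    IntegrableOn f (closedBall z r) :=
  hf.continuousOn.integrableOn_compact (isCompact_closedBall z r)

theorem hasDerivAt_ball_integral {f : Cn n → ℝ} (hf : ContDiff ℝ 1 f) (hc : HasCompactSupport f)
    (z : Cn n) (r : ℝ) :
    HasDerivAt (fun r => ∫ w in closedBall (0 : Cn n) 1, f (z + r • w))
      (∫ w in closedBall (0 : Cn n) 1, fderiv ℝ f (z + r • w) w) r := by
  have cf : Continuous (fderiv ℝ f) := hf.continuous_fderiv (by norm_num)
  obtain ⟨C, hC⟩ := (hc.fderiv ℝ).exists_bound_of_continuous cf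
  have hC0 : 0 ≤ C := (norm_nonneg _).trans (hC 0)
  refine (hasDerivAt_integral_of_dominated_loc_of_deriv_le (bound := fun _ => C)
    (F' := fun r w => fderiv ℝ f (z + r • w) w) univ_mem ?_ ?_ ?_ ?_ ?_ ?_).2
  · refine Eventually.of_forall fun r => (Continuous.aestronglyMeasurable ?_)
    exact hf.continuous.comp (by fun_prop)
  · exact integrableOn_closedBall (hf.continuous.comp (by fun_prop)) _ _
  · refine Continuous.aestronglyMeasurable ?_
    exact (cf.comp (by fun_prop : Continuous fun w : Cn n => z + r • w)).clm_apply continuous_id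
  · refine (ae_restrict_iff' isClosed_closedBall.measurableSet).2
      (Eventually.of_forall fun w hw r _ => ?_)
    rw [mem_closedBall_zero_iff] at hw
    calc _ ≤ ‖fderiv ℝ f (z + r • w)‖ * ‖w‖ := ContinuousLinearMap.le_opNorm _ _
      _ ≤ C * 1 := mul_le_mul (hC _) hw (norm_nonneg _) hC0
      _ = C := mul_one C
  · exact integrableOn_closedBall continuous_const _ _
  · refine Eventually.of_forall fun w r _ => ?_
    have h1 : HasDerivAt (fun r : ℝ => z + r • w) w r := by
      simpa using ((hasDerivAt_id r).smul_const w).const_add z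
    exact ((hf.differentiable (by norm_num) _).hasFDerivAt).comp_hasDerivAt r h1

/-- Expand w in the real orthonormal basis and integrate each term by parts: the integral equals r ∫
Δf(z + rw) p(w) dw, where p is the nonnegative function `paraboloid`. -/
theorem integral_fderiv_self_nonneg {f : Cn n → ℝ} (hf : ContDiff ℝ 2 f) (hc : HasCompactSupport f)
    {z : Cn n} {r : ℝ} (hr : 0 ≤ r) (h : ∀ y ∈ closedBall z r, 0 ≤ sqSum (stdVec n) f y) :
    0 ≤ ∫ w in closedBall (0 : Cn n) 1, fderiv ℝ f (z + r • w) w := by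
  have d1 : ∀ v, ContDiff ℝ 1 fun z => fderiv ℝ f z v :=
    fun v => by exact_mod_cast contDiff_fderiv_apply (k := 1) (by exact_mod_cast hf) v
  have e1 : ∀ w, fderiv ℝ f (z + r • w) w =
      ∑ k, fderiv ℝ f (z + r • w) (stdVec n k) * inner ℝ w (stdVec n k) := by
    intro w
    conv_lhs => rw [← sum_inner_smul_stdVec w]
    rw [map_sum]
    refine Finset.sum_congr rfl fun k _ => ?_
    rw [map_smul, smul_eq_mul, mul_comm, sum_inner_smul_stdVec w]
  have hlip : ∀ v, ∃ C, LipschitzWith C fun w => fderiv ℝ f (z + r • w) v := by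
    intro v
    obtain ⟨C, hC⟩ := (d1 v).lipschitzWith_of_hasCompactSupport (hc.fderiv_apply ℝ v) (by norm_num)
    have : LipschitzWith ‖r‖₊ fun w : Cn n => z + r • w := by
      refine LipschitzWith.of_dist_le_mul fun x y => ?_
      rw [dist_add_left, dist_smul₀]
      rfl
    exact ⟨_, hC.comp this⟩
  have e2 : ∀ v w, lineDeriv ℝ (fun w => fderiv ℝ f (z + r • w) v) w v =
      r * fderiv ℝ (fun y => fderiv ℝ f y v) (z + r • w) v := by
    intro v w
    have h1 : HasDerivAt (fun t : ℝ => z + r • (w + t • v)) (r • v) 0 := by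
      have := ((((hasDerivAt_id (0 : ℝ)).smul_const v).const_add w).const_smul r).const_add z
      simpa using this
    have h2 : HasFDerivAt (fun y => fderiv ℝ f y v)
        (fderiv ℝ (fun y => fderiv ℝ f y v) (z + r • w)) (z + r • (w + (0 : ℝ) • v)) := by
      rw [zero_smul, add_zero]
      exact ((d1 v).differentiable (by norm_num) _).hasFDerivAt
    have h3 := h2.comp_hasDerivAt (0 : ℝ) h1
    rw [map_smul, smul_eq_mul] at h3
    exact h3.deriv
  have ci : ∀ v, Continuous fun w => fderiv ℝ f (z + r • w) v * inner ℝ w v := fun v =>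
    ((d1 v).continuous.comp (by fun_prop : Continuous fun w : Cn n => z + r • w)).mul
      (by fun_prop)
  have cd : ∀ v, Continuous fun w =>
      r * fderiv ℝ (fun y => fderiv ℝ f y v) (z + r • w) v * paraboloid w := fun v =>
    (continuous_const.mul ((contDiff_fderiv_apply (k := 0) (by exact_mod_cast d1 v)
      v).continuous.comp (by fun_prop : Continuous fun w : Cn n => z + r • w))).mul
      lipschitzWith_paraboloid.continuous
  simp_rw [e1]
  rw [integral_finsetSum _ fun k _ => integrableOn_closedBall (ci (stdVec n k)) _ _]
  have e3 : ∀ k, ∫ w in closedBall (0 : Cn n) 1,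
      fderiv ℝ f (z + r • w) (stdVec n k) * inner ℝ w (stdVec n k) =
      ∫ w, r * fderiv ℝ (fun y => fderiv ℝ f y (stdVec n k)) (z + r • w) (stdVec n k) *
        paraboloid w := by
    intro k
    obtain ⟨C, hC⟩ := hlip (stdVec n k)
    rw [integral_inner_mul_eq hC]
    simp_rw [e2]
  simp_rw [e3]
  rw [← integral_finsetSum _ fun k _ => (cd (stdVec n k)).integrable_of_hasCompactSupport
    hasCompactSupport_paraboloid.mul_left]
  refine integral_nonneg fun w => ?_
  have e4 : ∑ k, r * fderiv ℝ (fun y => fderiv ℝ f y (stdVec n k)) (z + r • w) (stdVec n k) *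
      paraboloid w = r * sqSum (stdVec n) f (z + r • w) * paraboloid w := by
    rw [sqSum_eq hf, Finset.mul_sum, Finset.sum_mul]
  simp only [e4]
  by_cases hw : 1 ≤ ‖w‖
  · simp [paraboloid_eq_zero hw]
  · refine mul_nonneg (mul_nonneg hr (h _ ?_)) (paraboloid_nonneg w)
    rw [mem_closedBall_iff_norm, add_sub_cancel_left, norm_smul, Real.norm_of_nonneg hr]
    nlinarith [norm_nonneg w]

/-- The integral of f(z + rw) over the unit ball is increasing in r on [0, R], since its derivative
is the integral of the preceding lemma. Compare r = 0 with r = R. -/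
theorem smooth_submean {f : Cn n → ℝ} (hf : ContDiff ℝ 2 f) (hc : HasCompactSupport f)
    {z : Cn n} {R : ℝ} (hR : 0 < R) (h : ∀ y ∈ closedBall z R, 0 ≤ sqSum (stdVec n) f y) :
    f z * volume.real (closedBall z R) ≤ ∫ w in closedBall z R, f w := by
  set M : ℝ → ℝ := fun r => ∫ w in closedBall (0 : Cn n) 1, f (z + r • w) with hM
  have hd : ∀ r, HasDerivAt M (∫ w in closedBall (0 : Cn n) 1, fderiv ℝ f (z + r • w) w) r :=
    fun r => hasDerivAt_ball_integral (hf.of_le (by norm_num)) hc z r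
  have hmono : MonotoneOn M (Icc 0 R) := by
    refine monotoneOn_of_deriv_nonneg (convex_Icc 0 R)
      (fun r _ => (hd r).continuousAt.continuousWithinAt)
      (fun r _ => (hd r).differentiableAt.differentiableWithinAt) fun r hr => ?_
    rw [interior_Icc] at hr
    rw [(hd r).deriv]
    exact integral_fderiv_self_nonneg hf hc hr.1.le fun y hy =>
      h y (closedBall_subset_closedBall hr.2.le hy)
  have h1 := hmono (left_mem_Icc.2 hR.le) (right_mem_Icc.2 hR.le) hR.le
  -- The value at r = 0 is written as a rescaled integral of a constant, so that both sides acquire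
  -- the same scaling factor.
  have h2 : M 0 = ∫ w in closedBall (0 : Cn n) 1, (fun _ => f z) (z + R • w) := by simp [hM]
  rw [h2, setIntegral_closedBall_comp (fun _ => f z) z hR] at h1
  simp only [hM] at h1
  rw [setIntegral_closedBall_comp f z hR] at h1
  have h3 : 0 < |(R ^ Module.finrank ℝ (Cn n))⁻¹| := by positivity
  have h4 := le_of_mul_le_mul_left h1 h3
  rw [setIntegral_const, smul_eq_mul, mul_comm] at h4
  exact h4

theorem continuous_submean {u : Cn n → ℝ} {U : Set (Cn n)} (hU : IsOpen U)
    (hu : ContinuousOn u U) (h : SubDist (stdVec n) u U) {z : Cn n} {R : ℝ} (hR : 0 < R)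
    (hzR : closedBall z R ⊆ U) :
    u z * volume.real (closedBall z R) ≤ ∫ w in closedBall z R, u w := by
  refine le_of_forall_pos_le_add fun ε hε => ?_
  set V := volume.real (closedBall z R) with hV
  have hV0 : 0 ≤ V := measureReal_nonneg
  set δ := ε / (2 * (V + 1)) with hδ
  have hδ0 : 0 < δ := by positivity
  obtain ⟨w, hw, hwc, hwu, hwa⟩ := exists_smooth_approx (ι := Fin n ⊕ Fin n) hU
    (isCompact_closedBall z R) hzR hu hδ0
  have h1 := smooth_submean (hw.of_le ENat.LEInfty.out) hwc hR (hwa _ h)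
  have h2 : u z - δ ≤ w z := by
    have := abs_le.1 (hwu z (mem_closedBall_self hR.le)); linarith
  have hui : IntegrableOn u (closedBall z R) :=
    (hu.mono hzR).integrableOn_compact (isCompact_closedBall z R)
  have h3 : ∫ y in closedBall z R, w y ≤ ∫ y in closedBall z R, (u y + δ) := by
    refine setIntegral_mono_on (integrableOn_closedBall hw.continuous _ _)
      (hui.add (integrableOn_closedBall continuous_const _ _)) isClosed_closedBall.measurableSet
      fun y hy => ?_
    have := abs_le.1 (hwu y hy); linarith
  rw [integral_add hui (integrableOn_closedBall continuous_const _ _), setIntegral_const,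
    smul_eq_mul, ← hV] at h3
  have h4 : (u z - δ) * V ≤ w z * V := mul_le_mul_of_nonneg_right h2 hV0
  have h5 : 2 * (V * δ) ≤ ε := by
    rw [hδ]
    have : 2 * (V * (ε / (2 * (V + 1)))) = ε * (V / (V + 1)) := by field_simp
    rw [this]
    have h6 : V / (V + 1) ≤ 1 := by rw [div_le_one (by linarith)]; linarith
    nlinarith
  linarith

end MeanValue
-- The extended integral: comparison and monotone limits.
section EIntegral

open Topology Filter

variable {α : Type*} [MeasurableSpace α] {μ : Measure α}

theorem eintegral_coe {f : α → ℝ} (hf : Integrable f μ) :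
    eintegral μ (fun x => (f x : EReal)) = ((∫ x, f x ∂μ : ℝ) : EReal) := by
  have h1 : ∫⁻ x, ENNReal.ofReal (f x) ∂μ ≠ ⊤ := hf.lintegral_lt_top.ne
  have h2 : ∫⁻ x, ENNReal.ofReal (-f x) ∂μ ≠ ⊤ := hf.neg.lintegral_lt_top.ne
  rw [integral_eq_lintegral_pos_part_sub_lintegral_neg_part hf, EReal.coe_sub,
    EReal.coe_ennreal_toReal h1, EReal.coe_ennreal_toReal h2]
  rfl

theorem eintegral_congr_ae {u v : α → EReal} (h : u =ᵐ[μ] v) : eintegral μ u = eintegral μ v := by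
  unfold eintegral
  have h1 : ∫⁻ x, (u x).toENNReal ∂μ = ∫⁻ x, (v x).toENNReal ∂μ :=
    lintegral_congr_ae (h.fun_comp EReal.toENNReal)
  have h2 : ∫⁻ x, (-u x).toENNReal ∂μ = ∫⁻ x, (-v x).toENNReal ∂μ :=
    lintegral_congr_ae (h.fun_comp fun x => (-x).toENNReal)
  rw [h1, h2]

theorem eintegral_mono_ae {u v : α → EReal} (h : u ≤ᵐ[μ] v) : eintegral μ u ≤ eintegral μ v := by
  refine EReal.sub_le_sub ?_ ?_
  · refine EReal.coe_ennreal_le_coe_ennreal_iff.2 (lintegral_mono_ae ?_)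
    filter_upwards [h] with x hx using EReal.toENNReal_le_toENNReal hx
  · refine EReal.coe_ennreal_le_coe_ennreal_iff.2 (lintegral_mono_ae ?_)
    filter_upwards [h] with x hx using EReal.toENNReal_le_toENNReal (EReal.neg_le_neg_iff.2 hx)

theorem eintegral_le_integral {u : α → EReal} {f : α → ℝ} (hf : Integrable f μ)
    (h : ∀ᵐ x ∂μ, u x ≤ f x) : eintegral μ u ≤ ((∫ x, f x ∂μ : ℝ) : EReal) := by
  rw [← eintegral_coe hf]
  exact eintegral_mono_ae h

theorem eintegral_toReal {u : α → EReal} (h : Integrable (fun x => (u x).toReal) μ)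
    (h1 : ∀ᵐ x ∂μ, u x ≠ ⊤) (h2 : ∀ᵐ x ∂μ, u x ≠ ⊥) :
    eintegral μ u = ((∫ x, (u x).toReal ∂μ : ℝ) : EReal) := by
  rw [← eintegral_coe h]
  refine eintegral_congr_ae ?_
  filter_upwards [h1, h2] with x hx hx' using (EReal.coe_toReal hx hx').symm

/-- With an upper bound M, |u| ≤ |M| + u⁻ almost everywhere, so only the negative part can spoil
integrability. -/
theorem integrable_toReal_of_lintegral_neg [IsFiniteMeasure μ] {u : α → EReal}
    (hu : AEMeasurable u μ) {M : ℝ} (hM : ∀ᵐ x ∂μ, u x ≤ M)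
    (h : ∫⁻ x, (-u x).toENNReal ∂μ ≠ ⊤) :
    (∀ᵐ x ∂μ, u x ≠ ⊥) ∧ Integrable (fun x => (u x).toReal) μ := by
  have hm : AEMeasurable (fun x => (-u x).toENNReal) μ :=
    (continuous_neg.measurable.comp_aemeasurable hu).ereal_toENNReal
  have h1 : ∀ᵐ x ∂μ, u x ≠ ⊥ := by
    filter_upwards [ae_lt_top' hm h] with x hx hbot
    simp [hbot] at hx
  refine ⟨h1, ⟨hu.ereal_toReal.aestronglyMeasurable, ?_⟩⟩
  rw [hasFiniteIntegral_iff_enorm]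
  have h2 : ∫⁻ x, (ENNReal.ofReal |M| + (-u x).toENNReal) ∂μ < ⊤ := by
    rw [lintegral_add_left measurable_const, lintegral_const]
    exact ENNReal.add_lt_top.2 ⟨ENNReal.mul_lt_top ENNReal.ofReal_lt_top (measure_lt_top _ _),
      lt_top_iff_ne_top.2 h⟩
  refine lt_of_le_of_lt (lintegral_mono_ae ?_) h2
  filter_upwards [h1, hM] with x hx hxM
  have hx' : u x ≠ ⊤ := ne_top_of_le_ne_top (EReal.coe_ne_top M) hxM
  lift u x to ℝ using ⟨hx', hx⟩ with t
  rw [EReal.toReal_coe, ← EReal.coe_neg, EReal.real_coe_toENNReal, ← ofReal_norm]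
  rw [EReal.coe_le_coe_iff] at hxM
  rcases le_total 0 t with h | h
  · refine le_add_right (ENNReal.ofReal_le_ofReal ?_)
    rw [Real.norm_of_nonneg h]
    exact hxM.trans (le_abs_self M)
  · refine le_add_left (ENNReal.ofReal_le_ofReal ?_)
    rw [Real.norm_of_nonpos h]

/-- The positive parts are dominated by that of f_0 and the negative parts increase. Integrability
of f_0 keeps the first limit finite, so no ∞ − ∞ arises even if the limit is −∞. -/
theorem tendsto_integral_eintegral {u : α → EReal} {f : ℕ → α → ℝ}
    (hf : ∀ j, Integrable (f j) μ) (hanti : ∀ᵐ x ∂μ, Antitone fun j => f j x)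
    (hlim : ∀ᵐ x ∂μ, Tendsto (fun j => (f j x : EReal)) atTop (𝓝 (u x))) :
    Tendsto (fun j => ((∫ x, f j x ∂μ : ℝ) : EReal)) atTop (𝓝 (eintegral μ u)) := by
  have hpos : Tendsto (fun j => ∫⁻ x, (f j x : EReal).toENNReal ∂μ) atTop
      (𝓝 (∫⁻ x, (u x).toENNReal ∂μ)) := by
    refine tendsto_lintegral_of_dominated_convergence' (fun x => (f 0 x : EReal).toENNReal)
      (fun j => ?_) (fun j => ?_) ?_ ?_
    · simp only [EReal.real_coe_toENNReal]
      exact (hf j).aemeasurable.ennreal_ofReal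
    · filter_upwards [hanti] with x hx
      exact EReal.toENNReal_le_toENNReal (EReal.coe_le_coe_iff.2 (hx (Nat.zero_le j)))
    · exact (hf 0).lintegral_lt_top.ne
    · filter_upwards [hlim] with x hx
      exact (EReal.continuous_toENNReal.tendsto _).comp hx
  have hneg : Tendsto (fun j => ∫⁻ x, (-(f j x : EReal)).toENNReal ∂μ) atTop
      (𝓝 (∫⁻ x, (-u x).toENNReal ∂μ)) := by
    refine lintegral_tendsto_of_tendsto_of_monotone (fun j => ?_) ?_ ?_
    · simp only [← EReal.coe_neg, EReal.real_coe_toENNReal]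
      exact (hf j).aemeasurable.neg.ennreal_ofReal
    · filter_upwards [hanti] with x hx i j hij
      exact EReal.toENNReal_le_toENNReal
        (EReal.neg_le_neg_iff.2 (EReal.coe_le_coe_iff.2 (hx hij)))
    · filter_upwards [hlim] with x hx
      exact (EReal.continuous_toENNReal.tendsto _).comp ((continuous_neg.tendsto _).comp hx)
  have hfin : ∫⁻ x, (u x).toENNReal ∂μ ≠ ⊤ := by
    refine (lt_of_le_of_lt (lintegral_mono_ae ?_) (hf 0).lintegral_lt_top).ne
    filter_upwards [hlim, hanti] with x hx hx'
    refine EReal.toENNReal_le_toENNReal (y := (f 0 x : EReal)) (le_of_tendsto' hx fun j => ?_)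
    exact EReal.coe_le_coe_iff.2 (hx' (Nat.zero_le j))
  have h1 : ∀ j, ((∫ x, f j x ∂μ : ℝ) : EReal) = eintegral μ fun x => (f j x : EReal) :=
    fun j => (eintegral_coe (hf j)).symm
  simp_rw [h1]
  have hc : ContinuousAt (fun p : EReal × EReal => p.1 + p.2)
      (((∫⁻ x, (u x).toENNReal ∂μ : ℝ≥0∞) : EReal),
        -((∫⁻ x, (-u x).toENNReal ∂μ : ℝ≥0∞) : EReal)) := by
    refine EReal.continuousAt_add (Or.inl ?_) (Or.inl ?_)
    · simpa using hfin
    · simp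
  exact hc.tendsto.comp (((continuous_coe_ennreal_ereal.tendsto _).comp hpos).prodMk_nhds
    ((continuous_neg.tendsto _).comp ((continuous_coe_ennreal_ereal.tendsto _).comp hneg)))

end EIntegral

/-! ### Upper semicontinuous functions as decreasing limits of continuous ones. -/

section Usc

open Topology Filter

variable {n : ℕ}

theorem aemeasurable_of_usc {X : Set (Cn n)} (hX : MeasurableSet X) {φ : Cn n → EReal}
    (hφ : UpperSemicontinuousOn φ X) (μ : Measure (Cn n)) : AEMeasurable φ (μ.restrict X) := by
  refine aemeasurable_restrict_of_measurable_subtype hX ?_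
  exact UpperSemicontinuous.measurable (upperSemicontinuousOn_iff_restrict.2 hφ)

theorem exists_real_upper_bound {X : Set (Cn n)} (hX : IsCompact X) {φ : Cn n → EReal}
    (hφ : φ ∈ USC X) : ∃ M : ℝ, ∀ z ∈ X, φ z ≤ M := by
  rcases X.eq_empty_or_nonempty with rfl | hne
  · exact ⟨0, by simp⟩
  obtain ⟨z₀, hz₀, hmax⟩ := UpperSemicontinuousOn.exists_isMaxOn hne hX hφ.2
  obtain ⟨M, hM⟩ := EReal.lt_iff_exists_real_btwn.1 (lt_top_iff_ne_top.2 (hφ.1 z₀ hz₀))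
  exact ⟨M, fun z hz => (hmax hz).trans hM.1.le⟩

/-- A usc function on a compact set is the decreasing limit of continuous functions. -/
theorem exists_antitone_continuous {X : Set (Cn n)} (hX : IsCompact X) {φ : Cn n → EReal}
    (hφ : φ ∈ USC X) : ∃ f : ℕ → Cn n → ℝ, (∀ j, Continuous (f j)) ∧
      (∀ x, Antitone fun j => f j x) ∧ (∀ j, ∀ x ∈ X, φ x ≤ f j x) ∧
      ∀ x ∈ X, Tendsto (fun j => (f j x : EReal)) atTop (𝓝 (φ x)) := by
  rcases X.eq_empty_or_nonempty with rfl | hne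
  · exact ⟨fun _ _ => 0, fun _ => continuous_const, fun _ => antitone_const, by simp, by simp⟩
  obtain ⟨M, hM⟩ := exists_real_upper_bound hX hφ
  have : Nonempty X := hne.to_subtype
  -- Truncation at −j makes the function real-valued even where φ = −∞, and it still decreases to φ.
  set t : ℕ → X → ℝ := fun j y => (max (φ y) ((-(j : ℝ) : ℝ) : EReal)).toReal with ht
  have htc : ∀ j y, (t j y : EReal) = max (φ y) ((-(j : ℝ) : ℝ) : EReal) := by
    intro j y
    refine EReal.coe_toReal ?_ ?_
    · exact (max_lt (lt_top_iff_ne_top.2 (hφ.1 y y.2)) (EReal.coe_lt_top _)).ne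
    · exact (lt_of_lt_of_le (EReal.bot_lt_coe _) (le_max_right _ _)).ne'
  have htM : ∀ j y, t j y ≤ max M (-(j : ℝ)) := by
    intro j y
    rw [← EReal.coe_le_coe_iff, htc, EReal.coe_strictMono.monotone.map_max]
    exact max_le_max (hM y y.2) le_rfl
  have htanti : ∀ y, Antitone fun j => t j y := by
    intro y i j hij
    simp only [← EReal.coe_le_coe_iff, htc]
    refine max_le_max le_rfl (EReal.coe_le_coe_iff.2 ?_)
    have : (i : ℝ) ≤ j := by exact_mod_cast hij
    linarith
  -- The sup-convolution with the penalty j·dist is j-Lipschitz. For large j the penalty excludes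
  -- points y at distance at least r from x, and at closer points semicontinuity bounds φ.
  set f : ℕ → Cn n → ℝ := fun j x => ⨆ y : X, (t j y - j * dist x (y : Cn n)) with hf
  have hbdd : ∀ j (x : Cn n), BddAbove (range fun y : X => t j y - j * dist x (y : Cn n)) := by
    intro j x
    refine ⟨max M (-(j : ℝ)), ?_⟩
    rintro _ ⟨y, rfl⟩
    have : (0 : ℝ) ≤ j * dist x (y : Cn n) := by positivity
    linarith [htM j y]
  have hle : ∀ j, ∀ x (hx : x ∈ X), t j ⟨x, hx⟩ ≤ f j x := by
    intro j x hx
    have := le_ciSup (hbdd j x) ⟨x, hx⟩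
    simpa using this
  have hφf : ∀ j, ∀ x ∈ X, φ x ≤ f j x := by
    intro j x hx
    refine le_trans ?_ (EReal.coe_le_coe_iff.2 (hle j x hx))
    rw [htc]
    exact le_max_left _ _
  refine ⟨f, fun j => ?_, fun x i j hij => ?_, hφf, fun x hx => ?_⟩
  · refine (LipschitzWith.of_le_add_mul (j : NNReal) fun x y => ?_).continuous
    refine ciSup_le fun w => ?_
    have h1 := le_ciSup (hbdd j y) w
    have h2 : (j : ℝ) * dist y (w : Cn n) ≤ j * dist x (w : Cn n) + j * dist x y := by
      rw [← mul_add]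
      refine mul_le_mul_of_nonneg_left ?_ (by positivity)
      rw [add_comm, dist_comm x y]
      exact dist_triangle y x w
    simp only [NNReal.coe_natCast]
    linarith
  · refine ciSup_mono (hbdd i x) fun y => ?_
    have h1 := htanti y hij
    simp only at h1
    have h2 : (i : ℝ) * dist x (y : Cn n) ≤ j * dist x (y : Cn n) :=
      mul_le_mul_of_nonneg_right (by exact_mod_cast hij) dist_nonneg
    linarith
  · refine tendsto_order.2 ⟨fun c hc => Eventually.of_forall fun j => hc.trans_le (hφf j x hx),
      fun c hc => ?_⟩
    obtain ⟨c', hc1, hc2⟩ := EReal.lt_iff_exists_real_btwn.1 hc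
    have h1 := hφ.2 x hx c' hc1
    obtain ⟨r, hr, h2⟩ := Metric.mem_nhdsWithin_iff.1 h1
    have h3 : ∀ᶠ j : ℕ in atTop, -(j : ℝ) ≤ c' := by
      filter_upwards [eventually_ge_atTop ⌈-c'⌉₊] with j hj
      have := Nat.ceil_le.1 hj
      linarith
    have h4 : ∀ᶠ j : ℕ in atTop, max M 0 - j * r ≤ c' := by
      filter_upwards [eventually_ge_atTop ⌈(max M 0 - c') / r⌉₊] with j hj
      have := Nat.ceil_le.1 hj
      rw [div_le_iff₀ hr] at this
      linarith
    filter_upwards [h3, h4] with j hj3 hj4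
    refine lt_of_le_of_lt (EReal.coe_le_coe_iff.2 (ciSup_le fun y => ?_)) hc2
    have hd : (0 : ℝ) ≤ j * dist x (y : Cn n) := by positivity
    by_cases hy : dist (y : Cn n) x < r
    · have h5 : φ y < c' := h2 ⟨hy, y.2⟩
      have h6 : t j y ≤ c' := by
        rw [← EReal.coe_le_coe_iff, htc]
        exact max_le h5.le (EReal.coe_le_coe_iff.2 hj3)
      linarith
    · have h5 : (j : ℝ) * r ≤ j * dist x (y : Cn n) := by
        rw [dist_comm]
        exact mul_le_mul_of_nonneg_left (not_lt.1 hy) (by positivity)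
      have h6 : t j y ≤ max M 0 := (htM j y).trans (max_le_max le_rfl (by simp))
      linarith

end Usc
-- Continuous m-subharmonic functions and the cone `SHo m X`.
section ContSH

open Topology Filter Metric

variable {n m : ℕ}

/-- Continuous `m`-subharmonic functions, described by the currents only. -/
def ContSH (m : ℕ) (u : Cn n → ℝ) (U : Set (Cn n)) : Prop :=
  ContinuousOn u U ∧ ∀ A : Fin n → Matrix (Fin n) (Fin n) ℂ, (∀ i, A i ∈ Gam n m) →
    ∀ a : Fin n ⊕ Fin n → Cn n, (∀ η z, hessWedge m A η z = sqSum a η z) → SubDist a u U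

theorem ContSH.mono {u : Cn n → ℝ} {U V : Set (Cn n)} (h : ContSH m u V) (hUV : U ⊆ V) :
    ContSH m u U :=
  ⟨h.1.mono hUV, fun A hA a ha => (h.2 A hA a ha).mono hUV⟩

theorem ContSH.congr {u v : Cn n → ℝ} {U : Set (Cn n)} (h : ContSH m u U) (huv : EqOn u v U) :
    ContSH m v U :=
  ⟨h.1.congr huv.symm, fun A hA a ha => (h.2 A hA a ha).congr huv⟩

theorem contSH_const (c : ℝ) (U : Set (Cn n)) : ContSH m (fun _ => c) U :=
  ⟨continuousOn_const, fun _ _ a _ => subDist_const a c U⟩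

theorem ContSH.add {u v : Cn n → ℝ} {U : Set (Cn n)} (hu : ContSH m u U) (hv : ContSH m v U) :
    ContSH m (fun z => u z + v z) U :=
  ⟨hu.1.add hv.1, fun A hA a ha => (hu.2 A hA a ha).add hu.1 hv.1 (hv.2 A hA a ha)⟩

theorem ContSH.const_mul {u : Cn n → ℝ} {U : Set (Cn n)} (hu : ContSH m u U) {c : ℝ}
    (hc : 0 ≤ c) : ContSH m (fun z => c * u z) U :=
  ⟨continuousOn_const.mul hu.1, fun A hA a ha => (hu.2 A hA a ha).const_mul hc⟩

theorem ContSH.max {u v : Cn n → ℝ} {U : Set (Cn n)} (hU : IsOpen U) (hu : ContSH m u U)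
    (hv : ContSH m v U) : ContSH m (fun z => max (u z) (v z)) U :=
  ⟨hu.1.sup hv.1, fun A hA a ha => (hu.2 A hA a ha).max hU hu.1 hv.1 (hv.2 A hA a ha)⟩

theorem ContSH.union {u : Cn n → ℝ} {U V : Set (Cn n)} (hU : IsOpen U) (hV : IsOpen V)
    (h : ContSH m u U) (h' : ContSH m u V) : ContSH m u (U ∪ V) := by
  have hc : ContinuousOn u (U ∪ V) := by
    intro z hz
    rcases hz with hz | hz
    · exact (h.1.continuousAt (hU.mem_nhds hz)).continuousWithinAt
    · exact (h'.1.continuousAt (hV.mem_nhds hz)).continuousWithinAt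
  exact ⟨hc, fun A hA a ha => (h.2 A hA a ha).union hU hV hc (h'.2 A hA a ha)⟩

/-- Take every α_i equal to β, which lies in Γ_m. -/
theorem ContSH.subDist_stdVec (hm : 1 ≤ m) (hmn : m ≤ n) {u : Cn n → ℝ} {U : Set (Cn n)}
    (h : ContSH m u U) : SubDist (stdVec n) u U := by
  intro η hη
  have h1 : ∀ i : Fin n, (fun _ : Fin n => (1 : Matrix (Fin n) (Fin n) ℂ)) i ∈ Gam n m :=
    fun _ => one_mem_Gam
  obtain ⟨a, ha⟩ := exists_hessWedge_eq_sqSum hm hmn h1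
  obtain ⟨c, hc, hc'⟩ := exists_hessWedge_one (m := m) (lt_of_lt_of_le hm hmn)
  have h2 := h.2 _ h1 a ha η hη
  simp_rw [← ha, hc', mul_left_comm _ c] at h2
  rw [integral_const_mul] at h2
  exact nonneg_of_mul_nonneg_right h2 hc

theorem volume_closedBall_ne_zero (z : Cn n) {r : ℝ} (hr : 0 < r) :
    volume (closedBall z r) ≠ 0 := (measure_closedBall_pos _ z hr).ne'

theorem volume_closedBall_ne_top (z : Cn n) (r : ℝ) : volume (closedBall z r) ≠ ⊤ :=
  measure_closedBall_lt_top.ne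

/-- The normalized Lebesgue measure on a closed ball. -/
def ballMeasure (z : Cn n) (r : ℝ) : Measure (Cn n) :=
  (volume (closedBall z r))⁻¹ • volume.restrict (closedBall z r)

theorem ballMean_eq (u : Cn n → EReal) (z : Cn n) (r : ℝ) :
    ballMean u z r = eintegral (ballMeasure z r) u := rfl

theorem isProbabilityMeasure_ballMeasure (z : Cn n) {r : ℝ} (hr : 0 < r) :
    IsProbabilityMeasure (ballMeasure z r) :=
  ⟨by
    rw [ballMeasure, Measure.smul_apply, Measure.restrict_apply_univ, smul_eq_mul,
      ENNReal.inv_mul_cancel (volume_closedBall_ne_zero z hr) (volume_closedBall_ne_top z r)]⟩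

theorem ae_ballMeasure {z : Cn n} {r : ℝ} {p : Cn n → Prop}
    (h : ∀ᵐ x ∂(volume.restrict (closedBall z r)), p x) : ∀ᵐ x ∂(ballMeasure z r), p x :=
  Measure.ae_smul_measure h _

theorem integrable_ballMeasure {f : Cn n → ℝ} {z : Cn n} {r : ℝ} (hr : 0 < r)
    (hf : IntegrableOn f (closedBall z r)) : Integrable f (ballMeasure z r) :=
  Integrable.smul_measure hf (ENNReal.inv_ne_top.2 (volume_closedBall_ne_zero z hr))

theorem integral_ballMeasure (f : Cn n → ℝ) (z : Cn n) (r : ℝ) :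
    ∫ x, f x ∂(ballMeasure z r) =
      (volume.real (closedBall z r))⁻¹ * ∫ x in closedBall z r, f x := by
  rw [ballMeasure, integral_smul_measure, ENNReal.toReal_inv]
  rfl

theorem real_volume_closedBall_pos (z : Cn n) {r : ℝ} (hr : 0 < r) :
    0 < volume.real (closedBall z r) :=
  ENNReal.toReal_pos (volume_closedBall_ne_zero z hr) (volume_closedBall_ne_top z r)

/-- The case α_i = β already implies the sub-mean value inequality, and continuity makes the
integrability clauses automatic. So for continuous functions m-subharmonicity is a local family of
distributional inequalities. -/
theorem isMSubharmonic_iff_contSH (hm : 1 ≤ m) (hmn : m ≤ n) {u : Cn n → ℝ} {U : Set (Cn n)}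
    (hU : IsOpen U) (hu : ContinuousOn u U) :
    IsMSubharmonic m (fun z => (u z : EReal)) U ↔ ContSH m u U := by
  constructor
  · intro h
    refine ⟨hu, fun A hA a ha η hη => ?_⟩
    have := h.2 A hA η hη.smooth hη.compact hη.subset hη.nonneg
      (Eventually.of_forall fun z => EReal.coe_ne_bot _)
      ((hu.mono hη.subset).integrableOn_compact hη.compact)
    simpa only [EReal.toReal_coe, ha] using this
  · intro h
    refine ⟨⟨fun z _ => EReal.coe_ne_top _, ?_, fun z _ r hr hzr => ?_⟩, ?_⟩
    · exact (continuous_coe_real_ereal.comp_continuousOn hu).upperSemicontinuousOn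
    · have hi : IntegrableOn u (closedBall z r) :=
        (hu.mono hzr).integrableOn_compact (isCompact_closedBall z r)
      rw [ballMean_eq, eintegral_coe (integrable_ballMeasure hr hi), EReal.coe_le_coe_iff,
        integral_ballMeasure, inv_mul_eq_div, le_div_iff₀ (real_volume_closedBall_pos z hr)]
      exact continuous_submean hU hu (h.subDist_stdVec hm hmn) hr hzr
    · intro A hA η h1 h2 h3 h4 _ _
      obtain ⟨a, ha⟩ := exists_hessWedge_eq_sqSum hm hmn hA
      have := h.2 A hA a ha η ⟨h1, h2, h3, h4⟩
      simpa only [EReal.toReal_coe, ha] using this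

theorem mem_SHo_iff (hm : 1 ≤ m) (hmn : m ≤ n) {X : Set (Cn n)} {v : Cn n → ℝ} :
    v ∈ SHo m X ↔ ∃ U w, IsOpen U ∧ X ⊆ U ∧ ContSH m w U ∧ EqOn v w X := by
  constructor
  · rintro ⟨U, w, hU, hXU, hc, hw, hvw⟩
    exact ⟨U, w, hU, hXU, (isMSubharmonic_iff_contSH hm hmn hU hc).1 hw, hvw⟩
  · rintro ⟨U, w, hU, hXU, hw, hvw⟩
    exact ⟨U, w, hU, hXU, hw.1, (isMSubharmonic_iff_contSH hm hmn hU hw.1).2 hw, hvw⟩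

theorem SHo_continuousOn {X : Set (Cn n)} {v : Cn n → ℝ} (hv : v ∈ SHo m X) :
    ContinuousOn v X := by
  obtain ⟨U, w, -, hXU, hc, -, hvw⟩ := hv
  exact (hc.mono hXU).congr hvw

theorem const_mem_SHo (hm : 1 ≤ m) (hmn : m ≤ n) (X : Set (Cn n)) (c : ℝ) :
    (fun _ => c) ∈ SHo m X :=
  (mem_SHo_iff hm hmn).2 ⟨univ, fun _ => c, isOpen_univ, subset_univ _, contSH_const c _,
    fun _ _ => rfl⟩

theorem add_mem_SHo (hm : 1 ≤ m) (hmn : m ≤ n) {X : Set (Cn n)} {u v : Cn n → ℝ}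
    (hu : u ∈ SHo m X) (hv : v ∈ SHo m X) : (fun z => u z + v z) ∈ SHo m X := by
  rw [mem_SHo_iff hm hmn] at *
  obtain ⟨U, w, hU, hXU, hw, huw⟩ := hu
  obtain ⟨U', w', hU', hXU', hw', hvw⟩ := hv
  exact ⟨U ∩ U', fun z => w z + w' z, hU.inter hU', subset_inter hXU hXU',
    (hw.mono inter_subset_left).add (hw'.mono inter_subset_right),
    fun z hz => by simp only [huw hz, hvw hz]⟩

theorem const_mul_mem_SHo (hm : 1 ≤ m) (hmn : m ≤ n) {X : Set (Cn n)} {u : Cn n → ℝ}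
    (hu : u ∈ SHo m X) {c : ℝ} (hc : 0 ≤ c) : (fun z => c * u z) ∈ SHo m X := by
  rw [mem_SHo_iff hm hmn] at *
  obtain ⟨U, w, hU, hXU, hw, huw⟩ := hu
  exact ⟨U, fun z => c * w z, hU, hXU, hw.const_mul hc, fun z hz => by simp only [huw hz]⟩

theorem max_mem_SHo (hm : 1 ≤ m) (hmn : m ≤ n) {X : Set (Cn n)} {u v : Cn n → ℝ}
    (hu : u ∈ SHo m X) (hv : v ∈ SHo m X) : (fun z => max (u z) (v z)) ∈ SHo m X := by
  rw [mem_SHo_iff hm hmn] at *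
  obtain ⟨U, w, hU, hXU, hw, huw⟩ := hu
  obtain ⟨U', w', hU', hXU', hw', hvw⟩ := hv
  exact ⟨U ∩ U', fun z => max (w z) (w' z), hU.inter hU', subset_inter hXU hXU',
    (hw.mono inter_subset_left).max (hU.inter hU') (hw'.mono inter_subset_right),
    fun z hz => by simp only [huw hz, hvw hz]⟩

end ContSH

/-! ### Edwards' duality between minorants and Jensen measures. -/

section Edwards

open Topology Filter

variable {n m : ℕ}

/-- The values at `z` of the functions in `𝒮ℋ_m^o(X)` below `f`. -/
def minorantValues (m : ℕ) (X : Set (Cn n)) (z : Cn n) (f : C(X, ℝ)) : Set ℝ :=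
  {t | ∃ v ∈ SHo m X, (∀ x : X, v x ≤ f x) ∧ v z = t}

theorem const_mem_minorantValues (hm : 1 ≤ m) (hmn : m ≤ n) {X : Set (Cn n)} (z : Cn n)
    {f : C(X, ℝ)} {c : ℝ} (h : ∀ x, c ≤ f x) : c ∈ minorantValues m X z f :=
  ⟨fun _ => c, const_mem_SHo hm hmn X c, h, rfl⟩

theorem minorantValues_nonempty (hm : 1 ≤ m) (hmn : m ≤ n) {X : Set (Cn n)} [CompactSpace X]
    (z : Cn n) (f : C(X, ℝ)) : (minorantValues m X z f).Nonempty :=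
  ⟨-‖f‖, const_mem_minorantValues hm hmn z fun x => f.neg_norm_le_apply x⟩

theorem bddAbove_minorantValues {X : Set (Cn n)} {z : Cn n} (hz : z ∈ X) (f : C(X, ℝ)) :
    BddAbove (minorantValues m X z f) :=
  ⟨f ⟨z, hz⟩, by rintro _ ⟨v, -, hv, rfl⟩; exact hv ⟨z, hz⟩⟩

theorem sSup_minorantValues_add (hm : 1 ≤ m) (hmn : m ≤ n) {X : Set (Cn n)} [CompactSpace X]
    {z : Cn n} (hz : z ∈ X) (f g : C(X, ℝ)) :
    sSup (minorantValues m X z f) + sSup (minorantValues m X z g) ≤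
      sSup (minorantValues m X z (f + g)) := by
  rw [← csSup_add (minorantValues_nonempty hm hmn z f) (bddAbove_minorantValues hz f)
    (minorantValues_nonempty hm hmn z g) (bddAbove_minorantValues hz g)]
  refine csSup_le ((minorantValues_nonempty hm hmn z f).add (minorantValues_nonempty hm hmn z g)) ?_
  rintro _ ⟨_, ⟨v, hv, hvf, rfl⟩, _, ⟨w, hw, hwg, rfl⟩, rfl⟩
  exact le_csSup (bddAbove_minorantValues hz _)
    ⟨_, add_mem_SHo hm hmn hv hw, fun x => add_le_add (hvf x) (hwg x), rfl⟩

theorem sSup_minorantValues_smul_le (hm : 1 ≤ m) (hmn : m ≤ n) {X : Set (Cn n)} [CompactSpace X]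
    {z : Cn n} (hz : z ∈ X) (f : C(X, ℝ)) {c : ℝ} (hc : 0 < c) :
    c * sSup (minorantValues m X z f) ≤ sSup (minorantValues m X z (c • f)) := by
  rw [mul_comm, ← le_div_iff₀ hc]
  refine csSup_le (minorantValues_nonempty hm hmn z f) ?_
  rintro _ ⟨v, hv, hvf, rfl⟩
  rw [le_div_iff₀ hc, mul_comm]
  exact le_csSup (bddAbove_minorantValues hz _)
    ⟨_, const_mul_mem_SHo hm hmn hv hc.le,
      fun x => mul_le_mul_of_nonneg_left (hvf x) hc.le, rfl⟩

theorem sSup_minorantValues_smul (hm : 1 ≤ m) (hmn : m ≤ n) {X : Set (Cn n)} [CompactSpace X]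
    {z : Cn n} (hz : z ∈ X) (f : C(X, ℝ)) {c : ℝ} (hc : 0 < c) :
    sSup (minorantValues m X z (c • f)) = c * sSup (minorantValues m X z f) := by
  refine le_antisymm ?_ (sSup_minorantValues_smul_le hm hmn hz f hc)
  have h := sSup_minorantValues_smul_le hm hmn hz (c • f) (inv_pos.2 hc)
  rw [inv_smul_smul₀ hc.ne'] at h
  rwa [inv_mul_le_iff₀ hc] at h

/-- The supremum S(f) of the values at z of the minorants of f is superadditive and positively
homogeneous because `SHo m X` is a convex cone. Hahn–Banach for the sublinear functional f ↦ −S(−f)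
extends cg ↦ cS(g) from the line through g. -/
theorem exists_linear_ge_sSup_minorantValues (hm : 1 ≤ m) (hmn : m ≤ n) {X : Set (Cn n)}
    [CompactSpace X] {z : Cn n} (hz : z ∈ X) (g : C(X, ℝ)) :
    ∃ L : C(X, ℝ) →ₗ[ℝ] ℝ, L g = sSup (minorantValues m X z g) ∧
      ∀ f, sSup (minorantValues m X z f) ≤ L f := by
  set S : C(X, ℝ) → ℝ := fun f => sSup (minorantValues m X z f) with hS
  have hadd : ∀ f g, S f + S g ≤ S (f + g) := sSup_minorantValues_add hm hmn hz
  have hsmul : ∀ (c : ℝ), 0 < c → ∀ f, S (c • f) = c * S f :=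
    fun c hc f => sSup_minorantValues_smul hm hmn hz f hc
  have h0 : S 0 = 0 := by
    have := hsmul 2 (by norm_num) 0
    rw [smul_zero] at this
    linarith
  have H : ∀ c : ℝ, c • g = 0 → c • S g = 0 := by
    intro c hc
    rcases smul_eq_zero.1 hc with h | h
    · rw [h, zero_smul]
    · rw [h, h0, smul_zero]
  obtain ⟨L, hL1, hL2⟩ := exists_extension_of_le_sublinear
    (LinearPMap.mkSpanSingleton' g (S g) H) (fun f => -S (-f))
    (fun c hc f => by rw [← smul_neg, hsmul c hc]; ring)
    (fun f g => by have := hadd (-f) (-g); rw [← neg_add] at this; linarith)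
    (fun f => by
      obtain ⟨f, hf⟩ := f
      obtain ⟨c, rfl⟩ := Submodule.mem_span_singleton.1 hf
      rw [LinearPMap.mkSpanSingleton'_apply, RingHom.id_apply, smul_eq_mul]
      change c * S g ≤ -S (-(c • g))
      -- For c < 0 both sides agree by homogeneity; for c > 0 the bound is superadditivity, S(−cg) +
      -- S(cg) ≤ S(0) = 0.
      rcases lt_trichotomy c 0 with h | h | h
      · rw [← neg_smul, hsmul (-c) (by linarith)]
        linarith
      · simp [h, h0]
      · have h1 := hadd (-(c • g)) (c • g)
        rw [neg_add_cancel, h0, hsmul c h] at h1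
        linarith)
  refine ⟨L, ?_, fun f => ?_⟩
  · have := hL1 ⟨g, Submodule.mem_span_singleton_self g⟩
    rw [this]
    exact LinearPMap.mkSpanSingleton'_apply_self g (S g) H _
  · have := hL2 (-f)
    rw [map_neg, neg_neg] at this
    linarith

theorem exists_measure_of_positive {X : Set (Cn n)} [CompactSpace X] (L : C(X, ℝ) →ₗ[ℝ] ℝ)
    (hL : ∀ f : C(X, ℝ), 0 ≤ f → 0 ≤ L f) :
    ∃ μ : Measure X, ∀ f : C(X, ℝ), ∫ x, f x ∂μ = L f := by
  let T : CompactlySupportedContinuousMap X ℝ →ₗ[ℝ] ℝ :=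
    { toFun := fun f => L f.toContinuousMap
      map_add' := fun f g => by rw [← map_add]; rfl
      map_smul' := fun c f => by rw [RingHom.id_apply, ← map_smul]; rfl }
  let Λ : CompactlySupportedContinuousMap X ℝ →ₚ[ℝ] ℝ :=
    PositiveLinearMap.mk₀ T fun f hf => hL f.toContinuousMap hf
  refine ⟨RealRMK.rieszMeasure Λ, fun f => ?_⟩
  exact RealRMK.integral_rieszMeasure Λ (CompactlySupportedContinuousMap.continuousMapEquiv f)

/-- Edwards' theorem for the cone `𝒮ℋ_m^o(X)`: the supremum of the values at `z` of the minorants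
of a continuous function is attained by the integral against a Jensen measure. -/
theorem exists_jensenMeasure_integral_eq (hm : 1 ≤ m) (hmn : m ≤ n) {X : Set (Cn n)}
    (hX : IsCompact X) {z : Cn n} (hz : z ∈ X) {g : Cn n → ℝ} (hg : ContinuousOn g X) :
    ∃ μ ∈ JensenMeasures m X z, ∀ ε : ℝ, 0 < ε →
      ∃ v ∈ SHo m X, (∀ x ∈ X, v x ≤ g x) ∧ ∫ x in X, g x ∂μ < v z + ε := by
  have : CompactSpace X := isCompact_iff_compactSpace.1 hX
  set r : ∀ v : Cn n → ℝ, ContinuousOn v X → C(X, ℝ) := fun v hv =>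
    ⟨X.domRestrict v, hv.domRestrict⟩
  obtain ⟨L, hLg, hL⟩ := exists_linear_ge_sSup_minorantValues hm hmn hz (r g hg)
  -- The constants belong to the cone: the minorant 0 gives positivity, and the minorants ±1 of ±1
  -- give total mass one. The Jensen inequality holds since each v in the cone is a minorant of
  -- itself.
  have hpos : ∀ f : C(X, ℝ), 0 ≤ f → 0 ≤ L f := fun f hf =>
    (le_csSup (bddAbove_minorantValues hz f) (const_mem_minorantValues hm hmn z hf)).trans (hL f)
  obtain ⟨μ, hμ⟩ := exists_measure_of_positive L hpos
  have h1 : L 1 = 1 := by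
    have h2 := (le_csSup (bddAbove_minorantValues (m := m) hz 1)
      (const_mem_minorantValues hm hmn z (f := 1) (c := 1) fun x => le_rfl)).trans (hL 1)
    have h3 := (le_csSup (bddAbove_minorantValues (m := m) hz (-1))
      (const_mem_minorantValues hm hmn z (f := -1) (c := -1) fun x => le_rfl)).trans (hL (-1))
    rw [map_neg] at h3
    linarith
  have hμ1 : IsProbabilityMeasure μ := by
    have h2 := hμ 1
    rw [h1] at h2
    simp only [ContinuousMap.one_apply, integral_const, smul_eq_mul, mul_one] at h2
    exact ⟨by rwa [Measure.real, ENNReal.toReal_eq_one_iff] at h2⟩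
  have hemb : MeasurableEmbedding (Subtype.val : X → Cn n) :=
    MeasurableEmbedding.subtype_coe hX.measurableSet
  set ν := μ.map (Subtype.val : X → Cn n) with hν
  have hνX : ν Xᶜ = 0 := by
    rw [hν, hemb.map_apply]
    simp
  have hνr : ν.restrict X = ν := Measure.restrict_eq_self_of_ae_mem
    (measure_eq_zero_iff_ae_notMem.1 hνX |>.mono fun x hx => by simpa using hx)
  have hint : ∀ v (hv : ContinuousOn v X), ∫ x in X, v x ∂ν = L (r v hv) := by
    intro v hv
    rw [hνr, hν, hemb.integral_map, ← hμ]
    rfl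
  refine ⟨ν, ⟨hz, Measure.isProbabilityMeasure_map measurable_subtype_coe.aemeasurable, hνX,
    fun v hv => ?_⟩, fun ε hε => ?_⟩
  · have hvc := SHo_continuousOn hv
    rw [hint v hvc]
    exact (le_csSup (bddAbove_minorantValues hz (r v hvc)) ⟨v, hv, fun x => le_rfl, rfl⟩).trans
      (hL _)
  · rw [hint g hg, hLg]
    obtain ⟨_, ⟨v, hv, hvg, rfl⟩, hlt⟩ := exists_lt_of_lt_csSup
      (minorantValues_nonempty hm hmn z (r g hg)) (sub_lt_self _ hε)
    exact ⟨v, hv, fun x hx => hvg ⟨x, hx⟩, by linarith⟩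

end Edwards
-- Approximation on compact sets, and part 1 of the theorem.
section Compact

open Topology Filter Metric

variable {n m : ℕ}

theorem eventually_usc_lt {X : Set (Cn n)} {φ : Cn n → EReal} (hφ : UpperSemicontinuousOn φ X)
    {g : Cn n → ℝ} {x : Cn n} (hx : x ∈ X) (hg : ContinuousWithinAt g X x) (h : φ x < g x) :
    ∀ᶠ y in 𝓝[X] x, φ y < g y := by
  obtain ⟨c, hc1, hc2⟩ := EReal.lt_iff_exists_real_btwn.1 h
  filter_upwards [hφ x hx c hc1,
    hg.eventually_const_lt (EReal.coe_lt_coe_iff.1 hc2)] with y h1 h2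
  exact h1.trans (EReal.coe_lt_coe_iff.2 h2)

theorem integrableOn_of_continuousOn {X : Set (Cn n)} (hX : IsCompact X) {μ : Measure (Cn n)}
    [IsProbabilityMeasure μ] {g : Cn n → ℝ} (hg : ContinuousOn g X) : IntegrableOn g X μ :=
  hg.integrableOn_compact hX

theorem eintegral_le_setIntegral {X : Set (Cn n)} (hX : IsCompact X) {μ : Measure (Cn n)}
    [IsProbabilityMeasure μ] {φ : Cn n → EReal} {g : Cn n → ℝ} (hg : ContinuousOn g X)
    (h : ∀ x ∈ X, φ x ≤ g x) :
    eintegral (μ.restrict X) φ ≤ ((∫ x in X, g x ∂μ : ℝ) : EReal) :=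
  eintegral_le_integral (integrableOn_of_continuousOn hX hg)
    ((ae_restrict_iff' hX.measurableSet).2 (Eventually.of_forall h))

/-- A function with the Jensen property on the compact set `K` is approximated there from below
the continuous majorant `g` by elements of `𝒮ℋ_m^o(X)`. -/
theorem exists_SHo_between (hm : 1 ≤ m) (hmn : m ≤ n) {X K : Set (Cn n)} (hX : IsCompact X)
    (hK : IsCompact K) (hKX : K ⊆ X) {φ : Cn n → EReal} (hφ : φ ∈ USC X) {g : Cn n → ℝ}
    (hg : ContinuousOn g X) (hφg : ∀ x ∈ X, φ x ≤ g x)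
    (hJ : ∀ z ∈ K, ∀ μ ∈ JensenMeasures m X z, φ z ≤ eintegral (μ.restrict X) φ) {ε : ℝ}
    (hε : 0 < ε) :
    ∃ v ∈ SHo m X, (∀ x ∈ X, v x ≤ g x) ∧ ∀ x ∈ K, φ x < ((v x + ε : ℝ) : EReal) := by
  refine hK.induction_on
    (p := fun s => ∃ v ∈ SHo m X, (∀ x ∈ X, v x ≤ g x) ∧ ∀ x ∈ s, φ x < ((v x + ε : ℝ) : EReal))
    ?_ ?_ ?_ ?_
  · obtain ⟨C, hC⟩ := hX.exists_bound_of_continuousOn hg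
    exact ⟨fun _ => -C, const_mem_SHo hm hmn X _,
      fun x hx => (abs_le.1 (hC x hx)).1, fun x hx => absurd hx (notMem_empty x)⟩
  · rintro s t hst ⟨v, hv, h1, h2⟩
    exact ⟨v, hv, h1, fun x hx => h2 x (hst hx)⟩
  · rintro s t ⟨v, hv, h1, h2⟩ ⟨w, hw, h3, h4⟩
    refine ⟨_, max_mem_SHo hm hmn hv hw, fun x hx => max_le (h1 x hx) (h3 x hx), fun x hx => ?_⟩
    rcases hx with hx | hx
    · exact (h2 x hx).trans_le (EReal.coe_le_coe_iff.2 (by linarith [le_max_left (v x) (w x)]))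
    · exact (h4 x hx).trans_le (EReal.coe_le_coe_iff.2 (by linarith [le_max_right (v x) (w x)]))
  · intro z hz
    -- Edwards' measure at z turns the Jensen inequality for φ into a minorant v of g with φ < v + ε
    -- at z, and semicontinuity spreads this to a neighborhood. The union step above joins
    -- neighborhoods by taking maxima.
    obtain ⟨μ, hμ, hμg⟩ := exists_jensenMeasure_integral_eq hm hmn hX (hKX hz) hg
    obtain ⟨v, hv, hvg, hlt⟩ := hμg ε hε
    have := hμ.2.1
    have h1 : φ z < ((v z + ε : ℝ) : EReal) :=
      ((hJ z hz μ hμ).trans (eintegral_le_setIntegral hX hg hφg)).trans_lt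
        (EReal.coe_lt_coe_iff.2 hlt)
    have h2 := eventually_usc_lt hφ.2 (hKX hz)
      (g := fun x => v x + ε) (((SHo_continuousOn hv).add continuousOn_const) z (hKX hz)) h1
    refine ⟨{y | φ y < ((v y + ε : ℝ) : EReal)}, ?_, v, hv, hvg, fun x hx => hx⟩
    exact nhdsWithin_mono z hKX h2

/-- Passing to the larger compact set leaves fewer test functions: one defined near the closure is
defined near the frontier. -/
theorem jensenMeasures_frontier_subset {Ω : Set (Cn n)} {z : Cn n} :
    JensenMeasures m (frontier Ω) z ⊆ JensenMeasures m (closure Ω) z := by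
  rintro μ ⟨hz, hμ, hμ0, hJ⟩
  have hsub : frontier Ω ⊆ closure Ω := frontier_subset_closure
  have h0 : μ (closure Ω)ᶜ = 0 := measure_mono_null (compl_subset_compl.2 hsub) hμ0
  have h1 : μ.restrict (frontier Ω) = μ := Measure.restrict_eq_self_of_ae_mem
    ((measure_eq_zero_iff_ae_notMem.1 hμ0).mono fun x hx => by simpa using hx)
  have h2 : μ.restrict (closure Ω) = μ := Measure.restrict_eq_self_of_ae_mem
    ((measure_eq_zero_iff_ae_notMem.1 h0).mono fun x hx => by simpa using hx)
  refine ⟨hsub hz, hμ, h0, ?_⟩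
  rintro v ⟨U, w, hU, hXU, hc, hw, hvw⟩
  have := hJ v ⟨U, w, hU, hsub.trans hXU, hc, hw, hvw.mono hsub⟩
  rw [h1] at this
  rw [h2]
  exact this

theorem SHCompact_frontier {Ω : Set (Cn n)} {φ : Cn n → EReal}
    (h : φ ∈ SHCompact m (closure Ω)) : φ ∈ SHCompact m (frontier Ω) := by
  have hsub : frontier Ω ⊆ closure Ω := frontier_subset_closure
  refine ⟨⟨fun z hz => h.1.1 z (hsub hz), h.1.2.mono hsub⟩, fun z hz μ hμ => ?_⟩
  have h1 : μ.restrict (frontier Ω) = μ := Measure.restrict_eq_self_of_ae_mem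
    ((measure_eq_zero_iff_ae_notMem.1 hμ.2.2.1).mono fun x hx => by simpa using hx)
  have hμ' := jensenMeasures_frontier_subset hμ
  have h2 : μ.restrict (closure Ω) = μ := Measure.restrict_eq_self_of_ae_mem
    ((measure_eq_zero_iff_ae_notMem.1 hμ'.2.2.1).mono fun x hx => by simpa using hx)
  have := h.2 z (hsub hz) μ hμ'
  rw [h2] at this
  rw [h1]
  exact this

theorem ballMeasure_compl {X : Set (Cn n)} {z : Cn n} {r : ℝ} (h : closedBall z r ⊆ X) :
    ballMeasure z r Xᶜ = 0 := by
  rw [ballMeasure, Measure.smul_apply, Measure.restrict_apply' isClosed_closedBall.measurableSet]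
  have : Xᶜ ∩ closedBall z r = ∅ := by
    rw [← disjoint_iff_inter_eq_empty]
    exact disjoint_compl_left_iff_subset.2 h
  simp [this]

theorem ballMeasure_restrict {X : Set (Cn n)} {z : Cn n} {r : ℝ} (h : closedBall z r ⊆ X) :
    (ballMeasure z r).restrict X = ballMeasure z r :=
  Measure.restrict_eq_self_of_ae_mem
    ((measure_eq_zero_iff_ae_notMem.1 (ballMeasure_compl h)).mono fun x hx => by simpa using hx)

/-- Normalized Lebesgue measures on balls contained in `X` are Jensen measures. -/
theorem ballMeasure_mem_jensenMeasures {X : Set (Cn n)} {z : Cn n} {r : ℝ} (hr : 0 < r)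
    (h : closedBall z r ⊆ X) : ballMeasure z r ∈ JensenMeasures m X z := by
  refine ⟨h (mem_closedBall_self hr.le), isProbabilityMeasure_ballMeasure z hr,
    ballMeasure_compl h, ?_⟩
  rintro v ⟨U, w, hU, hXU, hc, hw, hvw⟩
  have hi : IntegrableOn w (closedBall z r) :=
    (hc.mono (h.trans hXU)).integrableOn_compact (isCompact_closedBall z r)
  have h1 := hw.1.2.2 z (hXU (h (mem_closedBall_self hr.le))) r hr (h.trans hXU)
  rw [ballMean_eq, eintegral_coe (integrable_ballMeasure hr hi), EReal.coe_le_coe_iff] at h1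
  rw [ballMeasure_restrict h, hvw (h (mem_closedBall_self hr.le))]
  refine h1.trans_eq (integral_congr_ae (ae_ballMeasure ?_))
  exact (ae_restrict_iff' isClosed_closedBall.measurableSet).2
    (Eventually.of_forall fun x hx => (hvw (h hx)).symm)

theorem isSubharmonic_of_SHCompact {Ω : Set (Cn n)} {φ : Cn n → EReal}
    (h : φ ∈ SHCompact m (closure Ω)) : IsSubharmonic φ Ω := by
  refine ⟨fun z hz => h.1.1 z (subset_closure hz), h.1.2.mono subset_closure,
    fun z hz r hr hzr => ?_⟩
  have := h.2 z (subset_closure hz) _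
    (ballMeasure_mem_jensenMeasures hr (hzr.trans subset_closure))
  rwa [ballMeasure_restrict (hzr.trans subset_closure)] at this

/-- On the closure choose v_j in the cone with φ − 1/(j+1) < v_j ≤ f_j, where the continuous f_j
decrease to φ. Each v_j satisfies the differential inequality, and v_j → φ wherever φ is finite. -/
theorem isMSubharmonic_of_SHCompact (hm : 1 ≤ m) (hmn : m ≤ n) {Ω : Set (Cn n)}
    (hΩb : Bornology.IsBounded Ω) {φ : Cn n → EReal} (h : φ ∈ SHCompact m (closure Ω)) :
    IsMSubharmonic m φ Ω := by
  refine ⟨isSubharmonic_of_SHCompact h, fun A hA η h1 h2 h3 h4 hbot hint => ?_⟩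
  have hη : IsTestFn η Ω := ⟨h1, h2, h3, h4⟩
  obtain ⟨a, ha⟩ := exists_hessWedge_eq_sqSum hm hmn hA
  simp_rw [ha]
  have hX : IsCompact (closure Ω) := hΩb.isCompact_closure
  obtain ⟨f, hfc, hfa, hφf, hft⟩ := exists_antitone_continuous hX h.1
  choose v hv hvf hφv using fun j : ℕ => exists_SHo_between hm hmn hX hX subset_rfl h.1
    (hfc j).continuousOn (hφf j) h.2 (ε := 1 / ((j : ℝ) + 1)) (by positivity)
  have hvd : ∀ j, SubDist a (v j) Ω := by
    intro j
    obtain ⟨U, w, hU, hXU, hw, hvw⟩ := (mem_SHo_iff hm hmn).1 (hv j)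
    exact ((hw.2 A hA a ha).mono (subset_closure.trans hXU)).congr
      fun z hz => (hvw (subset_closure hz)).symm
  have hvc : ∀ j, ContinuousOn (v j) Ω := fun j => (SHo_continuousOn (hv j)).mono subset_closure
  have hlim : Tendsto (fun j => ∫ z, v j z * sqSum a η z) atTop
      (𝓝 (∫ z, (φ z).toReal * sqSum a η z)) := by
    -- The domination is |v_j| ≤ |φ| + 1 + |f_0|, because φ − 1 < v_j ≤ f_j ≤ f_0.
    have hb : Integrable fun z => (|(φ z).toReal| + (1 + |f 0 z|)) * sqSum a η z :=
      integrable_mul_sqSum hη.contDiff_two h2 (hint.abs.add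
        ((continuous_const.add (hfc 0).abs).continuousOn.integrableOn_compact h2)) a
    refine tendsto_integral_of_dominated_convergence _
      (fun j => (hη.integrable_mul (hvc j) a).aestronglyMeasurable) hb.norm ?_ ?_
    · intro j
      filter_upwards [(ae_restrict_iff' h2.measurableSet).1 hbot] with z hz
      by_cases hzK : z ∈ tsupport η
      · rw [norm_mul, norm_mul]
        refine mul_le_mul_of_nonneg_right ?_ (norm_nonneg _)
        have hzX : z ∈ closure Ω := subset_closure (h3 hzK)
        have e1 : ((φ z).toReal : EReal) = φ z := EReal.coe_toReal (h.1.1 z hzX) (hz hzK)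
        have e2 := hφv j z hzX
        rw [← e1, EReal.coe_lt_coe_iff] at e2
        have e3 : 1 / ((j : ℝ) + 1) ≤ 1 := by
          rw [div_le_one (by positivity)]
          have : (0 : ℝ) ≤ j := Nat.cast_nonneg j
          linarith
        have e4 : v j z ≤ f 0 z := (hvf j z hzX).trans (hfa z (Nat.zero_le j))
        rw [Real.norm_eq_abs, Real.norm_eq_abs]
        refine le_trans (abs_le.2 ⟨?_, ?_⟩) (le_abs_self _)
        · linarith [neg_abs_le (φ z).toReal, abs_nonneg (f 0 z)]
        · linarith [le_abs_self (f 0 z), abs_nonneg (φ z).toReal]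
      · simp [sqSum_eq_zero a hzK]
    · filter_upwards [(ae_restrict_iff' h2.measurableSet).1 hbot] with z hz
      by_cases hzK : z ∈ tsupport η
      · refine Tendsto.mul_const _ ?_
        have hzX : z ∈ closure Ω := subset_closure (h3 hzK)
        have e1 : ((φ z).toReal : EReal) = φ z := EReal.coe_toReal (h.1.1 z hzX) (hz hzK)
        have e2 : Tendsto (fun j => f j z) atTop (𝓝 (φ z).toReal) := by
          have := hft z hzX
          rw [← e1] at this
          exact EReal.tendsto_coe.1 this
        have e3 : Tendsto (fun j : ℕ => (φ z).toReal - 1 / ((j : ℝ) + 1)) atTop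
            (𝓝 (φ z).toReal) := by
          simpa using tendsto_const_nhds.sub (tendsto_one_div_add_atTop_nhds_zero_nat (𝕜 := ℝ))
        refine tendsto_of_tendsto_of_tendsto_of_le_of_le e3 e2 (fun j => ?_)
          fun j => hvf j z hzX
        have e4 := hφv j z hzX
        rw [← e1, EReal.coe_lt_coe_iff] at e4
        simp only
        linarith
      · simp [sqSum_eq_zero a hzK]
  exact ge_of_tendsto' hlim fun j => hvd j η hη

end Compact
-- Regularization of m-subharmonic functions by averages over balls.
section Regularization

open Topology Filter Metric

variable {n m : ℕ}

/-- The points of `Ω` near which `φ` is integrable. -/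
def integrabilitySet (φ : Cn n → EReal) (Ω : Set (Cn n)) : Set (Cn n) :=
  {z | ∃ r : ℝ, 0 < r ∧ closedBall z r ⊆ Ω ∧
    ∫⁻ x in closedBall z r, (-φ x).toENNReal ≠ ⊤}

/-- If the negative part had infinite integral, the ball average would be −∞, and the sub-mean value
inequality would force φ(w) = −∞. -/
theorem lintegral_neg_ne_top {φ : Cn n → EReal} {Ω : Set (Cn n)} (h : IsSubharmonic φ Ω)
    {w : Cn n} {r : ℝ} (hr : 0 < r) (hwr : closedBall w r ⊆ Ω) (hw : φ w ≠ ⊥) :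
    ∫⁻ x in closedBall w r, (-φ x).toENNReal ≠ ⊤ := by
  intro htop
  have h1 := h.2.2 w (hwr (mem_closedBall_self hr.le)) r hr hwr
  rw [ballMean, eintegral, lintegral_smul_measure, lintegral_smul_measure, htop, smul_eq_mul,
    smul_eq_mul, ENNReal.mul_top (ENNReal.inv_ne_zero.2 (volume_closedBall_ne_top w r)),
    EReal.coe_ennreal_top, EReal.sub_top] at h1
  exact hw (le_bot_iff.1 h1)

theorem integrabilitySet_subset (φ : Cn n → EReal) (Ω : Set (Cn n)) :
    integrabilitySet φ Ω ⊆ Ω := fun _ ⟨_, hr, hz, _⟩ => hz (mem_closedBall_self hr.le)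

theorem mem_integrabilitySet_of_mem_closedBall {φ : Cn n → EReal} {Ω : Set (Cn n)} {w z : Cn n}
    {r : ℝ} (hz : closedBall z r ⊆ Ω) (h : ∫⁻ x in closedBall z r, (-φ x).toENNReal ≠ ⊤)
    (hw : w ∈ ball z r) : w ∈ integrabilitySet φ Ω := by
  have hsub : closedBall w (r - dist w z) ⊆ closedBall z r :=
    closedBall_subset_closedBall' (by linarith)
  exact ⟨r - dist w z, sub_pos.2 hw, hsub.trans hz,
    ne_top_of_le_ne_top h (lintegral_mono_set hsub)⟩

theorem isOpen_integrabilitySet (φ : Cn n → EReal) (Ω : Set (Cn n)) :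
    IsOpen (integrabilitySet φ Ω) := by
  rw [isOpen_iff_mem_nhds]
  rintro z ⟨r, hr, hz, h⟩
  filter_upwards [ball_mem_nhds z hr] with w hw using
    mem_integrabilitySet_of_mem_closedBall hz h hw

theorem mem_integrabilitySet {φ : Cn n → EReal} {Ω : Set (Cn n)} (hΩ : IsOpen Ω)
    (h : IsSubharmonic φ Ω) {z : Cn n} (hz : z ∈ Ω) (hφ : φ z ≠ ⊥) :
    z ∈ integrabilitySet φ Ω := by
  obtain ⟨r, hr, hzr⟩ := nhds_basis_closedBall.mem_iff.1 (hΩ.mem_nhds hz)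
  exact ⟨r, hr, hzr, lintegral_neg_ne_top h hr hzr hφ⟩

/-- Near a point of non-integrability φ is identically −∞: a nearby w with φ(w) > −∞ would give
integrability on a ball around w that contains the point in its interior. -/
theorem isOpen_diff_integrabilitySet {φ : Cn n → EReal} {Ω : Set (Cn n)} (hΩ : IsOpen Ω)
    (h : IsSubharmonic φ Ω) : IsOpen (Ω \ integrabilitySet φ Ω) := by
  rw [isOpen_iff_mem_nhds]
  rintro z ⟨hz, hzG⟩
  obtain ⟨r, hr, hzr⟩ := nhds_basis_closedBall.mem_iff.1 (hΩ.mem_nhds hz)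
  have hbot : ∀ w ∈ ball z (r / 2), φ w = ⊥ := by
    intro w hw
    by_contra hne
    have hsub : closedBall w (r / 2) ⊆ Ω :=
      (closedBall_subset_closedBall' (by linarith [mem_ball.1 hw])).trans hzr
    exact hzG (mem_integrabilitySet_of_mem_closedBall hsub
      (lintegral_neg_ne_top h (by positivity) hsub hne) (mem_ball'.2 (mem_ball.1 hw)))
  filter_upwards [ball_mem_nhds z (half_pos hr)] with w hw
  refine ⟨hzr (ball_subset_closedBall (ball_subset_ball (by linarith) hw)), ?_⟩
  rintro ⟨s, hs, -, hfin⟩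
  refine hfin (top_unique ?_)
  set O := ball w s ∩ ball z (r / 2) with hO
  have hOo : IsOpen O := isOpen_ball.inter isOpen_ball
  calc (⊤ : ℝ≥0∞) = ∫⁻ _ in O, ⊤ := by
        rw [setLIntegral_const, ENNReal.top_mul (hOo.measure_pos volume
          ⟨w, mem_ball_self hs, hw⟩).ne']
    _ = ∫⁻ x in O, (-φ x).toENNReal := by
        refine setLIntegral_congr_fun hOo.measurableSet fun x hx => ?_
        simp [hbot x hx.2]
    _ ≤ ∫⁻ x in closedBall w s, (-φ x).toENNReal :=
        lintegral_mono_set (inter_subset_left.trans ball_subset_closedBall)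

/-- The integrability set and its complement in Ω are both open, so a ball, being connected, cannot
meet both. Components of Ω on which φ ≡ −∞ are thus kept apart from the averages. -/
theorem closedBall_subset_integrabilitySet {φ : Cn n → EReal} {Ω : Set (Cn n)} (hΩ : IsOpen Ω)
    (h : IsSubharmonic φ Ω) {z : Cn n} {δ : ℝ} (hδ : 0 < δ) (hzδ : closedBall z δ ⊆ Ω)
    (hz : z ∈ integrabilitySet φ Ω) : closedBall z δ ⊆ integrabilitySet φ Ω := by
  refine (convex_closedBall z δ).isPreconnected.subset_left_of_subset_union
    (isOpen_integrabilitySet φ Ω) (isOpen_diff_integrabilitySet hΩ h) disjoint_sdiff_right ?_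
    ⟨z, mem_closedBall_self hδ.le, hz⟩
  intro x hx
  by_cases hxG : x ∈ integrabilitySet φ Ω
  · exact Or.inl hxG
  · exact Or.inr ⟨hzδ hx, hxG⟩

theorem integrableOn_toReal {φ : Cn n → EReal} {Ω K : Set (Cn n)} (h : IsSubharmonic φ Ω)
    (hK : IsCompact K) (hKG : K ⊆ integrabilitySet φ Ω) :
    (∀ᵐ x ∂(volume.restrict K), φ x ≠ ⊥) ∧ IntegrableOn (fun x => (φ x).toReal) K := by
  have hKΩ := hKG.trans (integrabilitySet_subset φ Ω)
  have hfin : ∫⁻ x in K, (-φ x).toENNReal ≠ ⊤ := by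
    refine hK.induction_on (p := fun s => ∫⁻ x in s, (-φ x).toENNReal ≠ ⊤) (by simp)
      (fun s t hst ht => ne_top_of_le_ne_top ht (lintegral_mono_set hst))
      (fun s t hs ht => ne_top_of_le_ne_top (ENNReal.add_ne_top.2 ⟨hs, ht⟩)
        (lintegral_union_le _ s t)) fun z hz => ?_
    obtain ⟨r, hr, -, hfin⟩ := hKG hz
    exact ⟨closedBall z r, mem_nhdsWithin_of_mem_nhds (closedBall_mem_nhds z hr), hfin⟩
  have husc : φ ∈ USC K := ⟨fun z hz => h.1 z (hKΩ hz), h.2.1.mono hKΩ⟩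
  obtain ⟨M, hM⟩ := exists_real_upper_bound hK husc
  have : IsFiniteMeasure (volume.restrict K) :=
    ⟨by rw [Measure.restrict_apply_univ]; exact hK.measure_lt_top⟩
  exact integrable_toReal_of_lintegral_neg
    (aemeasurable_of_usc hK.measurableSet husc.2 volume)
    ((ae_restrict_iff' hK.measurableSet).2 (Eventually.of_forall hM)) hfin

/-- The real-valued average of `φ` over a closed ball. -/
def ballAverage (φ : Cn n → EReal) (δ : ℝ) (z : Cn n) : ℝ :=
  (volume.real (closedBall z δ))⁻¹ * ∫ x in closedBall z δ, (φ x).toReal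

theorem ballMean_eq_ballAverage {φ : Cn n → EReal} {Ω : Set (Cn n)} (h : IsSubharmonic φ Ω)
    {z : Cn n} {δ : ℝ} (hδ : 0 < δ) (hz : closedBall z δ ⊆ integrabilitySet φ Ω) :
    ballMean φ z δ = (ballAverage φ δ z : EReal) := by
  obtain ⟨h1, h2⟩ := integrableOn_toReal h (isCompact_closedBall z δ) hz
  rw [ballMean_eq, eintegral_toReal (integrable_ballMeasure hδ h2) (ae_ballMeasure ?_)
    (ae_ballMeasure h1), integral_ballMeasure, ballAverage]
  exact (ae_restrict_iff' isClosed_closedBall.measurableSet).2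
    (Eventually.of_forall fun x hx => h.1 x (integrabilitySet_subset φ Ω (hz hx)))

theorem le_ballAverage {φ : Cn n → EReal} {Ω : Set (Cn n)} (h : IsSubharmonic φ Ω)
    {z : Cn n} {δ : ℝ} (hδ : 0 < δ) (hz : closedBall z δ ⊆ integrabilitySet φ Ω) :
    φ z ≤ (ballAverage φ δ z : EReal) := by
  rw [← ballMean_eq_ballAverage h hδ hz]
  have := hz.trans (integrabilitySet_subset φ Ω)
  exact h.2.2 z (this (mem_closedBall_self hδ.le)) δ hδ this

theorem volume_real_closedBall (z : Cn n) (δ : ℝ) :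
    volume.real (closedBall z δ) = volume.real (closedBall (0 : Cn n) δ) := by
  rw [measureReal_def, measureReal_def, Measure.addHaar_closedBall_center]

/-- Dominated convergence: the indicator of the moving ball is continuous in its center except at
points of the limiting sphere, which is a null set. -/
theorem continuousOn_setIntegral_closedBall {f : Cn n → ℝ} {G O : Set (Cn n)} {δ : ℝ} (hδ : 0 < δ)
    (hf : ∀ K, IsCompact K → K ⊆ G → IntegrableOn f K) (hO : IsOpen O)
    (hOG : ∀ z ∈ O, closedBall z δ ⊆ G) :
    ContinuousOn (fun z => ∫ x in closedBall z δ, f x) O := by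
  intro z hz
  refine ContinuousAt.continuousWithinAt ?_
  obtain ⟨r, hr, hzr⟩ := nhds_basis_closedBall.mem_iff.1 (hO.mem_nhds hz)
  set K := cthickening δ (closedBall z r) with hK
  have hKc : IsCompact K := (isCompact_closedBall z r).cthickening
  have hKG : K ⊆ G := by
    rw [hK, (isCompact_closedBall z r).cthickening_eq_biUnion_closedBall hδ.le]
    exact iUnion₂_subset fun y hy => hOG y (hzr hy)
  have hfK := hf K hKc hKG
  have hsub : ∀ y ∈ closedBall z r, closedBall y δ ⊆ K := fun y hy =>
    closedBall_subset_cthickening hy δ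
  have heq : (fun y => ∫ x in closedBall y δ, f x) =
      fun y => ∫ x, (closedBall y δ).indicator f x :=
    funext fun y => (integral_indicator isClosed_closedBall.measurableSet).symm
  rw [heq]
  refine continuousAt_of_dominated (bound := fun x => ‖K.indicator f x‖) ?_ ?_ ?_ ?_
  · filter_upwards [closedBall_mem_nhds z hr] with y hy
    exact ((hfK.mono_set (hsub y hy)).integrable_indicator
      isClosed_closedBall.measurableSet).aestronglyMeasurable
  · filter_upwards [closedBall_mem_nhds z hr] with y hy
    refine Eventually.of_forall fun x => ?_
    exact norm_indicator_le_of_subset (hsub y hy) f x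
  · exact (hfK.integrable_indicator hKc.measurableSet).norm
  · have hs : ∀ᵐ x ∂(volume : Measure (Cn n)), x ∉ sphere z δ :=
      measure_eq_zero_iff_ae_notMem.1 (Measure.addHaar_sphere_of_ne_zero volume z hδ.ne')
    filter_upwards [hs] with x hx
    rcases lt_or_gt_of_ne (fun h => hx h : dist x z ≠ δ) with h | h
    · have : ∀ᶠ y in 𝓝 z, dist x y < δ :=
        (continuous_const.dist continuous_id).continuousAt.eventually_lt_const h
      refine (continuousAt_const (y := f x)).congr ?_
      filter_upwards [this] with y hy
      rw [indicator_of_mem (mem_closedBall.2 hy.le)]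
    · have : ∀ᶠ y in 𝓝 z, δ < dist x y :=
        (continuous_const.dist continuous_id).continuousAt.eventually_const_lt h
      refine (continuousAt_const (y := (0 : ℝ))).congr ?_
      filter_upwards [this] with y hy
      rw [indicator_of_notMem fun h' => (mem_closedBall.1 h').not_gt hy]

theorem tsupport_comp_add_right (η : Cn n → ℝ) (w : Cn n) :
    tsupport (fun y => η (y + w)) = (fun y => y + w) ⁻¹' tsupport η :=
  tsupport_comp_eq_preimage η (Homeomorph.addRight w)

/-- The average over balls of a function satisfying a differential inequality in the sense of
distributions satisfies the same inequality. -/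
theorem SubDist.setIntegral_closedBall {ι : Type*} [Fintype ι] {a : ι → Cn n} {f : Cn n → ℝ}
    {G O : Set (Cn n)} {δ : ℝ}
    (hδ : 0 < δ) (hf : ∀ K, IsCompact K → K ⊆ G → IntegrableOn f K)
    (hOG : ∀ z ∈ O, closedBall z δ ⊆ G) (h : SubDist a f G) :
    SubDist a (fun z => ∫ x in closedBall z δ, f x) O := by
  intro η hη
  set K := cthickening δ (tsupport η) with hK
  have hηc : IsCompact (tsupport η) := hη.compact
  have hKc : IsCompact K := hηc.cthickening
  have hKG : K ⊆ G := by
    rw [hK, hηc.cthickening_eq_biUnion_closedBall hδ.le]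
    exact iUnion₂_subset fun y hy => hOG y (hη.subset hy)
  have hsub : ∀ y ∈ tsupport η, closedBall y δ ⊆ K := fun y hy =>
    closedBall_subset_cthickening hy δ
  set F := K.indicator f with hF
  have hFi : Integrable F := (hf K hKc hKG).integrable_indicator hKc.measurableSet
  set B := closedBall (0 : Cn n) δ with hB
  set k : Cn n → ℝ := B.indicator fun _ => 1 with hk
  have hki : Integrable k := (integrableOn_const (volume_closedBall_ne_top 0 δ)).integrable_indicator
    isClosed_closedBall.measurableSet
  have hLc : Continuous (sqSum a η) := continuous_sqSum hη.contDiff_two a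
  obtain ⟨C, hC⟩ := (hasCompactSupport_sqSum hη.compact a).exists_bound_of_continuous hLc
  have hint : Integrable (Function.uncurry fun z w : Cn n => k w * F (z - w) * sqSum a η z)
      (volume.prod volume) := by
    have h1 : Integrable (fun p : Cn n × Cn n => k p.2 * F (p.1 - p.2)) (volume.prod volume) :=
      hki.convolution_integrand (ContinuousLinearMap.lsmul ℝ ℝ) hFi
    exact Integrable.mul_bdd (c := C) h1 (hLc.comp continuous_fst).aestronglyMeasurable
      (Eventually.of_forall fun p => hC p.1)
  -- The ball integral is a convolution with the indicator of a ball. By Fubini it is a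
  -- superposition of translates of f, and each translate is tested by moving the translation onto
  -- η.
  have h1 : ∀ z, (∫ x in closedBall z δ, f x) * sqSum a η z =
      ∫ w, k w * F (z - w) * sqSum a η z := by
    intro z
    rw [integral_mul_const]
    by_cases hz : z ∈ tsupport η
    · congr 1
      rw [← integral_indicator isClosed_closedBall.measurableSet,
        ← integral_sub_left_eq_self _ volume z]
      refine integral_congr_ae (Eventually.of_forall fun w => ?_)
      by_cases hw : w ∈ B
      · have hw' : z - w ∈ closedBall z δ := by
          rw [mem_closedBall, dist_eq_norm, sub_sub_cancel_left, norm_neg]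
          exact mem_closedBall_zero_iff.1 hw
        simp only [hk, hF, indicator_of_mem hw, indicator_of_mem hw',
          indicator_of_mem (hsub z hz hw'), one_mul]
      · have hw' : z - w ∉ closedBall z δ := by
          rw [mem_closedBall, dist_eq_norm, sub_sub_cancel_left, norm_neg]
          exact fun h => hw (mem_closedBall_zero_iff.2 h)
        simp only [hk, indicator_of_notMem hw, indicator_of_notMem hw', zero_mul]
    · rw [sqSum_eq_zero a hz, mul_zero, mul_zero]
  simp_rw [h1]
  rw [integral_integral_swap hint]
  refine integral_nonneg fun w => ?_
  simp_rw [mul_assoc]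
  rw [Pi.zero_apply, integral_const_mul]
  by_cases hw : w ∈ B
  · refine mul_nonneg (indicator_nonneg (fun _ _ => zero_le_one) _) ?_
    set ζ : Cn n → ℝ := fun y => η (y - -w) with hζ
    have hζs : tsupport ζ = (fun y => y + w) ⁻¹' tsupport η := by
      simp only [hζ, sub_neg_eq_add]
      exact tsupport_comp_add_right η w
    have hζK : tsupport ζ ⊆ K := by
      rw [hζs]
      intro y hy
      refine hsub _ hy ?_
      rw [mem_closedBall, dist_eq_norm, sub_add_cancel_left, norm_neg]
      exact mem_closedBall_zero_iff.1 hw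
    have hζt : IsTestFn ζ G := ⟨hη.smooth.comp (contDiff_id.sub contDiff_const),
      hKc.of_isClosed_subset (isClosed_tsupport _) hζK, hζK.trans hKG, fun z => hη.nonneg _⟩
    refine (h ζ hζt).trans_eq ?_
    rw [← integral_add_right_eq_self (fun z => F (z - w) * sqSum a η z) w]
    refine integral_congr_ae (Eventually.of_forall fun y => ?_)
    have e1 : sqSum a ζ y = sqSum a η (y + w) := by
      rw [hζ, sqSum_comp_sub, sub_neg_eq_add]
    simp only [add_sub_cancel_right, ← e1]
    by_cases hy : y ∈ tsupport ζ
    · rw [hF, indicator_of_mem (hζK hy)]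
    · rw [sqSum_eq_zero a hy, mul_zero, mul_zero]
  · rw [hk, indicator_of_notMem hw, zero_mul]

theorem subDist_toReal {φ : Cn n → EReal} {Ω : Set (Cn n)} (h : IsMSubharmonic m φ Ω)
    {A : Fin n → Matrix (Fin n) (Fin n) ℂ} (hA : ∀ i, A i ∈ Gam n m) {a : Fin n ⊕ Fin n → Cn n}
    (ha : ∀ η z, hessWedge m A η z = sqSum a η z) :
    SubDist a (fun x => (φ x).toReal) (integrabilitySet φ Ω) := by
  intro η hη
  obtain ⟨h1, h2⟩ := integrableOn_toReal h.1 hη.compact hη.subset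
  have := h.2 A hA η hη.smooth hη.compact (hη.subset.trans (integrabilitySet_subset φ Ω))
    hη.nonneg h1 h2
  simpa only [ha] using this

theorem contSH_ballAverage {φ : Cn n → EReal} {Ω O : Set (Cn n)} (h : IsMSubharmonic m φ Ω)
    (hO : IsOpen O) {δ : ℝ} (hδ : 0 < δ)
    (hOG : ∀ z ∈ O, closedBall z δ ⊆ integrabilitySet φ Ω) : ContSH m (ballAverage φ δ) O := by
  have hf : ∀ K, IsCompact K → K ⊆ integrabilitySet φ Ω →
      IntegrableOn (fun x => (φ x).toReal) K := fun K hK hKG => (integrableOn_toReal h.1 hK hKG).2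
  have hA : ContSH m (fun z => ∫ x in closedBall z δ, (φ x).toReal) O :=
    ⟨continuousOn_setIntegral_closedBall hδ hf hO hOG, fun A hA a ha =>
      (subDist_toReal h hA ha).setIntegral_closedBall hδ hf hOG⟩
  refine (hA.const_mul (c := (volume.real (closedBall (0 : Cn n) δ))⁻¹) (by positivity)).congr
    fun z _ => ?_
  rw [ballAverage, volume_real_closedBall z]

/-- The averages over small balls of an upper semicontinuous function stay below a continuous
strict majorant, uniformly on compact sets. -/
theorem exists_ballMean_le {φ : Cn n → EReal} {Ω K : Set (Cn n)} (hΩ : IsOpen Ω)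
    (hφ : UpperSemicontinuousOn φ Ω) (hK : IsCompact K) (hKΩ : K ⊆ Ω) {g : Cn n → ℝ}
    (hg : ContinuousOn g K) (h : ∀ x ∈ K, φ x < g x) :
    ∃ δ₀ : ℝ, 0 < δ₀ ∧ ∀ δ : ℝ, 0 < δ → δ ≤ δ₀ → ∀ x ∈ K, ballMean φ x δ ≤ g x := by
  refine hK.induction_on
    (p := fun s => ∃ δ₀ : ℝ, 0 < δ₀ ∧ ∀ δ : ℝ, 0 < δ → δ ≤ δ₀ → ∀ x ∈ s, ballMean φ x δ ≤ g x)
    ⟨1, one_pos, by simp⟩ ?_ ?_ ?_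
  · rintro s t hst ⟨d, hd, h1⟩
    exact ⟨d, hd, fun δ h2 h3 x hx => h1 δ h2 h3 x (hst hx)⟩
  · rintro s t ⟨d, hd, h1⟩ ⟨d', hd', h1'⟩
    refine ⟨min d d', lt_min hd hd', fun δ h2 h3 x hx => ?_⟩
    rcases hx with hx | hx
    · exact h1 δ h2 (h3.trans (min_le_left _ _)) x hx
    · exact h1' δ h2 (h3.trans (min_le_right _ _)) x hx
  · intro z hz
    -- A constant c strictly between φ(z) and g(z) bounds φ above on a ball of radius r and g below
    -- near z. Balls of radius at most r/4 centered in the half ball see only values φ < c.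
    obtain ⟨c, hc1, hc2⟩ := EReal.lt_iff_exists_real_btwn.1 (h z hz)
    have h1 : ∀ᶠ y in 𝓝 z, φ y < c := by
      have := hφ z (hKΩ hz) c hc1
      rwa [hΩ.nhdsWithin_eq (hKΩ hz)] at this
    obtain ⟨r, hr, hr1⟩ := Metric.eventually_nhds_iff_ball.1 h1
    have h2 : ∀ᶠ y in 𝓝[K] z, c < g y := (hg z hz).eventually_const_lt (EReal.coe_lt_coe_iff.1 hc2)
    refine ⟨{y | c < g y} ∩ ball z (r / 2),
      inter_mem h2 (mem_nhdsWithin_of_mem_nhds (ball_mem_nhds z (half_pos hr))), r / 4,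
      by positivity, fun δ hδ hδr x hx => ?_⟩
    have := isProbabilityMeasure_ballMeasure x hδ
    rw [ballMean_eq]
    have h3 : eintegral (ballMeasure x δ) φ ≤ ((∫ _, c ∂(ballMeasure x δ) : ℝ) : EReal) := by
      refine eintegral_le_integral (integrable_const c) (ae_ballMeasure ?_)
      refine (ae_restrict_iff' isClosed_closedBall.measurableSet).2
        (Eventually.of_forall fun y hy => (hr1 y ?_).le)
      have e1 := mem_closedBall.1 hy
      have e2 := mem_ball.1 hx.2
      exact mem_ball.2 (by linarith [dist_triangle y x z])
    rw [integral_const, probReal_univ, one_smul] at h3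
    exact h3.trans (EReal.coe_le_coe_iff.2 (le_of_lt hx.1))

end Regularization
-- The gluing construction, and part 2 of the theorem.
section Gluing

open Topology Filter Metric

variable {n m : ℕ}

/-- If `φ` is `m`-subharmonic in `Ω` and lies below `v + ε` on the boundary of `Ω`, with
`v ∈ 𝒮ℋ_m^o(Ω̄)`, then it lies below some `ψ + ε` on `Ω̄`, with `ψ ∈ 𝒮ℋ_m^o(Ω̄)`. -/
theorem exists_SHo_ge_sub (hm : 1 ≤ m) (hmn : m ≤ n) {Ω : Set (Cn n)} (hΩ : IsOpen Ω)
    (hΩb : Bornology.IsBounded Ω) {φ : Cn n → EReal} (hφ : IsMSubharmonic m φ Ω)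
    (hφX : φ ∈ USC (closure Ω)) {f : Cn n → ℝ} (hf : Continuous f)
    (hφf : ∀ x ∈ closure Ω, φ x ≤ f x) {v : Cn n → ℝ} (hv : v ∈ SHo m (closure Ω))
    (hvf : ∀ x ∈ closure Ω, v x ≤ f x) {ε : ℝ} (hε : 0 < ε)
    (hφv : ∀ x ∈ frontier Ω, φ x < ((v x + ε : ℝ) : EReal)) :
    ∃ ψ ∈ SHo m (closure Ω), (∀ x ∈ closure Ω, ψ x ≤ f x) ∧
      ∀ x ∈ closure Ω, φ x ≤ ((ψ x + ε : ℝ) : EReal) := by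
  have hX : IsCompact (closure Ω) := hΩb.isCompact_closure
  obtain ⟨U, w, hU, hXU, hw, hvw⟩ := (mem_SHo_iff hm hmn).1 hv
  have hΩX : Ω ⊆ closure Ω := subset_closure
  -- K is where v fails to dominate φ up to ε. It is closed by semicontinuity and avoids the
  -- boundary by `hφv`, so there is room in Ω to regularize φ around it.
  set K : Set (Cn n) := {x | x ∈ closure Ω ∧ ((v x + ε : ℝ) : EReal) ≤ φ x} with hK
  have hKX : K ⊆ closure Ω := fun x hx => hx.1
  have hKcl : IsClosed K := by
    refine isClosed_of_closure_subset fun x hx => ?_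
    have hxX : x ∈ closure Ω := closure_minimal hKX isClosed_closure hx
    refine ⟨hxX, not_lt.1 fun hlt => ?_⟩
    have h1 := eventually_usc_lt hφX.2 hxX (g := fun x => v x + ε)
      (((SHo_continuousOn hv).add continuousOn_const) x hxX) hlt
    obtain ⟨O, hO, hxO, hOX⟩ := mem_nhdsWithin.1 h1
    obtain ⟨y, hyO, hyK⟩ := mem_closure_iff.1 hx O hO hxO
    exact (hOX ⟨hyO, hyK.1⟩ : φ y < ((v y + ε : ℝ) : EReal)).not_ge hyK.2
  have hKc : IsCompact K := hX.of_isClosed_subset hKcl hKX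
  have hKΩ : K ⊆ Ω := by
    intro x hx
    by_contra hxΩ
    have : x ∈ frontier Ω := by
      rw [hΩ.frontier_eq]
      exact ⟨hx.1, hxΩ⟩
    exact (hφv x this).not_ge hx.2
  obtain ⟨r, hr, hrΩ⟩ := hKc.exists_cthickening_subset_open hΩ hKΩ
  set K' := cthickening r K with hK'
  have hK'c : IsCompact K' := hKc.cthickening
  -- On this collar φ < w + ε strictly, hence averages over small balls are at most w + ε and the
  -- maximum in `ψ` reduces to w.
  set S := K' ∩ (thickening (r / 2) K)ᶜ with hS
  have hSc : IsCompact S := hK'c.inter_right isOpen_thickening.isClosed_compl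
  have hwX : ContinuousOn w (closure Ω) := hw.1.mono hXU
  have hK'X : K' ⊆ closure Ω := hrΩ.trans hΩX
  obtain ⟨δ₁, hδ₁, hδ₁Ω⟩ := hK'c.exists_cthickening_subset_open hΩ hrΩ
  obtain ⟨δ₂, hδ₂, h2⟩ := exists_ballMean_le hΩ hφ.1.2.1 hK'c hrΩ (g := fun x => f x + ε)
    (hf.add continuous_const).continuousOn fun x hx => (hφf x (hK'X hx)).trans_lt
      (EReal.coe_lt_coe_iff.2 (by linarith))
  obtain ⟨δ₃, hδ₃, h3⟩ := exists_ballMean_le hΩ hφ.1.2.1 hSc (inter_subset_left.trans hrΩ)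
    (g := fun x => w x + ε) ((hwX.mono (inter_subset_left.trans hK'X)).add continuousOn_const)
    fun x hx => by
      have hxX := hK'X hx.1
      rw [← hvw hxX]
      refine not_le.1 fun hle => hx.2 ?_
      exact self_subset_thickening (half_pos hr) K ⟨hxX, hle⟩
  obtain ⟨δ, hδ, hδ12, hδ3⟩ : ∃ δ : ℝ, 0 < δ ∧ δ ≤ min δ₁ δ₂ ∧ δ ≤ δ₃ :=
    ⟨min (min δ₁ δ₂) δ₃, lt_min (lt_min hδ₁ hδ₂) hδ₃, min_le_left _ _, min_le_right _ _⟩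
  set G := integrabilitySet φ Ω with hG
  have hGo : IsOpen G := isOpen_integrabilitySet φ Ω
  have hball : ∀ z ∈ K' ∩ G, closedBall z δ ⊆ G := fun z hz =>
    closedBall_subset_integrabilitySet hΩ hφ.1 hδ
      ((closedBall_subset_closedBall (hδ12.trans (min_le_left _ _))).trans
        ((closedBall_subset_cthickening hz.1 δ₁).trans hδ₁Ω)) hz.2
  classical
  -- Outside G the number `ballAverage` is meaningless, because `toReal` sends −∞ to 0; there φ = −∞
  -- nearby and w alone suffices.
  set ψ : Cn n → ℝ := fun z =>
    if z ∈ K' ∩ G then max (ballAverage φ δ z - ε) (w z) else w z with hψ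
  have hwψ : ∀ z, w z ≤ ψ z := by
    intro z
    simp only [hψ]
    split_ifs
    · exact le_max_right _ _
    · exact le_rfl
  have hthick : thickening r K ⊆ K' := thickening_subset_cthickening r K
  set O₁ := thickening r K ∩ G with hO₁
  have hO₁o : IsOpen O₁ := isOpen_thickening.inter hGo
  have hO₁K : O₁ ⊆ K' ∩ G := inter_subset_inter_left _ hthick
  have hc₁ : ContSH m ψ O₁ := by
    have h1 : ContSH m (ballAverage φ δ) O₁ :=
      contSH_ballAverage hφ hO₁o hδ fun z hz => hball z (hO₁K hz)
    have h2 : ContSH m w O₁ := hw.mono fun z hz => hXU (hK'X (hO₁K hz).1)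
    refine ((h1.add (contSH_const (-ε) O₁)).max hO₁o h2).congr fun z hz => ?_
    simp only [hψ, if_pos (hO₁K hz), sub_eq_add_neg]
  -- G is not closed in the whole space, but it is relatively closed in Ω, and the smaller
  -- thickening lies inside Ω.
  have hcl : IsClosed (cthickening (r / 2) K ∩ G) := by
    have : cthickening (r / 2) K ∩ G = cthickening (r / 2) K ∩ (Ω \ G)ᶜ := by
      ext z
      refine and_congr_right fun hz => ?_
      have hzΩ : z ∈ Ω := hrΩ (cthickening_mono (by linarith) K hz)
      simp [hzΩ]
    rw [this]
    exact isClosed_cthickening.inter (isOpen_diff_integrabilitySet hΩ hφ.1).isClosed_compl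
  set O₂ := U ∩ (cthickening (r / 2) K ∩ G)ᶜ with hO₂
  have hO₂o : IsOpen O₂ := hU.inter hcl.isOpen_compl
  have hc₂ : ContSH m ψ O₂ := by
    refine (hw.mono inter_subset_left).congr fun z hz => ?_
    simp only [hψ]
    split_ifs with hzK
    · have hzS : z ∈ S := ⟨hzK.1, fun h =>
        hz.2 ⟨thickening_subset_cthickening _ _ h, hzK.2⟩⟩
      have := h3 δ hδ hδ3 z hzS
      rw [ballMean_eq_ballAverage hφ.1 hδ (hball z hzK), EReal.coe_le_coe_iff] at this
      rw [max_eq_right (by linarith)]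
    · rfl
  refine ⟨ψ, (mem_SHo_iff hm hmn).2 ⟨O₁ ∪ O₂, ψ, hO₁o.union hO₂o, fun z hz => ?_,
    hc₁.union hO₁o hO₂o hc₂, fun _ _ => rfl⟩, fun x hx => ?_, fun x hx => ?_⟩
  · by_cases h : z ∈ cthickening (r / 2) K ∩ G
    · exact Or.inl ⟨cthickening_subset_thickening' hr (by linarith) K h.1, h.2⟩
    · exact Or.inr ⟨hXU hz, h⟩
  · have hwf : w x ≤ f x := (hvw hx).symm.trans_le (hvf x hx)
    simp only [hψ]
    split_ifs with hxK
    · have := h2 δ hδ (hδ12.trans (min_le_right _ _)) x hxK.1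
      rw [ballMean_eq_ballAverage hφ.1 hδ (hball x hxK), EReal.coe_le_coe_iff] at this
      exact max_le (by linarith) hwf
    · exact hwf
  · by_cases hxK : x ∈ K
    · by_cases hxb : φ x = ⊥
      · rw [hxb]
        exact bot_le
      have hxG : x ∈ K' ∩ G :=
        ⟨self_subset_cthickening K hxK, mem_integrabilitySet hΩ hφ.1 (hKΩ hxK) hxb⟩
      refine (le_ballAverage hφ.1 hδ (hball x hxG)).trans (EReal.coe_le_coe_iff.2 ?_)
      simp only [hψ, if_pos hxG]
      linarith [le_max_left (ballAverage φ δ x - ε) (w x)]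
    · have : φ x < ((v x + ε : ℝ) : EReal) := not_le.1 fun h => hxK ⟨hx, h⟩
      refine this.le.trans (EReal.coe_le_coe_iff.2 ?_)
      rw [hvw hx]
      linarith [hwψ x]

/-- Boundary Jensen inequalities give v near φ on ∂Ω; gluing extends this to ψ on the whole closure,
and the Jensen inequality for ψ, which lies in the cone, yields φ(z) ≤ ∫ f_j dμ for every j. -/
theorem SHCompact_of_isMSubharmonic (hm : 1 ≤ m) (hmn : m ≤ n) {Ω : Set (Cn n)} (hΩ : IsOpen Ω)
    (hΩb : Bornology.IsBounded Ω) {φ : Cn n → EReal} (hφ : IsMSubharmonic m φ Ω)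
    (hφX : φ ∈ USC (closure Ω))
    (hJ : ∀ z ∈ frontier Ω, ∀ μ ∈ JensenMeasures m (closure Ω) z,
      φ z ≤ eintegral (μ.restrict (closure Ω)) φ) : φ ∈ SHCompact m (closure Ω) := by
  refine ⟨hφX, fun z hz μ hμ => ?_⟩
  have hX : IsCompact (closure Ω) := hΩb.isCompact_closure
  have := hμ.2.1
  obtain ⟨f, hfc, hfa, hφf, hft⟩ := exists_antitone_continuous hX hφX
  have hμX : μ.restrict (closure Ω) = μ := Measure.restrict_eq_self_of_ae_mem
    ((measure_eq_zero_iff_ae_notMem.1 hμ.2.2.1).mono fun x hx => by simpa using hx)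
  have hle : ∀ j, φ z ≤ ((∫ x in closure Ω, f j x ∂μ : ℝ) : EReal) := by
    intro j
    refine EReal.le_of_forall_lt_iff_le.1 fun c hc => ?_
    have hc' := EReal.coe_lt_coe_iff.1 hc
    -- Both approximations use ε = c − ∫ f_j dμ, so that ψ(z) + ε ≤ ∫ f_j dμ + ε = c.
    obtain ⟨v, hv, hvf, hφv⟩ := exists_SHo_between hm hmn hX
      (hX.of_isClosed_subset isClosed_frontier frontier_subset_closure) frontier_subset_closure
      hφX (hfc j).continuousOn (hφf j) hJ (sub_pos.2 hc')
    obtain ⟨ψ, hψ, hψf, hφψ⟩ := exists_SHo_ge_sub hm hmn hΩ hΩb hφ hφX (hfc j) (hφf j) hv hvf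
      (sub_pos.2 hc') hφv
    refine (hφψ z hz).trans (EReal.coe_le_coe_iff.2 ?_)
    have h1 := hμ.2.2.2 ψ hψ
    have h2 : ∫ x in closure Ω, ψ x ∂μ ≤ ∫ x in closure Ω, f j x ∂μ :=
      setIntegral_mono_on (integrableOn_of_continuousOn hX (SHo_continuousOn hψ))
        (integrableOn_of_continuousOn hX (hfc j).continuousOn) hX.measurableSet hψf
    linarith
  refine ge_of_tendsto' (tendsto_integral_eintegral
    (fun j => integrableOn_of_continuousOn hX (hfc j).continuousOn)
    (Eventually.of_forall hfa) ?_) hle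
  exact (ae_restrict_iff' hX.measurableSet).2 (Eventually.of_forall hft)

end Gluing
end MSubharmonic

end

theorem theorem2p8 {n m : ℕ} (hm : 1 ≤ m) (hmn : m ≤ n)
    (Ω : Set (MSubharmonic.Cn n)) (hΩ : IsOpen Ω) (hΩb : Bornology.IsBounded Ω) :
    (∀ φ : MSubharmonic.Cn n → EReal, φ ∈ MSubharmonic.SHCompact m (closure Ω) →
      MSubharmonic.IsMSubharmonic m φ Ω ∧ φ ∈ MSubharmonic.SHCompact m (frontier Ω)) ∧
    (∀ φ : MSubharmonic.Cn n → EReal,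
      MSubharmonic.IsMSubharmonic m φ Ω → φ ∈ MSubharmonic.USC (closure Ω) →
      (∀ z ∈ frontier Ω, ∀ μ ∈ MSubharmonic.JensenMeasures m (closure Ω) z,
        φ z ≤ MSubharmonic.eintegral (μ.restrict (closure Ω)) φ) →
      φ ∈ MSubharmonic.SHCompact m (closure Ω)) :=
  ⟨fun _ h => ⟨MSubharmonic.isMSubharmonic_of_SHCompact hm hmn hΩb h,
      MSubharmonic.SHCompact_frontier h⟩,
    fun _ hφ hφX hJ => MSubharmonic.SHCompact_of_isMSubharmonic hm hmn hΩ hΩb hφ hφX hJ⟩
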